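/- **Model.** A network is a finite directed graph $G=(V,A)$ on $n=|V|$ nodes with a sink $r\in V$ that has no outgoing arc and is reachable from every node; each node $v$ strictly ranks its out-neighbours. A routing graph gives each node at most one outgoing arc of $G$. Each node $v$ also keeps a routing path $\mathcal P(v)$, a list of nodes that may be empty. An out-neighbour $w$ of $v$ is a valid choice for $v$ if $\mathcal P(w)$ is non-empty and contains no node of the filtering list $\mathcal D(v)$. When $v$ is activated, it takes the arc to the valid choice $w$ that it prefers most and sets $\mathcal P(v):=v\,\mathcal P(w)$; if it has no valid choice, it takes no arc and sets $\mathcal P(v):=\emptyset$. The initial routing graph $\mathcal R_0$ is arbitrary. In round $t=1,2,\dots$, first every $\mathcal P(v)$ is set to the actual $v,r$-path in $\mathcal R_{t-1}$ (to $\emptyset$ if there is none; $\mathcal P(r)=(r)$); then the nodes other than $r$ are activated, each exactly once, in an order $\pi_t$, which gives $\mathcal R_t$; then every packet is forwarded along $\mathcal R_t$ for $n$ hops or until it reaches $r$, and a packet that is caught in a cycle may be put by an adversary at any node of this cycle. A sequence $\pi_1,\pi_2,\dots$ of such orders is a fair activation sequence. Before round 1 every node generates one packet. Round $t$ is imperfect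 if from some node a packet forwarded along $\mathcal R_t$ does not reach $r$. A spanning tree of $G$ directed towards $r$ is stable if each node other than $r$ prefers its parent to every other out-neighbour that is not one of its descendants in the tree. **Theorem.** Suppose that $\mathcal D(v)=\{v\}$ for every node $v$. Then for every initial routing graph there is a fair activation sequence such that 1. every packet has reached the sink, whatever the adversary does, by the end of round $\lfloor (n+1)/3\rfloor$ (that is, $n/3$ rounded to the nearest integer: $\lfloor n/3\rfloor$ if $n\not\equiv 2 \pmod 3$, and $\lceil n/3\rceil$ if $n\equiv 2\pmod 3$); 2. $\mathcal R_n$ is a stable spanning tree, and $\mathcal R_t=\mathcal R_n$ for all $t\ge n$; 3. at most $\lfloor n/3\rfloor$ of the rounds $t=1,2,\dots$ are imperfect. In particular, if $\mathcal R_t$ is a stable spanning tree for some $t\ge 1$, then all packets have reached the sink by the end of round $t$: they are routed no later than the network becomes stable. -/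

import Mathlib

/-- A network: a directed graph with a sink that has no outgoing arc and is reachable from every
node, together with a strict ranking by each node of its out-neighbours
(`rank v w < rank v x` means that `v` prefers `w` to `x`). -/
structure Network (V : Type*) where
  graph : Digraph V
  sink : V
  rank : V → V → ℕ
  rank_injOn : ∀ v, Set.InjOn (rank v) {w | graph.Adj v w}
  sink_no_out : ∀ w, ¬ graph.Adj sink w
  reaches_sink : ∀ v, Relation.ReflTransGen graph.Adj v sink

/-- A choice of at most one next hop for every node. -/
abbrev RoutingGraph (V : Type*) := V → Option V

/-- What the control plane stores: the chosen next hop of each node and its routing path,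
a list of nodes starting at the node itself. The list `[]` is the empty path. -/
structure ControlState (V : Type*) where
  next : RoutingGraph V
  path : V → List V

namespace RoutingGraph

variable {V : Type*}

/-- One hop along the routing graph; at a node without a next hop a packet does not move. -/
def hop (R : RoutingGraph V) (v : V) : V := (R v).getD v

/-- `x` is a descendant of `v` (possibly `v` itself): following next hops from `x` leads to `v`. -/
def IsDescendant (R : RoutingGraph V) (x v : V) : Prop := ∃ k : ℕ, R.hop^[k] x = v

/-- The path from `v` to `r` obtained by following at most `k` next hops, or `[]` if `r` is not
reached within `k` hops. -/
def pathWithin [DecidableEq V] (R : RoutingGraph V) (r : V) : ℕ → V → List V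
  | 0, v => if v = r then [r] else []
  | k + 1, v =>
    if v = r then [r]
    else match R v with
      | none => []
      | some w => if pathWithin R r k w = [] then [] else v :: pathWithin R r k w

end RoutingGraph

namespace Network

variable {V : Type*} (N : Network V)

/-- All arcs of the routing graph are arcs of the network. -/
def Compatible (R : RoutingGraph V) : Prop := ∀ v w, R v = some w → N.graph.Adj v w

/-- Route verification: each node learns its actual path to the sink in the routing graph
(the empty path if there is none). A simple path has fewer hops than there are nodes. -/
def verified [Fintype V] [DecidableEq V] (R : RoutingGraph V) : ControlState V where
  next := R
  path := fun v => R.pathWithin N.sink (Fintype.card V) v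

/-- For filtering lists `D`, the out-neighbour `w` is a valid choice for `v`: it has a nonempty
routing path, and this path avoids the filtering list of `v`. -/
def IsValid (D : V → Set V) (s : ControlState V) (v w : V) : Prop :=
  N.graph.Adj v w ∧ s.path w ≠ [] ∧ ∀ x ∈ s.path w, x ∉ D v

/-- `w` is the best valid choice of `v`. -/
def IsBestValid (D : V → Set V) (s : ControlState V) (v w : V) : Prop :=
  N.IsValid D s v w ∧ ∀ x, N.IsValid D s v x → x ≠ w → N.rank v w < N.rank v x

open Classical in
/-- Activation of `v`: it takes its best valid choice as next hop and extends the routing path of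
that node; if there is no valid choice, `v` takes the empty path and no next hop. -/
noncomputable def activate (D : V → Set V) (s : ControlState V) (v : V) : ControlState V :=
  if h : ∃ w, N.IsBestValid D s v w then
    { next := Function.update s.next v (some h.choose)
      path := Function.update s.path v (v :: s.path h.choose) }
  else
    { next := Function.update s.next v none
      path := Function.update s.path v [] }

/-- A fair activation sequence: in every round each non-sink node is activated exactly once.
Round `t + 1` activates the nodes in the order `π t`. -/
def IsFair (π : ℕ → List V) : Prop := ∀ t, (π t).Nodup ∧ ∀ v, v ∈ π t ↔ v ≠ N.sink

/-- The routing graph at the end of round `t` (for `t = 0` the initial one). Route verification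
takes place between consecutive rounds, so each round starts from the verified paths. -/
noncomputable def routing [Fintype V] [DecidableEq V] (D : V → Set V) (π : ℕ → List V)
    (R₀ : RoutingGraph V) : ℕ → RoutingGraph V
  | 0 => R₀
  | t + 1 => ((π t).foldl (N.activate D) (N.verified (routing D π R₀ t))).next

/-- `p t` is a possible position after round `t` of a packet that starts at `p 0`, where
`R t` is the routing graph in which packets are forwarded in round `t`. After `n` hops (`n` the
number of nodes) the packet is at the sink, or at a node without a next hop, or on a cycle; in the
last case the adversary may put it at any node of the cycle, that is, add further hops. -/
def IsTrajectory [Fintype V] (R : ℕ → RoutingGraph V) (p : ℕ → V) : Prop :=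
  ∀ t, ∃ k : ℕ, p (t + 1) = (R (t + 1)).hop^[Fintype.card V + k] (p t)

/-- Every node generates a packet at the beginning, and all packets, however the adversary acts,
have reached the sink by the end of round `m`. -/
def AllRoutedBy [Fintype V] (R : ℕ → RoutingGraph V) (m : ℕ) : Prop :=
  ∀ p : ℕ → V, IsTrajectory R p → p m = N.sink

/-- A round that forwards along `R` is imperfect: a packet at some node is not delivered. -/
def IsImperfect [Fintype V] (R : RoutingGraph V) : Prop :=
  ∃ v, R.hop^[Fintype.card V] v ≠ N.sink

/-- `R` is a spanning in-arborescence of the network rooted at the sink. -/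
def IsSpanningTree (R : RoutingGraph V) : Prop :=
  N.Compatible R ∧ ∀ v, R.IsDescendant v N.sink

/-- `R` is a spanning tree in which every node prefers its parent to each other out-neighbour that
is not one of its descendants. -/
def IsStableSpanningTree (R : RoutingGraph V) : Prop :=
  N.IsSpanningTree R ∧
    ∀ v w, R v = some w → ∀ x, N.graph.Adj v x → ¬ R.IsDescendant x v → x ≠ w →
      N.rank v w < N.rank v x

end Network

/-! The proof is an induction on the number of nodes, by contraction. Suppose a forest of arcs is in
use such that every tail prefers its arc to all out-neighbours outside the subtree below it
(`IsContraction`). These arcs never have to change again, so each tree behaves like one node. The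
trees form a smaller network (`Forest.quotient`), and every round there can be imitated in the
original one (`Sim`): when a tree is activated, its root chooses first and the other nodes follow
from the top down, each keeping its arc.

It therefore suffices that every routing graph admits a good round (`hasGoodRound`): one that
delivers all packets and fixes at least one arc, or one that fixes at least three arcs. Then `n - 1`
rounds reach a stable tree. An imperfect round removes three nodes and leaves at least two, so at
most `(n - 2) / 3` rounds are imperfect, and for `n ≥ 2` one of the first `(n + 1) / 3` rounds is
perfect. A perfect round brings every packet to the sink.

To find a good round, let every node point to its favourite out-neighbour. If all nodes reach some
routing path along favourites, the nodes off the path can take their favourites and the path can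
then be activated from the sink outwards, which delivers everything (`Start.hasGoodRound_of_hits`).
On the other hand, all nodes off a path that reach it along favourites, together with one node of
every disjoint set closed under favourites, can take their favourites in one round
(`Start.exists_takers`); three such nodes are enough. If neither argument applies, there are just
two cycles of favourites besides the sink, both of length two, `{b, o}` and `{b', o'}`, and the
network consists of a path from `b`, a path from `b'`, and the nodes `o` and `o'`. This case is
settled by `hasGoodRound_of_two_paths` and `hasGoodRound_of_three_leaves`. -/

/-! ### Routing graphs: walks along next hops and verified paths. -/

namespace RoutingGraph

variable {V : Type*}

/-- Following next hops from `x` leads to `y`. -/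
abbrev Leads (R : RoutingGraph V) : V → V → Prop :=
  Relation.ReflTransGen fun v w => R v = some w

theorem hop_of_eq_some {R : RoutingGraph V} {v w : V} (h : R v = some w) : R.hop v = w := by
  simp [hop, h]

theorem hop_of_eq_none {R : RoutingGraph V} {v : V} (h : R v = none) : R.hop v = v := by
  simp [hop, h]

theorem leads_hop (R : RoutingGraph V) (v : V) : R.Leads v (R.hop v) := by
  cases h : R v with
  | none => rw [hop_of_eq_none h]
  | some w => rw [hop_of_eq_some h]; exact .single h

theorem leads_iterate_hop (R : RoutingGraph V) (k : ℕ) (v : V) : R.Leads v (R.hop^[k] v) := by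
  induction k with
  | zero => exact .refl
  | succ k ih => rw [Function.iterate_succ_apply']; exact ih.trans (leads_hop R _)

theorem isDescendant_iff_leads {R : RoutingGraph V} {x v : V} :
    R.IsDescendant x v ↔ R.Leads x v := by
  constructor
  · rintro ⟨k, rfl⟩
    exact leads_iterate_hop R k x
  · intro h
    induction h with
    | refl => exact ⟨0, rfl⟩
    | tail _ hbc ih =>
      obtain ⟨k, rfl⟩ := ih
      exact ⟨k + 1, by rw [Function.iterate_succ_apply', hop_of_eq_some hbc]⟩

theorem Leads.eq_or_head {R : RoutingGraph V} {x y : V} (h : R.Leads x y) :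
    x = y ∨ ∃ w, R x = some w ∧ R.Leads w y := by
  rcases Relation.ReflTransGen.cases_head h with h | ⟨w, h₁, h₂⟩
  · exact .inl h
  · exact .inr ⟨w, h₁, h₂⟩

theorem Leads.eq_of_next_none {R : RoutingGraph V} {x y : V} (h : R.Leads x y) (hx : R x = none) :
    x = y := by
  rcases h.eq_or_head with h | ⟨w, h₁, -⟩
  · exact h
  · simp [hx] at h₁

/-- Of two nodes on the way from `x`, one leads to the other. -/
theorem Leads.total {R : RoutingGraph V} {x y z : V} (h₁ : R.Leads x y) (h₂ : R.Leads x z) :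
    R.Leads y z ∨ R.Leads z y :=
  Relation.ReflTransGen.total_of_right_unique
    (fun a b c hb hc => by simp_all) h₁ h₂

theorem Leads.mono {R R' : RoutingGraph V} (h : ∀ v w, R v = some w → R' v = some w) {x y : V}
    (hxy : R.Leads x y) : R'.Leads x y :=
  Relation.ReflTransGen.mono (fun v w => h v w) x y hxy

theorem iterate_hop_of_next_none {R : RoutingGraph V} {r : V} (hr : R r = none) (k : ℕ) :
    R.hop^[k] r = r :=
  Function.iterate_fixed (hop_of_eq_none hr) k

/-- A node that leads to `r` does so within `card V` hops. -/
theorem exists_lt_card_iterate_hop [Fintype V] {R : RoutingGraph V} {r v : V}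
    (h : R.Leads v r) : ∃ k < Fintype.card V, R.hop^[k] v = r := by
  classical
  obtain ⟨k, hk⟩ := isDescendant_iff_leads.2 h
  have hex : ∃ k, R.hop^[k] v = r := ⟨k, hk⟩
  -- If the first visit to `r` came later, a node would repeat before it, and cutting out the loop
  -- would give an earlier visit.
  refine ⟨Nat.find hex, ?_, Nat.find_spec hex⟩
  by_contra hcard
  have hcard' : Fintype.card V < Fintype.card (Fin (Nat.find hex + 1)) := by
    rw [Fintype.card_fin]; omega
  obtain ⟨i, j, hij, he⟩ := Fintype.exists_ne_map_eq_of_card_lt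
    (fun i : Fin (Nat.find hex + 1) => R.hop^[i] v) hcard'
  wlog hlt : i < j generalizing i j
  · exact this j i hij.symm he.symm (lt_of_le_of_ne (not_lt.1 hlt) hij.symm)
  have hj : (j : ℕ) ≤ Nat.find hex := by omega
  have hlt' : (i : ℕ) < j := hlt
  refine Nat.find_min hex (m := Nat.find hex - j + i) (by omega) ?_
  rw [Function.iterate_add_apply, he, ← Function.iterate_add_apply]
  rw [Nat.sub_add_cancel hj]
  exact Nat.find_spec hex

theorem iterate_hop_card_add [Fintype V] {R : RoutingGraph V} {r v : V}
    (hr : R r = none) (h : R.Leads v r) (k : ℕ) : R.hop^[Fintype.card V + k] v = r := by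
  obtain ⟨j, hj, hjr⟩ := exists_lt_card_iterate_hop h
  obtain ⟨i, hi⟩ := Nat.exists_eq_add_of_lt hj
  rw [show Fintype.card V + k = (i + 1 + k) + j by omega, Function.iterate_add_apply, hjr,
    iterate_hop_of_next_none hr]

section pathWithin

variable [DecidableEq V] {R : RoutingGraph V} {r : V}

theorem pathWithin_self (k : ℕ) : R.pathWithin r k r = [r] := by
  cases k <;> simp [pathWithin]

theorem pathWithin_ne_nil_iff (hr : R r = none) (k : ℕ) (v : V) :
    R.pathWithin r k v ≠ [] ↔ R.hop^[k] v = r := by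
  induction k generalizing v with
  | zero => by_cases h : v = r <;> simp [pathWithin, h]
  | succ k ih =>
    by_cases h : v = r
    · subst h
      simp [pathWithin_self, iterate_hop_of_next_none hr]
    · rw [Function.iterate_succ_apply]
      cases hv : R v with
      | none =>
        rw [hop_of_eq_none hv, iterate_hop_of_next_none hv]
        simp [pathWithin, h, hv]
      | some w =>
        rw [hop_of_eq_some hv, ← ih w]
        by_cases hw : R.pathWithin r k w = [] <;> simp [pathWithin, h, hv, hw]

/-- Once the sink is reached, further fuel is irrelevant. This turns the recursion on fuel into a
recursion along next hops with the fuel fixed. -/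
theorem pathWithin_succ_of_ne_nil {k : ℕ} {v : V}
    (h : R.pathWithin r k v ≠ []) : R.pathWithin r (k + 1) v = R.pathWithin r k v := by
  induction k generalizing v with
  | zero =>
    have : v = r := by by_contra hv; simp [pathWithin, hv] at h
    subst this
    simp [pathWithin_self]
  | succ k ih =>
    by_cases hv : v = r
    · subst hv; simp [pathWithin_self]
    · cases hR : R v with
      | none => simp [pathWithin, hv, hR] at h
      | some w =>
        have hw : R.pathWithin r k w ≠ [] := by
          intro hw; simp [pathWithin, hv, hR, hw] at h
        rw [pathWithin, pathWithin]
        simp only [hv, hR, if_false, ih hw]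

theorem pathWithin_eq_cons {k : ℕ} {v : V} (hv : v ≠ r) (h : R.pathWithin r k v ≠ []) :
    ∃ w, R v = some w ∧ R.pathWithin r k w ≠ [] ∧
      R.pathWithin r k v = v :: R.pathWithin r k w := by
  cases k with
  | zero => simp [pathWithin, hv] at h
  | succ k =>
    cases hR : R v with
    | none => simp [pathWithin, hv, hR] at h
    | some w =>
      have hw : R.pathWithin r k w ≠ [] := by
        intro hw; simp [pathWithin, hv, hR, hw] at h
      refine ⟨w, rfl, ?_, ?_⟩
      · rwa [pathWithin_succ_of_ne_nil hw]
      · rw [pathWithin_succ_of_ne_nil hw, pathWithin]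
        simp [hv, hR, hw]

end pathWithin

end RoutingGraph

/-! ### The effect of one choice on walks. -/

open Classical in
/-- The state after `v` has chosen the next hop `w`. -/
noncomputable def ControlState.choose {V : Type*} (s : ControlState V) (v w : V) :
    ControlState V where
  next := Function.update s.next v (some w)
  path := Function.update s.path v (v :: s.path w)

namespace ControlState

variable {V : Type*} (s : ControlState V) (v w : V)

@[simp] theorem choose_path_self : (s.choose v w).path v = v :: s.path w := by simp [choose]

@[simp] theorem choose_next_self : (s.choose v w).next v = some w := by simp [choose]

variable {v} in
theorem choose_path_of_ne {x : V} (h : x ≠ v) : (s.choose v w).path x = s.path x := by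
  simp [choose, h]

variable {v} in
theorem choose_next_of_ne {x : V} (h : x ≠ v) : (s.choose v w).next x = s.next x := by
  simp [choose, h]

/-- A path after the choice is an old one, or continues from the old path through `v` along
the path of `w`. -/
theorem leads_or_of_leads_choose {x y : V} (h : (s.choose v w).next.Leads x y) :
    s.next.Leads x y ∨ s.next.Leads x v ∧ (s.choose v w).next.Leads w y := by
  induction h using Relation.ReflTransGen.head_induction_on with
  | refl => exact .inl .refl
  | @head a c hac hcy ih =>
    by_cases ha : a = v
    · subst ha
      simp only [choose_next_self, Option.some.injEq] at hac
      subst hac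
      exact .inr ⟨.refl, hcy⟩
    · rw [choose_next_of_ne _ _ ha] at hac
      rcases ih with ih | ⟨ih, ih'⟩
      · exact .inl (.head hac ih)
      · exact .inr ⟨.head hac ih, ih'⟩

theorem leads_choose_or {x y : V} (h : s.next.Leads x y) :
    (s.choose v w).next.Leads x y ∨ (s.choose v w).next.Leads x v := by
  induction h using Relation.ReflTransGen.head_induction_on with
  | refl => exact .inl .refl
  | @head a c hac hcy ih =>
    by_cases ha : a = v
    · subst ha; exact .inr .refl
    · rw [← choose_next_of_ne s w ha] at hac
      exact ih.imp (.head hac) (.head hac)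

theorem leads_of_leads_choose {x y : V} (hx : ¬ s.next.Leads x v)
    (h : (s.choose v w).next.Leads x y) : s.next.Leads x y :=
  (s.leads_or_of_leads_choose v w h).resolve_right fun h => hx h.1

theorem leads_choose {x y : V} (hx : ¬ s.next.Leads x v)
    (h : s.next.Leads x y) : (s.choose v w).next.Leads x y :=
  (s.leads_choose_or v w h).resolve_right fun h => hx (s.leads_of_leads_choose v w hx h)

end ControlState

/-! ### Valid choices and consistent states. -/

namespace Network

variable {V : Type*} (N : Network V)

/-- Filtering lists that contain just the node itself. -/
abbrev selfFilter (V : Type*) : V → Set V := fun v => {v}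

theorem isValid_iff {s : ControlState V} {v w : V} :
    N.IsValid (selfFilter V) s v w ↔ N.graph.Adj v w ∧ s.path w ≠ [] ∧ v ∉ s.path w := by
  unfold IsValid
  refine and_congr_right fun _ => and_congr_right fun _ => ?_
  simp only [selfFilter, Set.mem_singleton_iff]
  exact ⟨fun h hv => h v hv rfl, fun h x hx hxv => h (hxv ▸ hx)⟩

theorem IsBestValid.unique {N : Network V} {D : V → Set V} {s : ControlState V} {v w x : V}
    (hw : N.IsBestValid D s v w) (hx : N.IsBestValid D s v x) : x = w := by
  by_contra h
  exact absurd (hw.2 x hx.1 h) (not_lt.2 (hx.2 w hw.1 (Ne.symm h)).le)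

theorem activate_eq_choose {N : Network V} {D : V → Set V} {s : ControlState V} {v w : V}
    (h : N.IsBestValid D s v w) : N.activate D s v = s.choose v w := by
  have hex : ∃ w, N.IsBestValid D s v w := ⟨w, h⟩
  have he : hex.choose = w := h.unique hex.choose_spec
  unfold activate
  rw [dif_pos hex, he]
  rfl

theorem exists_best_of_exists {v : V} {p : V → Prop} (hp : ∃ w, N.graph.Adj v w ∧ p w) :
    ∃ w, (N.graph.Adj v w ∧ p w) ∧
      ∀ x, N.graph.Adj v x → p x → x ≠ w → N.rank v w < N.rank v x := by
  classical
  obtain ⟨w, hw, hmin⟩ := exists_minimal_of_wellFoundedLT (α := ℕ)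
    (fun k => ∃ w, (N.graph.Adj v w ∧ p w) ∧ N.rank v w = k)
    (by obtain ⟨w, hw⟩ := hp; exact ⟨_, w, hw, rfl⟩)
  obtain ⟨w₀, hw₀, rfl⟩ := hw
  refine ⟨w₀, hw₀, fun x hx hpx hne => ?_⟩
  refine lt_of_le_of_ne ?_ fun he => hne (N.rank_injOn v hx hw₀.1 he.symm)
  by_contra! hlt
  exact absurd (hmin ⟨x, ⟨hx, hpx⟩, rfl⟩ hlt.le) (not_le.2 hlt)

theorem exists_isBestValid {D : V → Set V} {s : ControlState V} {v : V}
    (h : ∃ w, N.IsValid D s v w) : ∃ w, N.IsBestValid D s v w := by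
  obtain ⟨w, hw⟩ := h
  obtain ⟨w, hw, hbest⟩ := N.exists_best_of_exists
    (p := fun w => s.path w ≠ [] ∧ ∀ x ∈ s.path w, x ∉ D v) ⟨w, hw⟩
  exact ⟨w, hw, fun x hx => hbest x hx.1 hx.2⟩

theorem Compatible.sink_eq_none {N : Network V} {R : RoutingGraph V} (hR : N.Compatible R) :
    R N.sink = none := by
  cases h : R N.sink with
  | none => rfl
  | some w => exact absurd (hR _ _ h) (N.sink_no_out w)

section verified

variable [Fintype V] [DecidableEq V] {R : RoutingGraph V}

theorem verified_path_sink : (N.verified R).path N.sink = [N.sink] :=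
  RoutingGraph.pathWithin_self _

theorem verified_path_eq_cons {v : V} (hv : v ≠ N.sink) (h : (N.verified R).path v ≠ []) :
    ∃ w, R v = some w ∧ (N.verified R).path w ≠ [] ∧
      (N.verified R).path v = v :: (N.verified R).path w :=
  RoutingGraph.pathWithin_eq_cons hv h

variable {N}

theorem verified_path_ne_nil_iff (hR : N.Compatible R) (v : V) :
    (N.verified R).path v ≠ [] ↔ R.Leads v N.sink := by
  refine (RoutingGraph.pathWithin_ne_nil_iff hR.sink_eq_none _ v).trans ⟨fun h => ?_, fun h => ?_⟩
  · exact RoutingGraph.isDescendant_iff_leads.1 ⟨_, h⟩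
  · exact RoutingGraph.iterate_hop_card_add hR.sink_eq_none h 0

omit [DecidableEq V] in
theorem not_isImperfect_iff (hR : N.Compatible R) :
    ¬ N.IsImperfect R ↔ ∀ v, R.Leads v N.sink := by
  unfold IsImperfect
  push Not
  refine forall_congr' fun v => ⟨fun h => ?_, fun h => ?_⟩
  · exact RoutingGraph.isDescendant_iff_leads.1 ⟨_, h⟩
  · exact RoutingGraph.iterate_hop_card_add hR.sink_eq_none h 0

end verified

variable {N}

/-- The routing paths are the actual paths along the next hops. -/
structure Consistent (N : Network V) (s : ControlState V) : Prop where
  compat : N.Compatible s.next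
  sink_path : s.path N.sink = [N.sink]
  path_eq : ∀ x ≠ N.sink, s.path x ≠ [] →
    ∃ w, s.next x = some w ∧ s.path w ≠ [] ∧ s.path x = x :: s.path w

theorem consistent_verified [Fintype V] [DecidableEq V] {R : RoutingGraph V}
    (hR : N.Compatible R) : N.Consistent (N.verified R) where
  compat := hR
  sink_path := N.verified_path_sink
  path_eq _ hx h := N.verified_path_eq_cons hx h

namespace Consistent

variable {s : ControlState V} (c : N.Consistent s)
include c

theorem mem_self {x : V} (h : s.path x ≠ []) : x ∈ s.path x := by
  by_cases hx : x = N.sink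
  · subst hx; simp [c.sink_path]
  · obtain ⟨w, -, -, he⟩ := c.path_eq x hx h
    simp [he]

/-- A stored path is its first node followed by the stored path of the next hop, so each of its
nodes starts a suffix. Comparing lengths of suffixes then excludes cycles among stored paths. -/
theorem suffix_of_mem {x y : V} (h : y ∈ s.path x) : s.path y <:+ s.path x := by
  induction hn : (s.path x).length generalizing x with
  | zero => rw [List.length_eq_zero_iff.1 hn] at h; simp at h
  | succ n ih =>
    by_cases hx : x = N.sink
    · subst hx
      rw [c.sink_path, List.mem_singleton] at h
      rw [h]
    · obtain ⟨w, -, -, he⟩ := c.path_eq x hx (by intro h0; simp [h0] at h)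
      rw [he] at h
      rcases List.mem_cons.1 h with rfl | h
      · exact List.suffix_rfl
      · rw [he] at hn ⊢
        exact (ih h (by simpa using hn)).trans (List.suffix_cons _ _)

theorem ne_nil_of_mem {x y : V} (h : y ∈ s.path x) : s.path y ≠ [] := by
  induction hn : (s.path x).length generalizing x with
  | zero => rw [List.length_eq_zero_iff.1 hn] at h; simp at h
  | succ n ih =>
    have hne : s.path x ≠ [] := by intro h0; simp [h0] at h
    by_cases hx : x = N.sink
    · subst hx
      rw [c.sink_path, List.mem_singleton] at h
      rw [h]; exact hne
    · obtain ⟨w, -, -, he⟩ := c.path_eq x hx hne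
      rw [he] at h
      rcases List.mem_cons.1 h with rfl | h
      · exact hne
      · rw [he] at hn
        exact ih h (by simpa using hn)

theorem eq_of_path_eq {x y : V} (hx : s.path x ≠ []) (h : s.path x = s.path y) : x = y := by
  have hhead : ∀ z, s.path z ≠ [] → (s.path z).head? = some z := by
    intro z hz
    by_cases hzr : z = N.sink
    · subst hzr; simp [c.sink_path]
    · obtain ⟨w, -, -, he⟩ := c.path_eq z hzr hz
      simp [he]
  have h₁ := hhead x hx
  rw [h, hhead y (h ▸ hx)] at h₁
  simpa using h₁.symm

theorem length_lt_of_mem {x y : V} (h : y ∈ s.path x) (hne : y ≠ x) :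
    (s.path y).length < (s.path x).length := by
  have hs := c.suffix_of_mem h
  refine lt_of_le_of_ne hs.length_le fun he => hne ?_
  exact c.eq_of_path_eq (c.ne_nil_of_mem h) (hs.eq_of_length he)

theorem eq_of_mem_of_mem {x y : V} (h : y ∈ s.path x) (h' : x ∈ s.path y) : x = y := by
  by_contra hne
  exact lt_asymm (c.length_lt_of_mem h (Ne.symm hne)) (c.length_lt_of_mem h' hne)

theorem mem_trans {x y z : V} (h : y ∈ s.path x) (h' : z ∈ s.path y) : z ∈ s.path x :=
  (c.suffix_of_mem h).subset h'

theorem notMem_next {x w : V} (h : s.path x = x :: s.path w) : x ∉ s.path w := by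
  intro hx
  have := (c.suffix_of_mem hx).length_le
  rw [h] at this
  simp at this

/-- Of two nodes on a routing path, the one with the shorter path lies on the path of the other. -/
theorem mem_path_of_length_le {x y z : V} (hy : y ∈ s.path x) (hz : z ∈ s.path x)
    (h : (s.path y).length ≤ (s.path z).length) : y ∈ s.path z :=
  (List.suffix_of_suffix_length_le (c.suffix_of_mem hy) (c.suffix_of_mem hz) h).subset
    (c.mem_self (c.ne_nil_of_mem hy))

theorem sink_mem {x : V} (h : s.path x ≠ []) : N.sink ∈ s.path x := by
  induction hn : (s.path x).length generalizing x with
  | zero => exact absurd (List.length_eq_zero_iff.1 hn) h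
  | succ n ih =>
    by_cases hx : x = N.sink
    · subst hx; exact c.mem_self h
    · obtain ⟨w, -, hw, he⟩ := c.path_eq x hx h
      rw [he] at hn ⊢
      exact List.mem_cons_of_mem _ (ih hw (by simpa using hn))

theorem leads_of_mem {x y : V} (h : y ∈ s.path x) : s.next.Leads x y := by
  induction hn : (s.path x).length generalizing x with
  | zero => rw [List.length_eq_zero_iff.1 hn] at h; simp at h
  | succ n ih =>
    by_cases hx : x = N.sink
    · subst hx
      rw [c.sink_path, List.mem_singleton] at h
      rw [h]
    · obtain ⟨w, hw, -, he⟩ := c.path_eq x hx (by intro h0; simp [h0] at h)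
      rw [he] at h hn
      rcases List.mem_cons.1 h with rfl | h
      · exact .refl
      · exact .head hw (ih h (by simpa using hn))

theorem mem_of_leads {x y : V} (hx : s.path x ≠ []) (h : s.next.Leads x y) : y ∈ s.path x := by
  induction h with
  | refl => exact c.mem_self hx
  | @tail a b _ hab ih =>
    refine c.mem_trans ih ?_
    have ha : a ≠ N.sink := by
      rintro rfl; rw [c.compat.sink_eq_none] at hab; cases hab
    obtain ⟨w, hw, hw', he⟩ := c.path_eq a ha (c.ne_nil_of_mem ih)
    rw [hw, Option.some.injEq] at hab
    subst hab
    rw [he]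
    exact List.mem_cons_of_mem _ (c.mem_self hw')

theorem mem_path_iff {x y : V} : y ∈ s.path x ↔ s.path x ≠ [] ∧ s.next.Leads x y :=
  ⟨fun h => ⟨List.ne_nil_of_mem h, c.leads_of_mem h⟩, fun h => c.mem_of_leads h.1 h.2⟩

end Consistent

/-! ### Invariants of a round, and favourites. -/

/-- What persists in a round that starts in the state `s₀`, when the nodes of `Z` have been
activated and `s` is the current state. -/
structure Inv (N : Network V) (s₀ s : ControlState V) (Z : Set V) : Prop where
  sink_notMem : N.sink ∉ Z
  compat : N.Compatible s.next
  sink_path : s.path N.sink = [N.sink]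
  frame_path : ∀ y ∉ Z, s.path y = s₀.path y
  frame_next : ∀ y ∉ Z, s.next y = s₀.next y
  mem_self : ∀ x, s.path x ≠ [] → x ∈ s.path x
  -- Stored paths may become stale during a round. What survives is that a path through a node still
  -- to be activated contains the whole path of that node, as a set.
  sub : ∀ y ∉ Z, ∀ x, y ∈ s.path x → s.path y ≠ [] ∧ s.path y ⊆ s.path x
  activated : ∀ y ∈ Z, s.path y ≠ [] ∧ s.next y ≠ none
  -- The old next hop stays a valid choice, so a node with a path is never left without one by its
  -- activation.
  next_spec : ∀ y ∉ Z, y ≠ N.sink → s.path y ≠ [] →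
    ∃ w, s.next y = some w ∧ w ∈ s.path y ∧ s.path w ≠ [] ∧ y ∉ s.path w

theorem Consistent.inv {s : ControlState V} (c : N.Consistent s) {Z : Set V} (hZ : N.sink ∉ Z)
    (hZs : ∀ y ∈ Z, s.path y ≠ []) : N.Inv s s Z where
  sink_notMem := hZ
  compat := c.compat
  sink_path := c.sink_path
  frame_path _ _ := rfl
  frame_next _ _ := rfl
  mem_self _ := c.mem_self
  sub _ _ _ h := ⟨c.ne_nil_of_mem h, (c.suffix_of_mem h).subset⟩
  activated y hy := by
    obtain ⟨w, hw, -⟩ := c.path_eq y (by rintro rfl; exact hZ hy) (hZs y hy)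
    exact ⟨hZs y hy, by simp [hw]⟩
  next_spec y _ hy h := by
    obtain ⟨w, hw, hw', he⟩ := c.path_eq y hy h
    exact ⟨w, hw, by rw [he]; exact List.mem_cons_of_mem _ (c.mem_self hw'), hw',
      c.notMem_next he⟩

/-- `h v` is the out-neighbour that `v` prefers to all others except `v` itself. -/
structure IsFavourite (N : Network V) (h : V → V) : Prop where
  sink : h N.sink = N.sink
  ne : ∀ v ≠ N.sink, h v ≠ v
  adj : ∀ v ≠ N.sink, N.graph.Adj v (h v)
  lt : ∀ v ≠ N.sink, ∀ x, N.graph.Adj v x → x ≠ v → x ≠ h v → N.rank v (h v) < N.rank v x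

theorem exists_adj_ne {v : V} (hv : v ≠ N.sink) : ∃ w, N.graph.Adj v w ∧ w ≠ v := by
  by_contra! hall
  refine hv (Eq.symm ?_)
  have : ∀ x, Relation.ReflTransGen N.graph.Adj v x → x = v := by
    intro x hx
    induction hx with
    | refl => rfl
    | tail _ hbc ih => subst ih; exact hall _ hbc
  exact this _ (N.reaches_sink v)

theorem exists_isFavourite (N : Network V) : ∃ h, N.IsFavourite h := by
  classical
  have : ∀ v, ∃ w, v ≠ N.sink → (N.graph.Adj v w ∧ w ≠ v) ∧
      ∀ x, N.graph.Adj v x → x ≠ v → x ≠ w → N.rank v w < N.rank v x := by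
    intro v
    by_cases hv : v = N.sink
    · exact ⟨v, fun h => absurd hv h⟩
    · obtain ⟨w, hw⟩ := N.exists_best_of_exists (p := fun w => w ≠ v) (exists_adj_ne hv)
      exact ⟨w, fun _ => hw⟩
  choose f hf using this
  refine ⟨Function.update f N.sink N.sink, by simp, ?_, ?_, ?_⟩ <;> intro v hv <;>
    simp only [Function.update_of_ne hv]
  · exact (hf v hv).1.2
  · exact (hf v hv).1.1
  · exact (hf v hv).2

namespace Inv

variable {s₀ s : ControlState V} {Z : Set V}

theorem choose (I : N.Inv s₀ s Z) {v w : V} (hv : v ∉ Z) (hvr : v ≠ N.sink)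
    (hw : N.IsValid (selfFilter V) s v w) : N.Inv s₀ (s.choose v w) (insert v Z) := by
  obtain ⟨hadj, hne, hvw⟩ := N.isValid_iff.1 hw
  refine ⟨?_, ?_, ?_, ?_, ?_, ?_, ?_, ?_, ?_⟩
  · rintro (h | h)
    · exact hvr h.symm
    · exact I.sink_notMem h
  · intro x y h
    by_cases hx : x = v
    · subst hx
      rw [s.choose_next_self, Option.some.injEq] at h
      exact h ▸ hadj
    · rw [s.choose_next_of_ne _ hx] at h
      exact I.compat _ _ h
  · rw [s.choose_path_of_ne _ hvr.symm, I.sink_path]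
  · intro y hy
    rw [Set.mem_insert_iff, not_or] at hy
    rw [s.choose_path_of_ne _ hy.1, I.frame_path y hy.2]
  · intro y hy
    rw [Set.mem_insert_iff, not_or] at hy
    rw [s.choose_next_of_ne _ hy.1, I.frame_next y hy.2]
  · intro x hx
    by_cases hxv : x = v
    · subst hxv; simp
    · rw [s.choose_path_of_ne _ hxv] at hx ⊢
      exact I.mem_self x hx
  · intro y hy x hyx
    rw [Set.mem_insert_iff, not_or] at hy
    rw [s.choose_path_of_ne _ hy.1]
    by_cases hxv : x = v
    · subst hxv
      rw [s.choose_path_self] at hyx ⊢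
      have := I.sub y hy.2 w ((List.mem_cons.1 hyx).resolve_left hy.1)
      exact ⟨this.1, List.subset_cons_of_subset _ this.2⟩
    · rw [s.choose_path_of_ne _ hxv] at hyx ⊢
      exact I.sub y hy.2 x hyx
  · intro y hy
    by_cases hyv : y = v
    · subst hyv; simp
    · rw [s.choose_path_of_ne _ hyv, s.choose_next_of_ne _ hyv]
      exact I.activated y (hy.resolve_left hyv)
  · intro y hy hyr hyne
    rw [Set.mem_insert_iff, not_or] at hy
    rw [s.choose_path_of_ne _ hy.1] at hyne ⊢
    rw [s.choose_next_of_ne _ hy.1]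
    obtain ⟨u, hu, huy, hune, hyu⟩ := I.next_spec y hy.2 hyr hyne
    refine ⟨u, hu, huy, ?_⟩
    by_cases huv : u = v
    · subst huv
      rw [s.choose_path_self]
      refine ⟨by simp, ?_⟩
      rw [List.mem_cons, not_or]
      -- If the path of `w` met `y`, it would by `sub` contain the path of `y` and hence `u` itself,
      -- which the filter of `u` forbids.
      exact ⟨hy.1, fun h => hvw ((I.sub y hy.2 w h).2 huy)⟩
    · rw [s.choose_path_of_ne _ huv]
      exact ⟨hune, hyu⟩

/-- A node can be activated if it has a routing path or an out-neighbour with a routing path. -/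
theorem exists_best (I : N.Inv s₀ s Z) {v : V} (hv : v ∉ Z) (hvr : v ≠ N.sink)
    (h : s.path v ≠ [] ∨ ∃ u, N.graph.Adj v u ∧ s.path u ≠ []) :
    ∃ w, N.IsBestValid (selfFilter V) s v w := by
  apply N.exists_isBestValid
  by_cases hne : s.path v ≠ []
  · obtain ⟨w, hw, -, hw', hvw⟩ := I.next_spec v hv hvr hne
    exact ⟨w, N.isValid_iff.2 ⟨I.compat _ _ hw, hw', hvw⟩⟩
  · obtain ⟨u, hu, hu'⟩ := h.resolve_left hne
    exact ⟨u, N.isValid_iff.2 ⟨hu, hu', fun hvu => hne (I.sub v hv u hvu).1⟩⟩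

/-- Favourites disregard loops of the network. This is harmless, since a nonempty path contains its
own node and a node is thus never a valid choice for itself. -/
theorem isBestValid_favourite (I : N.Inv s₀ s Z) {h : V → V} (hh : N.IsFavourite h) {v : V}
    (hvr : v ≠ N.sink) (hne : s.path (h v) ≠ []) (hv : v ∉ s.path (h v)) :
    N.IsBestValid (selfFilter V) s v (h v) := by
  refine ⟨N.isValid_iff.2 ⟨hh.adj v hvr, hne, hv⟩, fun x hx hxh => ?_⟩
  obtain ⟨hadj, hne', hvx⟩ := N.isValid_iff.1 hx
  refine hh.lt v hvr x hadj ?_ hxh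
  rintro rfl
  exact hvx (I.mem_self _ hne')

theorem sink_ne_nil (I : N.Inv s₀ s Z) : s.path N.sink ≠ [] := by simp [I.sink_path]

end Inv

/-! ### Partial rounds and clean sets. -/

/-- Activating nodes that are not in `Z`, each once, leads from `s` to `s'`, and the set of
activated nodes grows from `Z` to `Z'`. -/
def Run (N : Network V) (s : ControlState V) (Z : Set V) (s' : ControlState V) (Z' : Set V) :
    Prop :=
  ∃ l : List V, l.Nodup ∧ (∀ v ∈ l, v ∉ Z) ∧ s' = l.foldl (N.activate (selfFilter V)) s ∧
    Z' = Z ∪ {v | v ∈ l}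

namespace Run

variable {s s' s'' : ControlState V} {Z Z' Z'' : Set V}

theorem refl (s : ControlState V) (Z : Set V) : N.Run s Z s Z := ⟨[], by simp⟩

theorem trans (h : N.Run s Z s' Z') (h' : N.Run s' Z' s'' Z'') : N.Run s Z s'' Z'' := by
  obtain ⟨l, hl, hlZ, rfl, rfl⟩ := h
  obtain ⟨l', hl', hlZ', rfl, rfl⟩ := h'
  refine ⟨l ++ l', ?_, ?_, by simp, ?_⟩
  · refine List.nodup_append'.2 ⟨hl, hl', fun v hv hv' => hlZ' v hv' (.inr hv)⟩
  · intro v hv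
    rcases List.mem_append.1 hv with hv | hv
    · exact hlZ v hv
    · exact fun h => hlZ' v hv (.inl h)
  · ext v; simp [or_assoc]

theorem single {v : V} (hv : v ∉ Z) :
    N.Run s Z (N.activate (selfFilter V) s v) (insert v Z) :=
  ⟨[v], by simp, by simpa using hv, rfl, by ext; simp [or_comm]⟩

theorem subset (h : N.Run s Z s' Z') : Z ⊆ Z' := by
  obtain ⟨l, -, -, -, rfl⟩ := h
  exact Set.subset_union_left

/-- An invariant that can be kept while activating nodes until `G` is exhausted. -/
theorem exists_of_step [Finite V] (G : Set V) (I : ControlState V → Set V → Prop)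
    (hstep : ∀ s Z, I s Z → (∃ g ∈ G, g ∉ Z) →
      ∃ v, v ∉ Z ∧ I (N.activate (selfFilter V) s v) (insert v Z)) (hI : I s Z) :
    ∃ s' Z', N.Run s Z s' Z' ∧ I s' Z' ∧ G ⊆ Z' := by
  induction hn : Zᶜ.ncard using Nat.strong_induction_on generalizing s Z with
  | _ n ih =>
    by_cases hG : ∃ g ∈ G, g ∉ Z
    · obtain ⟨v, hv, hI'⟩ := hstep s Z hI hG
      have hlt : (insert v Z)ᶜ.ncard < n := by
        rw [← hn]
        refine Set.ncard_lt_ncard ?_ (Set.toFinite _)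
        exact compl_lt_compl_iff_lt.2 (Set.ssubset_insert hv)
      obtain ⟨s', Z', hrun, h⟩ := ih _ hlt hI' rfl
      exact ⟨s', Z', (single hv).trans hrun, h⟩
    · push Not at hG
      exact ⟨s, Z, refl s Z, hI, hG⟩

end Run

/-- The nodes of `S` follow paths to the sink, whose nodes that may still be activated are on the
stored routing paths. -/
structure Clean (N : Network V) (s : ControlState V) (Z S : Set V) : Prop where
  reach : ∀ x ∈ S, s.next.Leads x N.sink
  closed : ∀ x ∈ S, ∀ y, s.next.Leads x y → y ∈ S
  -- A stale path in `S` still shows every node ahead that can yet be rerouted, so a choice in `S`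
  -- that passes the filter closes no cycle.
  cover : ∀ x ∈ S, ∀ y ∉ Z, y ≠ N.sink → s.next.Leads x y → y ∈ s.path x

theorem Clean.of_consistent {s : ControlState V} (c : N.Consistent s) (Z : Set V) {S : Set V}
    (hS : ∀ x ∈ S, s.path x ≠ [] ∧ ∀ y ∈ s.path x, y ∈ S) : N.Clean s Z S where
  reach x hx := c.leads_of_mem (c.sink_mem (hS x hx).1)
  closed x hx y h := (hS x hx).2 y (c.mem_of_leads (hS x hx).1 h)
  cover x hx _ _ _ h := c.mem_of_leads (hS x hx).1 h

/-- By `cover` and the filter, `w` does not lead to `v`, so no cycle arises. The hypothesis `hS`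
protects `cover`: a node that leads to `v` now continues along the way of `w`, but its stored path
is not refreshed, so apart from the sink that way must contain no node still to be activated. -/
theorem Clean.choose {s : ControlState V} {Z S : Set V} (C : N.Clean s Z S) {v w : V}
    (hv : v ∉ Z) (hvr : v ≠ N.sink) (hw : w ∈ S) (hvw : v ∉ s.path w)
    (hS : ∀ x ∈ S, s.next.Leads x v → ∀ y ∉ Z, y ≠ N.sink → ¬ s.next.Leads w y) :
    N.Clean (s.choose v w) (insert v Z) (insert v S) := by
  have hwv : ¬ s.next.Leads w v := fun h => hvw (C.cover w hw v hv hvr h)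
  have hvr' : (s.choose v w).next.Leads v N.sink :=
    .head (s.choose_next_self v w) (s.leads_choose v w hwv (C.reach w hw))
  have hw' : ∀ y, (s.choose v w).next.Leads w y → s.next.Leads w y := fun y =>
    s.leads_of_leads_choose v w hwv
  have hv' : ∀ y, (s.choose v w).next.Leads v y → v = y ∨ s.next.Leads w y := by
    intro y h
    rcases h.eq_or_head with h | ⟨u, hu, h⟩
    · exact .inl h
    · rw [s.choose_next_self, Option.some.injEq] at hu
      subst hu
      exact .inr (hw' y h)
  refine ⟨?_, ?_, ?_⟩
  · intro x hx
    rcases hx with rfl | hx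
    · exact hvr'
    · rcases s.leads_choose_or v w (C.reach x hx) with h | h
      · exact h
      · exact h.trans hvr'
  · intro x hx y h
    rcases hx with rfl | hx
    · rcases hv' y h with rfl | h
      · exact .inl rfl
      · exact .inr (C.closed w hw y h)
    · rcases s.leads_or_of_leads_choose v w h with h | ⟨-, h⟩
      · exact .inr (C.closed x hx y h)
      · exact .inr (C.closed w hw y (hw' y h))
  · intro x hx y hy hyr h
    rw [Set.mem_insert_iff, not_or] at hy
    by_cases hxv : x = v
    · subst hxv
      rw [s.choose_path_self]
      rcases hv' y h with rfl | h
      · simp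
      · exact List.mem_cons_of_mem _ (C.cover w hw y hy.2 hyr h)
    · have hx := hx.resolve_left hxv
      rw [s.choose_path_of_ne _ hxv]
      rcases s.leads_or_of_leads_choose v w h with h | ⟨hxv, h⟩
      · exact C.cover x hx y hy.2 hyr h
      · exact absurd (hw' y h) (hS x hx hxv y hy.2 hyr)

/-- A node outside a clean set joins it. -/
theorem Clean.choose_of_notMem {s : ControlState V} {Z S : Set V} (C : N.Clean s Z S) {v w : V}
    (hv : v ∉ Z) (hvr : v ≠ N.sink) (hw : w ∈ S) (hvw : v ∉ s.path w) (hvS : v ∉ S) :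
    N.Clean (s.choose v w) (insert v Z) (insert v S) :=
  C.choose hv hvr hw hvw fun x hx h => absurd (C.closed x hx v h) hvS

/-- A clean set persists if every node that may still be activated, on its way, has `v` on
its path. -/
theorem Clean.choose_of_top {s₀ s : ControlState V} {Z S : Set V} (C : N.Clean s Z S)
    (I : N.Inv s₀ s Z) {v w : V}
    (hv : v ∉ Z) (hvr : v ≠ N.sink) (hw : w ∈ S) (hvw : v ∉ s.path w)
    (htop : ∀ y ∉ Z, y ≠ N.sink → s.path y ≠ [] → v ∈ s.path y) :
    N.Clean (s.choose v w) (insert v Z) (insert v S) := by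
  -- A node still to be activated on the way of `w` would put its own path, and with it `v`, on the
  -- stored path of `w`.
  refine C.choose hv hvr hw hvw fun x _ _ y hy hyr h => hvw ?_
  have := I.sub y hy w (C.cover w hw y hy hyr h)
  exact this.2 (htop y hy hyr this.1)

/-! ### Contractible arcs and good rounds. -/

/-- The arcs of `F` are arcs of `R` that remain the best choices of their tails as long as they
are kept, and contracting them keeps the sink reachable. -/
structure IsContraction (N : Network V) (R F : RoutingGraph V) : Prop where
  compat : N.Compatible R
  sub : ∀ v w, F v = some w → R v = some w
  acyclic : ∃ μ : V → ℕ, ∀ v w, F v = some w → μ w < μ v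
  -- The exempt out-neighbours are those below `v` in the forest; while the arcs of `F` are kept,
  -- their ways to the sink run through `v`.
  best : ∀ v w, F v = some w → ∀ x, N.graph.Adj v x → ¬ F.Leads x v → x ≠ w →
    N.rank v w < N.rank v x
  reach : ∀ v, Relation.ReflTransGen
    (fun v w => N.graph.Adj v w ∧ (F v = none ∨ F v = some w)) v N.sink
  next_ne_none : ∀ v ≠ N.sink, R v ≠ none

/-- From `R`, some order of activations leads to a round that makes enough progress: it delivers all
packets and fixes an arc, or it fixes three arcs. -/
def HasGoodRound [Fintype V] [DecidableEq V] (N : Network V) (R : RoutingGraph V) : Prop :=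
  ∃ l : List V, l.Nodup ∧ (∀ v, v ∈ l ↔ v ≠ N.sink) ∧ ∃ F : RoutingGraph V,
    N.IsContraction (l.foldl (N.activate (selfFilter V)) (N.verified R)).next F ∧
    ((∀ v, (l.foldl (N.activate (selfFilter V)) (N.verified R)).next.Leads v N.sink) ∧
        1 ≤ {v | F v ≠ none}.ncard ∨
      3 ≤ {v | F v ≠ none}.ncard)

theorem exists_order_of_run [Fintype V] [DecidableEq V] {R : RoutingGraph V}
    {s₀ s : ControlState V} {Z : Set V} (hrun : N.Run (N.verified R) ∅ s Z)
    (I : N.Inv s₀ s Z) (hZ : ∀ v ≠ N.sink, v ∈ Z) :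
    ∃ l : List V, l.Nodup ∧ (∀ v, v ∈ l ↔ v ≠ N.sink) ∧
      s = l.foldl (N.activate (selfFilter V)) (N.verified R) := by
  obtain ⟨l, hl, -, hs, hZ'⟩ := hrun
  refine ⟨l, hl, fun v => ⟨?_, fun hv => ?_⟩, hs⟩
  · rintro hv rfl
    exact I.sink_notMem (by rw [hZ']; exact .inr hv)
  · have := hZ v hv
    rw [hZ'] at this
    simpa using this

/-- A perfect round in which some node takes its favourite makes progress. -/
theorem hasGoodRound_of_perfect [Fintype V] [DecidableEq V] {R : RoutingGraph V}
    {s₀ s : ControlState V} {Z : Set V} (hrun : N.Run (N.verified R) ∅ s Z)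
    (I : N.Inv s₀ s Z) (hZ : ∀ v ≠ N.sink, v ∈ Z)
    (hperf : ∀ v, s.next.Leads v N.sink) {h : V → V} (hh : N.IsFavourite h) {y : V}
    (hy : y ≠ N.sink) (hyh : s.next y = some (h y)) : N.HasGoodRound R := by
  classical
  obtain ⟨l, hl, hlm, rfl⟩ := exists_order_of_run hrun I hZ
  set F : RoutingGraph V := fun v => if v = y then some (h y) else none with hF
  have hFs : ∀ v w, F v = some w → v = y ∧ w = h y := by
    intro v w hvw
    by_cases hv : v = y
    · simp only [hF, hv, if_true, Option.some.injEq] at hvw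
      exact ⟨hv, hvw.symm⟩
    · simp [hF, hv] at hvw
  refine ⟨l, hl, hlm, F, ⟨I.compat, ?_, ?_, ?_, ?_, ?_⟩, .inl ⟨hperf, ?_⟩⟩
  · intro v w hvw
    obtain ⟨rfl, rfl⟩ := hFs v w hvw
    exact hyh
  · refine ⟨fun v => if v = y then 1 else 0, fun v w hvw => ?_⟩
    obtain ⟨rfl, rfl⟩ := hFs v w hvw
    simp [hh.ne v hy]
  · intro v w hvw x hx hxv hxw
    obtain ⟨rfl, rfl⟩ := hFs v w hvw
    refine hh.lt v hy x hx ?_ hxw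
    rintro rfl
    exact hxv .refl
  · intro v
    refine Relation.ReflTransGen.mono (fun a b hab => ⟨I.compat _ _ hab, ?_⟩) _ _ (hperf v)
    by_cases ha : a = y
    · subst ha
      rw [hyh] at hab
      right; simp [hF]; simpa using hab
    · left; simp [hF, ha]
  · intro v hv hnone
    exact hv ((hperf v).eq_of_next_none hnone)
  · exact (Set.ncard_pos (Set.toFinite _)).2 ⟨y, by simp [hF]⟩

/-! ### Perfect rounds along favourites. -/

/-- A state in the course of the first round from `R`, after the activation of the nodes of `W`,
in which all routing paths are actual paths. -/
structure Start [Fintype V] [DecidableEq V] (N : Network V) (R : RoutingGraph V)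
    (s : ControlState V) (W : Set V) : Prop where
  run : N.Run (N.verified R) ∅ s W
  consistent : N.Consistent s
  sink_notMem : N.sink ∉ W
  ne_nil : ∀ y ∈ W, s.path y ≠ []

theorem Start.inv [Fintype V] [DecidableEq V] {R : RoutingGraph V} {s : ControlState V} {W : Set V}
    (S : N.Start R s W) : N.Inv s s W :=
  S.consistent.inv S.sink_notMem S.ne_nil

theorem start_verified [Fintype V] [DecidableEq V] {R : RoutingGraph V} (hR : N.Compatible R) :
    N.Start R (N.verified R) ∅ :=
  ⟨.refl _ _, consistent_verified hR, by simp, by simp⟩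

theorem exists_iterate_notMem_of_mem {V : Type*} {h : V → V} {A : Set V} {v : V} (hv : v ∉ A)
    {k : ℕ} (hk : h^[k] v ∈ A) : ∃ j, h^[j] v ∉ A ∧ h (h^[j] v) ∈ A := by
  induction k with
  | zero => exact absurd hk hv
  | succ k ih =>
    by_cases hk' : h^[k] v ∈ A
    · exact ih hk'
    · exact ⟨k, hk', by rwa [Function.iterate_succ_apply'] at hk⟩

/-- If every node reaches the routing path of `v₀` along favourites, some order of activations
delivers all packets. -/
theorem Start.hasGoodRound_of_hits [Fintype V] [DecidableEq V] {R : RoutingGraph V}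
    {s : ControlState V} {W : Set V} (S : N.Start R s W) {h : V → V} (hh : N.IsFavourite h) {v₀ : V}
    (hv₀ : s.path v₀ ≠ []) (hW : ∀ w ∈ W, w ∈ s.path v₀)
    (hits : ∀ v, ∃ k, h^[k] v ∈ s.path v₀) (hy : ∃ y, y ∉ s.path v₀) : N.HasGoodRound R := by
  have c := S.consistent
  have hsink : N.sink ∈ s.path v₀ := c.sink_mem hv₀
  -- A node off the path waits until its favourite is on the path or activated. The stored path of
  -- the favourite then stays among such nodes and misses the waiting node, so the favourite is
  -- valid.
  obtain ⟨s₁, Z₁, run₁, ⟨I₁, C₁, hS₁, hfav₁, hQ₁⟩, hG₁⟩ := Run.exists_of_step (N := N) (s := s)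
    (Z := W) {v | v ∉ s.path v₀}
    (fun t Z => N.Inv s t Z ∧ N.Clean t Z {x | x ∈ s.path v₀ ∨ x ∈ Z} ∧
      (∀ x, x ∈ s.path v₀ ∨ x ∈ Z → t.path x ≠ [] ∧ ∀ u ∈ t.path x, u ∈ s.path v₀ ∨ u ∈ Z) ∧
      (∀ y ∈ Z, y ∉ s.path v₀ → t.next y = some (h y)) ∧
      (∀ q ∈ s.path v₀, q ∈ Z → q ∈ W))
    (by
      rintro t Z ⟨I, C, hS, hfav, hQ⟩ ⟨g, hg, hgZ⟩
      obtain ⟨k, hk⟩ := hits g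
      obtain ⟨j, hj, hj'⟩ := exists_iterate_notMem_of_mem (h := h)
        (A := {x | x ∈ s.path v₀ ∨ x ∈ Z}) (v := g) (by rintro (h | h); exacts [hg h, hgZ h])
        (k := k) (.inl hk)
      generalize h^[j] g = y at hj hj'
      simp only [Set.mem_ofPred_eq, not_or] at hj hj'
      have hyr : y ≠ N.sink := by rintro rfl; exact hj.1 hsink
      have hne := (hS _ hj').1
      have hyn : y ∉ t.path (h y) := fun hm => by
        rcases (hS _ hj').2 _ hm with h | h
        exacts [hj.1 h, hj.2 h]
      have hb := I.isBestValid_favourite hh hyr hne hyn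
      refine ⟨y, hj.2, ?_⟩
      rw [activate_eq_choose hb]
      have hset : {x | x ∈ s.path v₀ ∨ x ∈ insert y Z} = insert y {x | x ∈ s.path v₀ ∨ x ∈ Z} := by
        ext x; simp only [Set.mem_ofPred_eq, Set.mem_insert_iff]; tauto
      refine ⟨I.choose hj.2 hyr hb.1, ?_, ?_, ?_, ?_⟩
      · rw [hset]
        exact C.choose_of_notMem hj.2 hyr hj' hyn (by simp [hj])
      · intro x hx
        by_cases hxy : x = y
        · subst hxy
          rw [t.choose_path_self]
          refine ⟨by simp, fun u hu => ?_⟩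
          rcases List.mem_cons.1 hu with rfl | hu
          · exact .inr (.inl rfl)
          · exact ((hS _ hj').2 u hu).imp_right .inr
        · rw [t.choose_path_of_ne _ hxy]
          have hx' := hS x (hx.imp_right fun h => h.resolve_left hxy)
          exact ⟨hx'.1, fun u hu => (hx'.2 u hu).imp_right .inr⟩
      · intro x hx hxQ
        by_cases hxy : x = y
        · subst hxy; simp
        · rw [t.choose_next_of_ne _ hxy]
          exact hfav x (hx.resolve_left hxy) hxQ
      · intro q hq hqZ
        refine hQ q hq (hqZ.resolve_left ?_)
        rintro rfl
        exact hj.1 hq)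
    (by
      refine ⟨S.inv, Clean.of_consistent c _ ?_, ?_, fun y hy hyQ => absurd (hW y hy) hyQ,
        fun q _ h => h⟩
      · rintro x (hx | hx)
        · exact ⟨c.ne_nil_of_mem hx, fun y hy => .inl (c.mem_trans hx hy)⟩
        · exact ⟨S.ne_nil x hx, fun y hy => .inl (c.mem_trans (hW x hx) hy)⟩
      · rintro x (hx | hx)
        · exact ⟨c.ne_nil_of_mem hx, fun y hy => .inl (c.mem_trans hx hy)⟩
        · exact ⟨S.ne_nil x hx, fun y hy => .inl (c.mem_trans (hW x hx) hy)⟩)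
  have hall : ∀ x, x ∈ s.path v₀ ∨ x ∈ Z₁ := fun x => or_iff_not_imp_left.2 fun h => hG₁ h
  -- Now the path is activated from the sink outwards: the next node lies on the stored paths of all
  -- remaining ones, as `Clean.choose_of_top` requires.
  obtain ⟨s₂, Z₂, run₂, ⟨I₂, C₂, hne₂, hfav₂⟩, hG₂⟩ := Run.exists_of_step (N := N) (s := s₁)
    (Z := Z₁) {v | v ≠ N.sink}
    (fun t Z => N.Inv s t Z ∧ N.Clean t Z Set.univ ∧ (∀ x, t.path x ≠ []) ∧
      (∀ y, y ∉ s.path v₀ → y ∈ Z ∧ t.next y = some (h y)))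
    (by
      rintro t Z ⟨I, C, hne, hfav⟩ ⟨g, hg, hgZ⟩
      obtain ⟨q, ⟨hqr, hqZ⟩, hmin⟩ := Set.exists_min_image {q | q ≠ N.sink ∧ q ∉ Z}
        (fun q => (s.path q).length) (Set.toFinite _) ⟨g, hg, hgZ⟩
      obtain ⟨w, hb⟩ := I.exists_best hqZ hqr (.inl (hne q))
      have hqw := (N.isValid_iff.1 hb.1).2.2
      have hmem : ∀ y ∉ Z, y ∈ s.path v₀ := fun y hy => by
        by_contra hyQ
        exact hy (hfav y hyQ).1
      refine ⟨q, hqZ, ?_⟩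
      rw [activate_eq_choose hb]
      refine ⟨I.choose hqZ hqr hb.1, ?_, ?_, ?_⟩
      · rw [← Set.insert_eq_of_mem (Set.mem_univ q)]
        refine C.choose_of_top I hqZ hqr (Set.mem_univ _) hqw fun y hy hyr _ => ?_
        rw [I.frame_path y hy]
        exact c.mem_path_of_length_le (hmem q hqZ) (hmem y hy) (hmin y ⟨hyr, hy⟩)
      · intro x
        by_cases hxq : x = q
        · subst hxq; simp
        · rw [t.choose_path_of_ne _ hxq]; exact hne x
      · intro y hyQ
        have hyq : y ≠ q := by rintro rfl; exact hyQ (hmem y hqZ)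
        rw [t.choose_next_of_ne _ hyq]
        exact ⟨.inr (hfav y hyQ).1, (hfav y hyQ).2⟩)
    (by
      refine ⟨I₁, ?_, fun x => (hS₁ x (hall x)).1, fun y hy => ?_⟩
      · convert C₁
        exact (Set.eq_univ_of_forall hall).symm
      · have := (hall y).resolve_left hy
        exact ⟨this, hfav₁ y this hy⟩)
  obtain ⟨y, hy⟩ := hy
  exact hasGoodRound_of_perfect ((S.run.trans run₁).trans run₂) I₂ hG₂
    (fun v => C₂.reach v (Set.mem_univ v)) hh (by rintro rfl; exact hy hsink) (hfav₂ y hy).2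

/-- The distance to a set of nodes that contains the sink. -/
theorem exists_dist (N : Network V) {T : Set V} (hT : N.sink ∈ T) :
    ∃ d : V → ℕ, (∀ x, d x = 0 ↔ x ∈ T) ∧ (∀ x, d x ≠ 0 → ∃ u, N.graph.Adj x u ∧ d u + 1 = d x) ∧
      ∀ x u, N.graph.Adj x u → d x ≤ d u + 1 := by
  classical
  let near : ℕ → V → Prop := fun k => Nat.rec (fun x => x ∈ T)
    (fun _ p x => ∃ u, N.graph.Adj x u ∧ p u) k
  have hex : ∀ x, ∃ k, near k x := by
    intro x
    induction N.reaches_sink x using Relation.ReflTransGen.head_induction_on with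
    | refl => exact ⟨0, hT⟩
    | head hac _ ih =>
      obtain ⟨k, hk⟩ := ih
      exact ⟨k + 1, _, hac, hk⟩
  have hmin : ∀ x, ∃ k, near k x ∧ ∀ m, near m x → k ≤ m := fun x =>
    ⟨sInf {k | near k x}, Nat.sInf_mem (hex x), fun m hm => Nat.sInf_le hm⟩
  choose d hd hdmin using hmin
  have hle : ∀ x u, N.graph.Adj x u → d x ≤ d u + 1 :=
    fun x u hxu => hdmin x _ ⟨u, hxu, hd u⟩
  refine ⟨d, fun x => ⟨fun h => ?_, fun h => Nat.le_zero.1 (hdmin x 0 h)⟩, fun x hx => ?_, hle⟩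
  · have := hd x
    rwa [h] at this
  · obtain ⟨k, hk⟩ := Nat.exists_eq_succ_of_ne_zero hx
    have hspec := hd x
    rw [hk] at hspec
    obtain ⟨u, hxu, hu⟩ := hspec
    refine ⟨u, hxu, le_antisymm ?_ (hle x u hxu)⟩
    rw [hk]
    exact Nat.succ_le_succ (hdmin u k hu)

/-- A node without a routing path chooses: the paths stay actual paths. -/
theorem Consistent.choose {s : ControlState V} (c : N.Consistent s) {v w : V}
    (hvr : v ≠ N.sink) (hv : s.path v = []) (hw : N.IsValid (selfFilter V) s v w) :
    N.Consistent (s.choose v w) := by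
  obtain ⟨hadj, hne, hvw⟩ := N.isValid_iff.1 hw
  have hwv : w ≠ v := by rintro rfl; exact hne hv
  refine ⟨?_, ?_, ?_⟩
  · intro x y h
    by_cases hx : x = v
    · subst hx
      rw [s.choose_next_self, Option.some.injEq] at h
      exact h ▸ hadj
    · rw [s.choose_next_of_ne _ hx] at h
      exact c.compat _ _ h
  · rw [s.choose_path_of_ne _ hvr.symm, c.sink_path]
  · intro x hx hxne
    by_cases hxv : x = v
    · subst hxv
      exact ⟨w, by simp, by rwa [s.choose_path_of_ne _ hwv], by
        rw [s.choose_path_self, s.choose_path_of_ne _ hwv]⟩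
    · rw [s.choose_path_of_ne _ hxv] at hxne ⊢
      rw [s.choose_next_of_ne _ hxv]
      obtain ⟨u, hu, hune, he⟩ := c.path_eq x hx hxne
      -- A node without a path lies on no stored path, so its choice makes none of them stale.
      have huv : u ≠ v := by rintro rfl; exact hune hv
      exact ⟨u, hu, by rwa [s.choose_path_of_ne _ huv], by rwa [s.choose_path_of_ne _ huv]⟩

/-! ### Access paths to a set of nodes. -/

/-- A start of the round that gives a routing path to a node `b` of `C`, where only nodes of this
path have been activated, and no other node of the path is in `C`. -/
structure Access [Fintype V] [DecidableEq V] (N : Network V) (R : RoutingGraph V) (C : Set V)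
    (s : ControlState V) (W : Set V) (b : V) : Prop where
  start : N.Start R s W
  mem : b ∈ C
  ne_nil : s.path b ≠ []
  subset : ∀ w ∈ W, w ∈ s.path b
  eq_of_mem : ∀ u ∈ s.path b, u ∈ C → u = b
  direct : ∀ x ∈ C, (N.verified R).path x ≠ [] →
    (N.verified R).path b ≠ [] ∧ W = ∅ ∧ s = N.verified R
  -- `τ` is where the path of `b` joins the tree of old paths; it is `b` itself if `b` already
  -- belongs to that tree.
  trunk : ∃ τ, (N.verified R).path τ ≠ [] ∧ ((N.verified R).path b ≠ [] → τ = b) ∧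
    ∀ u, (N.verified R).path u ≠ [] → (u ∈ s.path b ↔ u ∈ (N.verified R).path τ)

/-- If `C` meets the tree of old paths, take the node of `C` with the shortest old path. Otherwise
take a node of `C` nearest to that tree and activate the nodes of a shortest connection one after
the other, starting at the tree. -/
theorem exists_access [Fintype V] [DecidableEq V] {R : RoutingGraph V} (hR : N.Compatible R)
    {C : Set V} (hC : C.Nonempty) : ∃ s W b, N.Access R C s W b := by
  have c₀ := consistent_verified hR
  by_cases hCT : ∃ x ∈ C, (N.verified R).path x ≠ []
  · obtain ⟨x, hx, hxne⟩ := hCT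
    obtain ⟨b, ⟨hb, hbne⟩, hmin⟩ := Set.exists_min_image
      {b | b ∈ C ∧ (N.verified R).path b ≠ []} (fun q => ((N.verified R).path q).length)
      (Set.toFinite _) ⟨x, hx, hxne⟩
    refine ⟨N.verified R, ∅, b, start_verified hR, hb, hbne, by simp, ?_,
      fun _ _ _ => ⟨hbne, rfl, rfl⟩, b, hbne, fun _ => rfl, fun _ _ => Iff.rfl⟩
    intro u hu huC
    by_contra hub
    exact absurd (hmin u ⟨huC, c₀.ne_nil_of_mem hu⟩) (not_le.2 (c₀.length_lt_of_mem hu hub))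
  · push Not at hCT
    obtain ⟨d, hd₀, hd₁, hd₂⟩ := N.exists_dist (T := {x | (N.verified R).path x ≠ []})
      (by simp [c₀.sink_path])
    have key : ∀ k x, d x = k → ∃ s W, N.Start R s W ∧ s.path x ≠ [] ∧ (∀ w ∈ W, w ∈ s.path x) ∧
        (∀ u ∈ W, 0 < d u ∧ d u ≤ d x ∧ (d u = d x → u = x)) ∧
        (∀ y ∉ W, s.path y = (N.verified R).path y) ∧
        (∃ τ, (N.verified R).path τ ≠ [] ∧
          ∀ u, (N.verified R).path u ≠ [] → (u ∈ s.path x ↔ u ∈ (N.verified R).path τ)) ∧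
        (k = 0 → W = ∅) := by
      intro k
      induction k with
      | zero =>
        intro x hx
        exact ⟨N.verified R, ∅, start_verified hR, (hd₀ x).1 hx, by simp, by simp, fun _ _ => rfl,
          ⟨x, (hd₀ x).1 hx, fun _ _ => Iff.rfl⟩, fun _ => rfl⟩
      | succ k ih =>
        intro x hx
        obtain ⟨u, hxu, hu⟩ := hd₁ x (by omega)
        obtain ⟨s, W, S, hune, hWu, hWd, hold, ⟨τ, hτ, hτu⟩, hW₀⟩ := ih u (by omega)
        have hxW : x ∉ W := fun hxW => by have := (hWd x hxW).2.1; omega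
        have hxT : (N.verified R).path x = [] := by
          by_contra hne
          have := (hd₀ x).2 hne
          omega
        have hxr : x ≠ N.sink := by rintro rfl; simp [c₀.sink_path] at hxT
        have hxs : s.path x = [] := (hold x hxW).trans hxT
        obtain ⟨w, hb⟩ := S.inv.exists_best hxW hxr (.inr ⟨u, hxu, hune⟩)
        obtain ⟨hxw, hwne, hwx⟩ := N.isValid_iff.1 hb.1
        -- An out-neighbour of `x` has distance at least `d u`. Within `W` only `u` is that far; a
        -- node of the old tree forces `d u = 0`, and then nothing has been activated yet.
        have hw : w = u ∨ W = ∅ ∧ (N.verified R).path w ≠ [] := by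
          by_cases hwW : w ∈ W
          · left
            have h₁ := hd₂ x w hxw
            have h₂ := hWd w hwW
            exact h₂.2.2 (by omega)
          · rw [hold w hwW] at hwne
            have h₁ := hd₂ x w hxw
            have h₂ := (hd₀ w).2 hwne
            exact .inr ⟨hW₀ (by omega), hwne⟩
        refine ⟨s.choose x w, insert x W, ⟨?_, S.consistent.choose hxr hxs hb.1, ?_, ?_⟩, by simp,
          ?_, ?_, ?_, ?_, by simp⟩
        · rw [← activate_eq_choose hb]
          exact S.run.trans (.single hxW)
        · rintro (h | h)
          exacts [hxr h.symm, S.sink_notMem h]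
        · rintro y (rfl | hy)
          · simp
          · rw [s.choose_path_of_ne _ (by rintro rfl; exact hxW hy)]
            exact S.ne_nil y hy
        · rintro y (rfl | hy)
          · simp
          · rw [s.choose_path_self]
            rcases hw with rfl | ⟨rfl, -⟩
            · exact List.mem_cons_of_mem _ (hWu y hy)
            · simp at hy
        · rintro y (rfl | hy)
          · exact ⟨by omega, le_rfl, fun _ => rfl⟩
          · have := hWd y hy
            exact ⟨this.1, by omega, by omega⟩
        · intro y hy
          rw [Set.mem_insert_iff, not_or] at hy
          rw [s.choose_path_of_ne _ hy.1, hold y hy.2]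
        · rw [s.choose_path_self]
          rcases hw with rfl | ⟨rfl, hw⟩
          · refine ⟨τ, hτ, fun z hz => ?_⟩
            rw [List.mem_cons, hτu z hz, or_iff_right]
            rintro rfl
            exact hz hxT
          · refine ⟨w, hw, fun z hz => ?_⟩
            rw [List.mem_cons, hold w (by simp), or_iff_right]
            rintro rfl
            exact hz hxT
    obtain ⟨b, hb, hmin⟩ := Set.exists_min_image C d (Set.toFinite _) hC
    obtain ⟨s, W, S, hne, hWb, hWd, hold, ⟨τ, hτ, hτu⟩, -⟩ := key (d b) b rfl
    refine ⟨s, W, b, S, hb, hne, hWb, ?_, fun x hx hxne => absurd (hCT x hx) hxne,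
      τ, hτ, fun h => absurd (hCT b hb) h, hτu⟩
    intro u hu huC
    by_cases huW : u ∈ W
    · have h₁ := hWd u huW
      exact h₁.2.2 (le_antisymm h₁.2.1 (hmin u huC))
    · have := S.consistent.ne_nil_of_mem hu
      rw [hold u huW] at this
      exact absurd (hCT u huC) this

/-! ### Rounds that fix three arcs. -/

/-- Nodes whose favourite comes earlier in a suitable linear order can all take their favourite in
the same round. -/
theorem Start.hasGoodRound_of_order [Fintype V] [DecidableEq V] {R : RoutingGraph V}
    {s : ControlState V} {W : Set V} (S : N.Start R s W) {h : V → V} (hh : N.IsFavourite h)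
    {α : Type*} [LinearOrder α] (pos : V → α) (M G : Set V)
    (hGr : N.sink ∉ G) (hGW : ∀ v ∈ G, v ∉ W) (hG : ∀ v ∈ G, pos (h v) < pos v)
    (hM₁ : ∀ v, s.path v ≠ [] → v ∈ M) (hM₂ : ∀ v ∈ M, v ∈ G → h v ∈ M)
    (hM₃ : ∀ v ∈ M, v ∉ G → s.path v ≠ [])
    (hpath : ∀ v ∉ G, ∀ u ∈ s.path v, pos u ≤ pos v)
    (hadj : ∀ v ∉ G, v ≠ N.sink → ∃ u, N.graph.Adj v u ∧ pos u < pos v)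
    (hcard : 3 ≤ G.ncard) : N.HasGoodRound R := by
  classical
  -- By increasing position: the path of the favourite never rises above the favourite's position,
  -- so it misses the node that chooses.
  obtain ⟨s₁, Z₁, run₁, ⟨I₁, hfav₁, -, -⟩, hG₁⟩ := Run.exists_of_step (N := N) (s := s)
    (Z := W) (M ∩ G)
    (fun t Z => N.Inv s t Z ∧ (∀ y ∈ Z, y ∈ G → t.next y = some (h y)) ∧
      (∀ y ∈ Z, y ∈ G → ∀ u ∈ t.path y, pos u ≤ pos y) ∧ ∀ y ∉ G, t.path y = s.path y)
    (by
      rintro t Z ⟨I, hfav, hpos, hkeep⟩ ⟨g, hg, hgZ⟩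
      obtain ⟨y, ⟨⟨hyM, hyG⟩, hyZ⟩, hmin⟩ := Set.exists_min_image {y | y ∈ M ∩ G ∧ y ∉ Z} pos
        (Set.toFinite _) ⟨g, hg, hgZ⟩
      have hyr : y ≠ N.sink := by rintro rfl; exact hGr hyG
      have hlt := hG y hyG
      have hne : t.path (h y) ≠ [] ∧ ∀ u ∈ t.path (h y), pos u ≤ pos (h y) := by
        by_cases hhG : h y ∈ G
        · have hhZ : h y ∈ Z := by
            by_contra hhZ
            exact absurd (hmin (h y) ⟨⟨hM₂ y hyM hyG, hhG⟩, hhZ⟩) (not_le.2 hlt)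
          exact ⟨(I.activated _ hhZ).1, hpos _ hhZ hhG⟩
        · rw [hkeep _ hhG]
          exact ⟨hM₃ _ (hM₂ y hyM hyG) hhG, hpath _ hhG⟩
      have hb := I.isBestValid_favourite hh hyr hne.1 fun hm => absurd (hne.2 y hm) (not_le.2 hlt)
      refine ⟨y, hyZ, ?_⟩
      rw [activate_eq_choose hb]
      refine ⟨I.choose hyZ hyr hb.1, ?_, ?_, ?_⟩
      · intro x hx hxG
        by_cases hxy : x = y
        · subst hxy; simp
        · rw [t.choose_next_of_ne _ hxy]
          exact hfav x (hx.resolve_left hxy) hxG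
      · intro x hx hxG
        by_cases hxy : x = y
        · subst hxy
          rw [t.choose_path_self]
          intro u hu
          rcases List.mem_cons.1 hu with rfl | hu
          · exact le_rfl
          · exact (hne.2 u hu).trans hlt.le
        · rw [t.choose_path_of_ne _ hxy]
          exact hpos x (hx.resolve_left hxy) hxG
      · intro x hxG
        rw [t.choose_path_of_ne _ (by rintro rfl; exact hxG hyG)]
        exact hkeep x hxG)
    ⟨S.inv, fun y hy hyG => absurd hy (hGW y hyG), fun y hy hyG => absurd hy (hGW y hyG),
      fun _ _ => rfl⟩
  -- The other nodes with a path only need some next hop, which they find in any order.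
  obtain ⟨s₂, Z₂, run₂, ⟨I₂, hfav₂, -⟩, hG₂⟩ := Run.exists_of_step (N := N) (s := s₁)
    (Z := Z₁) {v | s.path v ≠ [] ∧ v ≠ N.sink}
    (fun t Z => N.Inv s t Z ∧ (∀ y ∈ Z, y ∈ G → t.next y = some (h y)) ∧ M ∩ G ⊆ Z)
    (by
      rintro t Z ⟨I, hfav, hMG⟩ ⟨g, ⟨hgne, hgr⟩, hgZ⟩
      obtain ⟨w, hb⟩ := I.exists_best hgZ hgr (.inl (by rwa [I.frame_path g hgZ]))
      refine ⟨g, hgZ, ?_⟩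
      rw [activate_eq_choose hb]
      refine ⟨I.choose hgZ hgr hb.1, ?_, hMG.trans (Set.subset_insert _ _)⟩
      intro x hx hxG
      have hxg : x ≠ g := by
        rintro rfl
        exact hgZ (hMG ⟨hM₁ x hgne, hxG⟩)
      rw [t.choose_next_of_ne _ hxg]
      exact hfav x (hx.resolve_left hxg) hxG)
    ⟨I₁, hfav₁, hG₁⟩
  -- The nodes left have no path and so lie on no stored path: every out-neighbour with a path is
  -- valid. By increasing position there is always one, and for nodes of `G` the favourite is one.
  obtain ⟨s₃, Z₃, run₃, ⟨I₃, hfav₃, -⟩, hG₃⟩ := Run.exists_of_step (N := N) (s := s₂)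
    (Z := Z₂) {v | v ≠ N.sink}
    (fun t Z => N.Inv s t Z ∧ (∀ y ∈ Z, y ∈ G → t.next y = some (h y)) ∧
      ∀ y, s.path y ≠ [] → y ≠ N.sink → y ∈ Z)
    (by
      rintro t Z ⟨I, hfav, hT⟩ ⟨g, hgr, hgZ⟩
      obtain ⟨y, ⟨hyr, hyZ⟩, hmin⟩ := Set.exists_min_image {y | y ≠ N.sink ∧ y ∉ Z} pos
        (Set.toFinite _) ⟨g, hgr, hgZ⟩
      have hyne : t.path y = [] := by
        rw [I.frame_path y hyZ]
        by_contra hne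
        exact hyZ (hT y hne hyr)
      have hlt : ∀ u, pos u < pos y → t.path u ≠ [] := by
        intro u hu
        by_cases hur : u = N.sink
        · rw [hur]; exact I.sink_ne_nil
        · refine (I.activated u ?_).1
          by_contra huZ
          exact absurd (hmin u ⟨hur, huZ⟩) (not_le.2 hu)
      have hmem : ∀ x, y ∉ t.path x := fun x hx => (I.sub y hyZ x hx).1 hyne
      by_cases hyG : y ∈ G
      · have hb := I.isBestValid_favourite hh hyr (hlt _ (hG y hyG)) (hmem _)
        refine ⟨y, hyZ, ?_⟩
        rw [activate_eq_choose hb]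
        refine ⟨I.choose hyZ hyr hb.1, fun x hx hxG => ?_, fun x hx hxr => .inr (hT x hx hxr)⟩
        by_cases hxy : x = y
        · subst hxy; simp
        · rw [t.choose_next_of_ne _ hxy]
          exact hfav x (hx.resolve_left hxy) hxG
      · obtain ⟨u, hyu, hu⟩ := hadj y hyG hyr
        obtain ⟨w, hb⟩ := I.exists_best hyZ hyr (.inr ⟨u, hyu, hlt u hu⟩)
        refine ⟨y, hyZ, ?_⟩
        rw [activate_eq_choose hb]
        refine ⟨I.choose hyZ hyr hb.1, fun x hx hxG => ?_, fun x hx hxr => .inr (hT x hx hxr)⟩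
        have hxy : x ≠ y := by rintro rfl; exact hyG hxG
        rw [t.choose_next_of_ne _ hxy]
        exact hfav x (hx.resolve_left hxy) hxG)
    ⟨I₂, hfav₂, fun y hy hyr => hG₂ ⟨hy, hyr⟩⟩
  obtain ⟨l, hl, hlm, hs₃⟩ :=
    exists_order_of_run (((S.run.trans run₁).trans run₂).trans run₃) I₃ hG₃
  set F : RoutingGraph V := fun v => if v ∈ G then some (h v) else none with hF
  have hFG : {v | F v ≠ none} = G := by ext v; simp [hF]
  have hFs : ∀ v w, F v = some w → v ∈ G ∧ w = h v := by
    intro v w hvw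
    by_cases hv : v ∈ G
    · simp only [hF, hv, if_true, Option.some.injEq] at hvw
      exact ⟨hv, hvw.symm⟩
    · simp [hF, hv] at hvw
  -- Counting the nodes in lower positions turns `pos` into a height with values in `ℕ`.
  have hμ : ∀ u v, pos u < pos v →
      (Finset.univ.filter fun x => pos x < pos u).card <
        (Finset.univ.filter fun x => pos x < pos v).card := by
    intro u v huv
    refine Finset.card_lt_card ⟨fun x hx => ?_, fun hsub => ?_⟩
    · simp only [Finset.mem_filter, Finset.mem_univ, true_and] at hx ⊢
      exact hx.trans huv
    · have : u ∈ Finset.univ.filter fun x => pos x < pos u := hsub (by simpa using huv)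
      simp at this
  refine ⟨l, hl, hlm, F, hs₃ ▸ ⟨I₃.compat, ?_, ?_, ?_, ?_, ?_⟩, .inr (hFG ▸ hcard)⟩
  · intro v w hvw
    obtain ⟨hv, rfl⟩ := hFs v w hvw
    exact hfav₃ v (hG₃ (by rintro rfl; exact hGr hv)) hv
  · refine ⟨fun v => (Finset.univ.filter fun x => pos x < pos v).card, fun v w hvw => ?_⟩
    obtain ⟨hv, rfl⟩ := hFs v w hvw
    exact hμ _ _ (hG v hv)
  · intro v w hvw x hx hxv hxw
    obtain ⟨hv, rfl⟩ := hFs v w hvw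
    refine hh.lt v (by rintro rfl; exact hGr hv) x hx ?_ hxw
    rintro rfl
    exact hxv .refl
  · intro v
    induction hn : (Finset.univ.filter fun x => pos x < pos v).card using Nat.strong_induction_on
      generalizing v with
    | _ n ih =>
      by_cases hvr : v = N.sink
      · rw [hvr]
      by_cases hv : v ∈ G
      · exact .head ⟨hh.adj v hvr, .inr (by simp [hF, hv])⟩
          (ih _ (hn ▸ hμ _ _ (hG v hv)) _ rfl)
      · obtain ⟨u, hvu, hu⟩ := hadj v hv hvr
        exact .head ⟨hvu, .inl (by simp [hF, hv])⟩ (ih _ (hn ▸ hμ _ _ hu) _ rfl)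
  · intro v hv
    exact (I₃.activated v (hG₃ hv)).2

/-- The routing path of `v₀` is kept, all other nodes that reach it along favourites can take their
favourites, and so can one node of each other set that is closed under favourites. -/
theorem Start.exists_takers [Fintype V] [DecidableEq V] {R : RoutingGraph V}
    {s : ControlState V} {W : Set V} (S : N.Start R s W) {h : V → V} (hh : N.IsFavourite h) {v₀ : V}
    (hv₀ : s.path v₀ ≠ []) (hW : ∀ w ∈ W, w ∈ s.path v₀) :
    ∃ G : Set V, (∀ v ∉ s.path v₀, (∃ k, h^[k] v ∈ s.path v₀) → v ∈ G) ∧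
      (∀ C : Set V, C.Nonempty → (∀ v ∈ C, h v ∈ C) → (∀ v ∈ C, v ∉ s.path v₀) → ∃ y ∈ C, y ∈ G) ∧
      (3 ≤ G.ncard → N.HasGoodRound R) := by
  classical
  have c := S.consistent
  have hsink : N.sink ∈ s.path v₀ := c.sink_mem hv₀
  obtain ⟨d, hd₀, hd₁, -⟩ := N.exists_dist (T := {x | s.path x ≠ []}) (by simp [c.sink_path])
  set hits : V → Prop := fun v => ∃ k, h^[k] v ∈ s.path v₀ with hhits
  -- The classes are the kept path, the nodes that reach it along favourites, the other nodes with a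
  -- path, and the rest. Within them `b` is chosen so that next hops, favourites, next hops and
  -- steps towards the nodes with a path, respectively, lead downwards.
  set a : V → ℕ := fun v => if v ∈ s.path v₀ then 0 else if hits v then 1 else
    if s.path v ≠ [] then 2 else 3 with ha
  set b : V → ℕ := fun v => if v ∈ s.path v₀ then (s.path v).length else if hits v then
    sInf {k | h^[k] v ∈ s.path v₀} else if s.path v ≠ [] then (s.path v).length else d v with hb
  set pos : V → ℕ ×ₗ ℕ ×ₗ ℕ := fun v => toLex (a v, toLex (b v, (Fintype.equivFin V v : ℕ)))
    with hpos
  have lt_of_a : ∀ u v, a u < a v → pos u < pos v := fun u v huv =>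
    Prod.Lex.toLex_lt_toLex.2 (.inl huv)
  have lt_of_b : ∀ u v, a u ≤ a v → b u < b v → pos u < pos v := fun u v huv huv' => by
    rcases huv.lt_or_eq with h | h
    · exact lt_of_a u v h
    · exact Prod.Lex.toLex_lt_toLex.2 (.inr ⟨h, Prod.Lex.toLex_lt_toLex.2 (.inl huv')⟩)
  have a_le : ∀ u v, pos u ≤ pos v → a u ≤ a v := fun u v huv => by
    by_contra! hlt
    exact absurd (lt_of_a v u hlt) (not_lt.2 huv)
  have inj : Function.Injective pos := by
    intro u v huv
    simp only [hpos, EmbeddingLike.apply_eq_iff_eq, Prod.mk.injEq, Fin.val_inj] at huv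
    exact huv.2.2
  have a0 : ∀ v, v ∈ s.path v₀ → a v = 0 ∧ b v = (s.path v).length := fun v hv => by
    simp [ha, hb, hv]
  have a1 : ∀ v, v ∉ s.path v₀ → hits v → a v = 1 ∧ b v = sInf {k | h^[k] v ∈ s.path v₀} :=
    fun v hv hv' => by simp [ha, hb, hv, hv']
  have a2 : ∀ v, v ∉ s.path v₀ → ¬ hits v → s.path v ≠ [] → a v = 2 ∧ b v = (s.path v).length :=
    fun v hv hv' hv'' => by simp [ha, hb, hv, hv', hv'']
  have a3 : ∀ v, v ∉ s.path v₀ → ¬ hits v → s.path v = [] → a v = 3 ∧ b v = d v :=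
    fun v hv hv' hv'' => by simp [ha, hb, hv, hv', hv'']
  have aM : ∀ v, a v ≤ 2 ↔ hits v ∨ s.path v ≠ [] := by
    intro v
    by_cases hv : v ∈ s.path v₀
    · simp [a0 v hv, c.ne_nil_of_mem hv]
    by_cases hv' : hits v
    · simp [a1 v hv hv', hv']
    by_cases hv'' : s.path v = []
    · simp [a3 v hv hv' hv'', hv', hv'']
    · simp [a2 v hv hv' hv'', hv'']
  have hpath : ∀ v, v ∈ s.path v₀ ∨ ¬ hits v → ∀ u ∈ s.path v, u ≠ v → pos u < pos v := by
    intro v hv u hu huv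
    have hlen := c.length_lt_of_mem hu huv
    have hune := c.ne_nil_of_mem hu
    by_cases hvQ : v ∈ s.path v₀
    · have huQ := c.mem_trans hvQ hu
      exact lt_of_b u v (by simp [a0 u huQ]) (by rw [(a0 u huQ).2, (a0 v hvQ).2]; exact hlen)
    · have hv' := hv.resolve_left hvQ
      have hav := a2 v hvQ hv' (List.ne_nil_of_mem hu)
      have hau := (aM u).2 (.inr hune)
      rcases hau.lt_or_eq with hlt | heq
      · exact lt_of_a u v (by omega)
      · have hu2 : b u = (s.path u).length := by
          by_cases huQ : u ∈ s.path v₀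
          · exact (a0 u huQ).2
          by_cases hu' : hits u
          · have := (a1 u huQ hu').1; omega
          · exact (a2 u huQ hu' hune).2
        exact lt_of_b u v (by omega) (by omega)
  have hhit : ∀ v, v ∉ s.path v₀ → hits v → pos (h v) < pos v := by
    intro v hv hv'
    by_cases hQ : h v ∈ s.path v₀
    · exact lt_of_a _ _ (by rw [(a0 _ hQ).1, (a1 v hv hv').1]; exact one_pos)
    · have hmem : sInf {k | h^[k] v ∈ s.path v₀} ∈ {k | h^[k] v ∈ s.path v₀} := Nat.sInf_mem hv'
      obtain ⟨k, hk⟩ : ∃ k, sInf {k | h^[k] v ∈ s.path v₀} = k + 1 := by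
        refine Nat.exists_eq_succ_of_ne_zero fun h0 => hv ?_
        rwa [h0] at hmem
      rw [hk] at hmem
      have hmem' : h^[k] (h v) ∈ s.path v₀ := hmem
      have h1 := a1 (h v) hQ ⟨k, hmem'⟩
      have h2 := a1 v hv hv'
      have hle : sInf {k | h^[k] (h v) ∈ s.path v₀} ≤ k := Nat.sInf_le hmem'
      exact lt_of_b _ _ (by omega) (by omega)
  refine ⟨{v | v ≠ N.sink ∧ v ∉ s.path v₀ ∧ pos (h v) < pos v}, ?_, ?_, ?_⟩
  · intro v hv hv'
    exact ⟨by rintro rfl; exact hv hsink, hv, hhit v hv hv'⟩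
  · intro C hC hCh hCQ
    -- The favourite of the highest node of `C` lies in `C` too, and it is strictly lower because
    -- ties are broken by the enumeration of the nodes.
    obtain ⟨y, hy, hmax⟩ := Set.exists_max_image C pos (Set.toFinite _) hC
    have hyr : y ≠ N.sink := by rintro rfl; exact hCQ _ hy hsink
    refine ⟨y, hy, hyr, hCQ y hy, lt_of_le_of_ne (hmax _ (hCh y hy)) fun he => ?_⟩
    exact hh.ne y hyr (inj he)
  · have hnG : ∀ v, v ∉ {v | v ≠ N.sink ∧ v ∉ s.path v₀ ∧ pos (h v) < pos v} →
        v ∈ s.path v₀ ∨ ¬ hits v := by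
      intro v hv
      by_contra! hcon
      exact hv ⟨by rintro rfl; exact hcon.1 hsink, hcon.1, hhit v hcon.1 hcon.2⟩
    -- The set `M` consists of the first three classes.
    refine S.hasGoodRound_of_order hh pos {v | hits v ∨ s.path v ≠ []} _ (fun h => h.1 rfl)
      (fun v hv hvW => hv.2.1 (hW v hvW)) (fun v hv => hv.2.2) (fun v hv => .inr hv) ?_ ?_ ?_ ?_
    · intro v hv hvG
      exact (aM _).1 ((a_le _ _ hvG.2.2.le).trans ((aM v).2 hv))
    · intro v hv hvG
      rcases hnG v hvG with hQ | hv'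
      · exact c.ne_nil_of_mem hQ
      · exact hv.resolve_left hv'
    · intro v hv u hu
      by_cases huv : u = v
      · rw [huv]
      · exact (hpath v (hnG v hv) u hu huv).le
    · intro v hv hvr
      by_cases hvne : s.path v = []
      · have hvQ : v ∉ s.path v₀ := fun hQ => c.ne_nil_of_mem hQ hvne
        have hv' := (hnG v hv).resolve_left hvQ
        have hav := a3 v hvQ hv' hvne
        obtain ⟨u, hvu, hu⟩ := hd₁ v (fun h0 => (hd₀ v).1 h0 hvne)
        refine ⟨u, hvu, ?_⟩
        by_cases hau : a u ≤ 2
        · exact lt_of_a _ _ (by omega)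
        · have hau' := (aM u).not.1 hau
          push Not at hau'
          have := a3 u (fun hQ => c.ne_nil_of_mem hQ hau'.2) hau'.1 hau'.2
          exact lt_of_b _ _ (by omega) (by omega)
      · obtain ⟨w, hw, hwne, he⟩ := c.path_eq v hvr hvne
        refine ⟨w, c.compat _ _ hw, hpath v (hnG v hv) w ?_ ?_⟩
        · rw [he]; exact List.mem_cons_of_mem _ (c.mem_self hwne)
        · rintro rfl
          exact c.notMem_next he (c.mem_self hwne)

/-! ### Good rounds for two paths and for three leaves. -/

/-- The invariant of a round all of whose activated nodes follow paths to the sink. -/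
structure CleanInv (N : Network V) (s₀ : ControlState V) (A : Set V) (s : ControlState V)
    (Z : Set V) : Prop where
  inv : N.Inv s₀ s Z
  clean : N.Clean s Z (A ∪ Z)

/-- Only nodes of `A` are in the clean set before their activation, so only their order matters:
such a node must lie on all old paths of nodes still to be activated. -/
theorem CleanInv.choose {s₀ s : ControlState V} {A Z : Set V} (J : N.CleanInv s₀ A s Z) {v w : V}
    (hvZ : v ∉ Z) (hvr : v ≠ N.sink) (hb : N.IsBestValid (selfFilter V) s v w) (hw : w ∈ A ∪ Z)
    (htop : v ∈ A → ∀ y ∉ Z, y ≠ N.sink → s₀.path y ≠ [] → v ∈ s₀.path y) :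
    N.CleanInv s₀ A (s.choose v w) (insert v Z) := by
  refine ⟨J.inv.choose hvZ hvr hb.1, ?_⟩
  rw [Set.union_insert]
  have hvw := (N.isValid_iff.1 hb.1).2.2
  by_cases hv : v ∈ A
  · refine J.clean.choose_of_top J.inv hvZ hvr hw hvw fun y hy hyr hne => ?_
    rw [J.inv.frame_path y hy] at hne ⊢
    exact htop hv y hy hyr hne
  · exact J.clean.choose_of_notMem hvZ hvr hw hvw (by rintro (h | h); exacts [hv h, hvZ h])

theorem Consistent.cleanInv {s : ControlState V} (c : N.Consistent s) (x : V) :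
    N.CleanInv s {u | u ∈ s.path x} s ∅ := by
  refine ⟨c.inv (by simp) (by simp), Clean.of_consistent c _ ?_⟩
  rintro y (hy | hy)
  · exact ⟨c.ne_nil_of_mem hy, fun z hz => .inl (c.mem_trans hy hz)⟩
  · simp at hy

/-- If the nodes with a routing path form two paths and at most two further nodes, then some order
of activations delivers all packets: first the one path is activated, from the sink downwards, and
then the other. -/
theorem hasGoodRound_of_two_paths [Fintype V] [DecidableEq V] {R : RoutingGraph V}
    (hR : N.Compatible R) {h : V → V} (hh : N.IsFavourite h) {τ τ' o o' : V}
    (hτ : (N.verified R).path τ ≠ []) (hτ' : (N.verified R).path τ' ≠ [])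
    (hT : ∀ x, (N.verified R).path x ≠ [] →
      x ∈ (N.verified R).path τ ∨ x ∈ (N.verified R).path τ' ∨ x = o ∨ x = o')
    (hoτ : o ∉ (N.verified R).path τ) (hoτ' : o ∉ (N.verified R).path τ')
    (ho'τ : o' ∉ (N.verified R).path τ) (ho'τ' : o' ∉ (N.verified R).path τ') (hoo' : o ≠ o')
    (ho : (N.verified R).path o ≠ [] →
      ∀ u ∈ (N.verified R).path τ, u ∈ (N.verified R).path o)
    (ho' : (N.verified R).path o' ≠ [] → h o' ∈ (N.verified R).path τ')
    (ho'₂ : (N.verified R).path o' = [] → h (h o') = o') : N.HasGoodRound R := by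
  have c := consistent_verified hR
  generalize hs₀ : N.verified R = s₀ at *
  have hrτ : N.sink ∈ s₀.path τ := c.sink_mem hτ
  have hrτ' : N.sink ∈ s₀.path τ' := c.sink_mem hτ'
  have hor : o ≠ N.sink := by rintro rfl; exact hoτ hrτ
  have ho'r : o' ≠ N.sink := by rintro rfl; exact ho'τ hrτ
  have hJ₀ := c.cleanInv τ'
  -- If `o'` has a path, it takes its favourite before anything else happens; this is the arc to be
  -- fixed.
  obtain ⟨sA, ZA, runA, hJA, hoA, hZA⟩ : ∃ t Z, N.Run s₀ ∅ t Z ∧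
      N.CleanInv s₀ {u | u ∈ s₀.path τ'} t Z ∧
      (s₀.path o' ≠ [] → o' ∈ Z ∧ t.next o' = some (h o')) ∧
      ∀ x ∈ Z, x ∈ s₀.path τ ∨ x = o' ∧ s₀.path o' ≠ [] := by
    by_cases ho'T : s₀.path o' = []
    · exact ⟨s₀, ∅, .refl _ _, hJ₀, fun h => absurd ho'T h, by simp⟩
    · have hmem := ho' ho'T
      have hb := hJ₀.inv.isBestValid_favourite hh ho'r (c.ne_nil_of_mem hmem)
        fun hm => ho'τ' (c.mem_trans hmem hm)
      refine ⟨s₀.choose o' (h o'), insert o' ∅, ?_,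
        hJ₀.choose (by simp) ho'r hb (.inl hmem) fun h => absurd h ho'τ',
        fun _ => by simp, fun x hx => ?_⟩
      · rw [← activate_eq_choose hb]
        exact .single (by simp)
      · simp only [Set.mem_insert_iff, Set.mem_empty_iff_false, or_false] at hx
        exact .inr ⟨hx, ho'T⟩
  obtain ⟨sB, ZB, runB, ⟨hJB, hoB, hZB⟩, hGB⟩ := Run.exists_of_step (N := N) (s := sA)
    (Z := ZA) {v | v ∈ s₀.path τ ∧ v ≠ N.sink}
    (fun t Z => N.CleanInv s₀ {u | u ∈ s₀.path τ'} t Z ∧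
      (s₀.path o' ≠ [] → o' ∈ Z ∧ t.next o' = some (h o')) ∧
      ∀ x ∈ Z, x ∈ s₀.path τ ∨ x = o' ∧ s₀.path o' ≠ [])
    (by
      rintro t Z ⟨hJt, hot, hZt⟩ ⟨g, hg, hgZ⟩
      obtain ⟨v, ⟨⟨hvτ, hvr⟩, hvZ⟩, hmin⟩ := Set.exists_min_image
        {v | (v ∈ s₀.path τ ∧ v ≠ N.sink) ∧ v ∉ Z} (fun q => (s₀.path q).length)
        (Set.toFinite _) ⟨g, hg, hgZ⟩
      have I := hJt.inv
      have hvne := c.ne_nil_of_mem hvτ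
      obtain ⟨w, hb⟩ := I.exists_best hvZ hvr (.inl (by rwa [I.frame_path v hvZ]))
      obtain ⟨-, hwne, hvw⟩ := N.isValid_iff.1 hb.1
      have htop : ∀ y ∉ Z, y ≠ N.sink → y ∈ s₀.path τ → v ∈ s₀.path y := fun y hy hyr hyτ =>
        c.mem_path_of_length_le hvτ hyτ (hmin y ⟨⟨hyτ, hyr⟩, hy⟩)
      refine ⟨v, hvZ, ?_⟩
      rw [activate_eq_choose hb]
      refine ⟨hJt.choose hvZ hvr hb ?_ ?_, fun hne => ?_, ?_⟩
      -- A choice outside the clean set would be a node still to be activated whose path contains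
      -- `v`, against the filter.
      · by_contra hw
        rw [Set.mem_union, not_or] at hw
        rw [I.frame_path w hw.2] at hwne hvw
        have hwr : w ≠ N.sink := by rintro rfl; exact hw.1 hrτ'
        rcases hT w hwne with h | h | rfl | rfl
        · exact hvw (htop w hw.2 hwr h)
        · exact hw.1 h
        · exact hvw (ho hwne v hvτ)
        · exact hw.2 (hot hwne).1
      · intro hvτ' y hy hyr hyne
        rcases hT y hyne with h | h | rfl | rfl
        · exact htop y hy hyr h
        · rcases le_total (s₀.path v).length (s₀.path y).length with hle | hle
          · exact c.mem_path_of_length_le hvτ' h hle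
          · have hyv := c.mem_path_of_length_le h hvτ' hle
            exact htop y hy hyr (c.mem_trans hvτ hyv)
        · exact ho hyne v hvτ
        · exact absurd (hot hyne).1 hy
      · have := hot hne
        rw [t.choose_next_of_ne _ (by rintro rfl; exact ho'τ hvτ)]
        exact ⟨.inr this.1, this.2⟩
      · rintro x (rfl | hx)
        · exact .inl hvτ
        · exact hZt x hx)
    ⟨hJA, hoA, hZA⟩
  obtain ⟨sC, ZC, runC, hJC, hoC, hZC, hτC, hooC⟩ : ∃ t Z, N.Run sB ZB t Z ∧
      N.CleanInv s₀ {u | u ∈ s₀.path τ'} t Z ∧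
      (s₀.path o' ≠ [] → o' ∈ Z ∧ t.next o' = some (h o')) ∧
      (∀ x ∈ Z, s₀.path x ≠ []) ∧ (∀ x ∈ s₀.path τ, x ≠ N.sink → x ∈ Z) ∧
      (s₀.path o ≠ [] → o ∈ Z) := by
    have hZB' : ∀ x ∈ ZB, s₀.path x ≠ [] := by
      intro x hx
      rcases hZB x hx with h | ⟨rfl, h⟩
      exacts [c.ne_nil_of_mem h, h]
    by_cases hoT : s₀.path o = []
    · exact ⟨sB, ZB, .refl _ _, hJB, hoB, hZB', fun x hx hxr => hGB ⟨hx, hxr⟩,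
        fun h => absurd hoT h⟩
    · have I := hJB.inv
      have hoZ : o ∉ ZB := by
        intro hoZ
        rcases hZB o hoZ with h | ⟨h, -⟩
        exacts [hoτ h, hoo' h]
      obtain ⟨w, hb⟩ := I.exists_best hoZ hor (.inl (by rwa [I.frame_path o hoZ]))
      obtain ⟨-, hwne, how⟩ := N.isValid_iff.1 hb.1
      refine ⟨sB.choose o w, insert o ZB, ?_,
        hJB.choose hoZ hor hb ?_ fun h => absurd h hoτ', fun hne => ?_, ?_,
        fun x hx hxr => .inr (hGB ⟨hx, hxr⟩), fun _ => .inl rfl⟩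
      · rw [← activate_eq_choose hb]
        exact .single hoZ
      · by_contra hw
        rw [Set.mem_union, not_or] at hw
        have hwm := I.mem_self w hwne
        rw [I.frame_path w hw.2] at hwne
        have hwr : w ≠ N.sink := by rintro rfl; exact hw.1 hrτ'
        rcases hT w hwne with h | h | rfl | rfl
        · exact hw.2 (hGB ⟨h, hwr⟩)
        · exact hw.1 h
        · exact how hwm
        · exact hw.2 (hoB hwne).1
      · have := hoB hne
        rw [sB.choose_next_of_ne _ hoo'.symm]
        exact ⟨.inr this.1, this.2⟩
      · rintro x (rfl | hx)
        · exact hoT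
        · exact hZB' x hx
  obtain ⟨sD, ZD, runD, ⟨hJD, hoD, hZD, hτD, hooD⟩, hGD⟩ := Run.exists_of_step (N := N) (s := sC)
    (Z := ZC) {v | v ∈ s₀.path τ' ∧ v ≠ N.sink}
    (fun t Z => N.CleanInv s₀ {u | u ∈ s₀.path τ'} t Z ∧
      (s₀.path o' ≠ [] → o' ∈ Z ∧ t.next o' = some (h o')) ∧
      (∀ x ∈ Z, s₀.path x ≠ []) ∧ (∀ x ∈ s₀.path τ, x ≠ N.sink → x ∈ Z) ∧
      (s₀.path o ≠ [] → o ∈ Z))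
    (by
      rintro t Z ⟨hJt, hot, hZt, hτt, hoot⟩ ⟨g, hg, hgZ⟩
      obtain ⟨v, ⟨⟨hvτ, hvr⟩, hvZ⟩, hmin⟩ := Set.exists_min_image
        {v | (v ∈ s₀.path τ' ∧ v ≠ N.sink) ∧ v ∉ Z} (fun q => (s₀.path q).length)
        (Set.toFinite _) ⟨g, hg, hgZ⟩
      have I := hJt.inv
      have hvne := c.ne_nil_of_mem hvτ
      have hrest : ∀ y ∉ Z, y ≠ N.sink → s₀.path y ≠ [] → y ∈ s₀.path τ' := by
        intro y hy hyr hyne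
        rcases hT y hyne with h | h | rfl | rfl
        · exact absurd (hτt y h hyr) hy
        · exact h
        · exact absurd (hoot hyne) hy
        · exact absurd (hot hyne).1 hy
      obtain ⟨w, hb⟩ := I.exists_best hvZ hvr (.inl (by rwa [I.frame_path v hvZ]))
      obtain ⟨-, hwne, hvw⟩ := N.isValid_iff.1 hb.1
      refine ⟨v, hvZ, ?_⟩
      rw [activate_eq_choose hb]
      refine ⟨hJt.choose hvZ hvr hb ?_ ?_, fun hne => ?_, ?_,
        fun x hx hxr => .inr (hτt x hx hxr), fun hne => .inr (hoot hne)⟩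
      · by_contra hw
        rw [Set.mem_union, not_or] at hw
        rw [I.frame_path w hw.2] at hwne
        have hwr : w ≠ N.sink := by rintro rfl; exact hw.1 hrτ'
        exact hw.1 (hrest w hw.2 hwr hwne)
      · intro _ y hy hyr hyne
        have := hrest y hy hyr hyne
        exact c.mem_path_of_length_le hvτ this (hmin y ⟨⟨this, hyr⟩, hy⟩)
      · have := hot hne
        rw [t.choose_next_of_ne _ (by rintro rfl; exact ho'τ' hvτ)]
        exact ⟨.inr this.1, this.2⟩
      · rintro x (rfl | hx)
        · exact hvne
        · exact hZt x hx)
    ⟨hJC, hoC, hZC, hτC, hooC⟩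
  -- If `o'` had no path, then `o'` and `h o'` are each other's favourites, and whichever is
  -- activated later can take the other. The second alternative says that `h o'` will still have to
  -- do so if `o'` has already been activated.
  obtain ⟨sE, ZE, runE, ⟨hJE, hKE, -⟩, hGE⟩ := Run.exists_of_step (N := N) (s := sD)
    (Z := ZD) {v | v ≠ N.sink}
    (fun t Z => N.CleanInv s₀ {u | u ∈ s₀.path τ'} t Z ∧ ((∃ y ∈ Z, t.next y = some (h y)) ∨
        s₀.path o' = [] ∧ (o' ∈ Z → h o' ∉ Z ∧ h o' ≠ N.sink)) ∧
      ∀ x, s₀.path x ≠ [] → x ≠ N.sink → x ∈ Z)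
    (by
      rintro t Z ⟨hJt, hKt, hTt⟩ ⟨g, hgr, hgZ⟩
      have I := hJt.inv
      obtain ⟨d, hd₀, hd₁, -⟩ := N.exists_dist (T := {x | x = N.sink ∨ x ∈ Z}) (.inl rfl)
      obtain ⟨v, ⟨hvr, hvZ⟩, hmin⟩ := Set.exists_min_image {v | v ≠ N.sink ∧ v ∉ Z} d
        (Set.toFinite _) ⟨g, hgr, hgZ⟩
      have hvne : s₀.path v = [] := by
        by_contra hne
        exact hvZ (hTt v hne hvr)
      obtain ⟨u, hvu, hu⟩ := hd₁ v (by
        rw [Ne, hd₀]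
        rintro (h | h)
        exacts [hvr h, hvZ h])
      have hune : t.path u ≠ [] := by
        by_cases hur : u = N.sink
        · rw [hur]; exact I.sink_ne_nil
        · refine (I.activated u ?_).1
          by_contra huZ
          have := hmin u ⟨hur, huZ⟩
          omega
      have hvt : t.path v = [] := (I.frame_path v hvZ).trans hvne
      have hnm : ∀ x, v ∉ t.path x := fun x hx => (I.sub v hvZ x hx).1 hvt
      obtain ⟨w, hb⟩ := I.exists_best hvZ hvr (.inr ⟨u, hvu, hune⟩)
      obtain ⟨-, hwne, hvw⟩ := N.isValid_iff.1 hb.1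
      refine ⟨v, hvZ, ?_⟩
      rw [activate_eq_choose hb]
      refine ⟨hJt.choose hvZ hvr hb ?_ ?_, ?_, fun x hx hxr => .inr (hTt x hx hxr)⟩
      · by_contra hw
        rw [Set.mem_union, not_or] at hw
        rw [I.frame_path w hw.2] at hwne
        exact hw.2 (hTt w hwne (by rintro rfl; exact hw.1 hrτ'))
      · intro hv
        exact absurd hvne (c.ne_nil_of_mem hv)
      · rcases hKt with ⟨y, hy, hyh⟩ | ⟨ho'T, hK⟩
        · refine .inl ⟨y, .inr hy, ?_⟩
          rwa [t.choose_next_of_ne _ (by rintro rfl; exact hvZ hy)]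
        · have hfav : t.path (h v) ≠ [] → (t.choose v w).next v = some (h v) := by
            intro hne
            have := hb.unique (I.isBestValid_favourite hh hvr hne (hnm _))
            rw [t.choose_next_self, this]
          by_cases hvo : v = o'
          · subst hvo
            by_cases hz : t.path (h v) = []
            · refine .inr ⟨ho'T, fun _ => ⟨?_, ?_⟩⟩
              · rintro (h' | h')
                · exact hh.ne v hvr h'
                · exact (I.activated _ h').1 hz
              · intro h'
                rw [h'] at hz
                exact I.sink_ne_nil hz
            · exact .inl ⟨v, .inl rfl, hfav hz⟩
          · by_cases ho'Z : o' ∈ Z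
            · have := hK ho'Z
              by_cases hvz : v = h o'
              · left
                refine ⟨v, .inl rfl, hfav ?_⟩
                rw [hvz, ho'₂ ho'T]
                exact (I.activated o' ho'Z).1
              · refine .inr ⟨ho'T, fun _ => ⟨?_, this.2⟩⟩
                rintro (h' | h')
                exacts [hvz h'.symm, this.1 h']
            · refine .inr ⟨ho'T, ?_⟩
              rintro (h' | h')
              exacts [absurd h'.symm hvo, absurd h' ho'Z])
    (by
      refine ⟨hJD, ?_, ?_⟩
      · by_cases ho'T : s₀.path o' = []
        · exact .inr ⟨ho'T, fun hZ => absurd ho'T (hZD o' hZ)⟩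
        · exact .inl ⟨o', hoD ho'T⟩
      · intro x hx hxr
        rcases hT x hx with h | h | rfl | rfl
        · exact hτD x h hxr
        · exact hGD ⟨h, hxr⟩
        · exact hooD hx
        · exact (hoD hx).1)
  have hperf : ∀ v, sE.next.Leads v N.sink := by
    intro v
    by_cases hv : v = N.sink
    · rw [hv]
    · exact hJE.clean.reach v (.inr (hGE hv))
  obtain ⟨y, hyZ, hy⟩ : ∃ y ∈ ZE, sE.next y = some (h y) := by
    refine hKE.resolve_right fun hK => ?_
    have := hK.2 (hGE ho'r)
    exact this.1 (hGE this.2)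
  refine hasGoodRound_of_perfect ?_ hJE.inv hGE hperf hh ?_ hy
  · rw [hs₀]
    exact (((runA.trans runB).trans runC).trans runD).trans runE
  · rintro rfl
    exact hJE.inv.sink_notMem hyZ

/-- If all nodes have routing paths, then leaves `o`, `b` and `o'` can take three arcs for good: `o`
its favourite `b`, `o'` its favourite, and `b` its favourite among the nodes other than `o`. -/
theorem hasGoodRound_of_three_leaves [Fintype V] [DecidableEq V] {R : RoutingGraph V}
    (hR : N.Compatible R) {h : V → V} (hh : N.IsFavourite h) {o b o' : V}
    (hall : ∀ x, (N.verified R).path x ≠ [])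
    (hor : o ≠ N.sink) (hbr : b ≠ N.sink) (ho'r : o' ≠ N.sink)
    (hob : h o = b) (ho'o : o' ≠ o) (ho'b : o' ≠ b) (hho'o : h o' ≠ o) (hho'b : h o' ≠ b)
    (ho : ∀ x, o ∈ (N.verified R).path x → x = o) (hb : ∀ x, b ∈ (N.verified R).path x → x = b)
    (ho' : ∀ x, o' ∈ (N.verified R).path x → x = o') : N.HasGoodRound R := by
  classical
  have c := consistent_verified hR
  have hbo : b ≠ o := hob ▸ hh.ne o hor
  have hho' := hh.ne o' ho'r
  obtain ⟨u, hu, hune, he⟩ := c.path_eq b hbr (hall b)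
  have hub : u ≠ b := by rintro rfl; exact c.notMem_next he (c.mem_self hune)
  have huo : u ≠ o := by
    rintro rfl
    exact hbo (ho b (by rw [he]; exact List.mem_cons_of_mem _ (c.mem_self hune)))
  -- Since `o` is activated before `b`, its path runs through `b` and is invalid for `b`, which then
  -- takes the best out-neighbour other than `o`.
  obtain ⟨w, ⟨hbw, hwb, hwo⟩, hwbest⟩ := N.exists_best_of_exists
    (p := fun w => w ≠ b ∧ w ≠ o) ⟨u, c.compat _ _ hu, hub, huo⟩
  have I₀ : N.Inv (N.verified R) (N.verified R) ∅ := c.inv (by simp) (by simp)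
  have best₀ : N.IsBestValid (selfFilter V) (N.verified R) o b := by
    rw [← hob]
    refine I₀.isBestValid_favourite hh hor (hall _) fun hm => ?_
    rw [hob] at hm
    exact hbo (ho b hm)
  set s₁ := (N.verified R).choose o b with hs₁
  have I₁ : N.Inv (N.verified R) s₁ (insert o ∅) := I₀.choose (by simp) hor best₀.1
  have best₁ : N.IsBestValid (selfFilter V) s₁ b w := by
    refine ⟨N.isValid_iff.2 ⟨hbw, ?_, ?_⟩, fun x hx hxw => ?_⟩
    · rw [hs₁, ControlState.choose_path_of_ne _ _ hwo]; exact hall w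
    · rw [hs₁, ControlState.choose_path_of_ne _ _ hwo]; exact fun hm => hwb (hb w hm)
    · obtain ⟨hbx, hxne, hbx'⟩ := N.isValid_iff.1 hx
      refine hwbest x hbx ⟨?_, ?_⟩ hxw
      · rintro rfl; exact hbx' (I₁.mem_self _ hxne)
      · rintro rfl
        rw [hs₁, ControlState.choose_path_self] at hbx'
        exact hbx' (List.mem_cons_of_mem _ (c.mem_self (hall b)))
  set s₂ := s₁.choose b w with hs₂
  have I₂ : N.Inv (N.verified R) s₂ (insert b (insert o ∅)) :=
    I₁.choose (by simpa using hbo) hbr best₁.1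
  have hpath₂ : s₂.path (h o') = (N.verified R).path (h o') := by
    rw [hs₂, ControlState.choose_path_of_ne _ _ hho'b, hs₁,
      ControlState.choose_path_of_ne _ _ hho'o]
  have best₂ : N.IsBestValid (selfFilter V) s₂ o' (h o') := by
    refine I₂.isBestValid_favourite hh ho'r ?_ ?_
    · rw [hpath₂]; exact hall _
    · rw [hpath₂]; exact fun hm => hho' (ho' _ hm)
  set s₃ := s₂.choose o' (h o') with hs₃
  have hZ₃ : o' ∉ insert b (insert o (∅ : Set V)) := by simp [ho'o, ho'b]
  have I₃ : N.Inv (N.verified R) s₃ (insert o' (insert b (insert o ∅))) :=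
    I₂.choose hZ₃ ho'r best₂.1
  have run₃ : N.Run (N.verified R) ∅ s₃ (insert o' (insert b (insert o ∅))) := by
    rw [hs₃, ← activate_eq_choose best₂, hs₂, ← activate_eq_choose best₁, hs₁,
      ← activate_eq_choose best₀]
    exact ((Run.single (by simp)).trans (.single (by simpa using hbo))).trans (.single hZ₃)
  obtain ⟨s₄, Z₄, run₄, ⟨I₄, hZ₄, hn₄⟩, hG₄⟩ := Run.exists_of_step (N := N) (s := s₃)
    (Z := insert o' (insert b (insert o ∅))) {v | v ≠ N.sink}
    (fun t Z => N.Inv (N.verified R) t Z ∧ (o ∈ Z ∧ b ∈ Z ∧ o' ∈ Z) ∧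
      (t.next o = some b ∧ t.next b = some w ∧ t.next o' = some (h o')))
    (by
      rintro t Z ⟨I, hZ, hn⟩ ⟨v, hvr, hvZ⟩
      obtain ⟨x, hx⟩ := I.exists_best hvZ hvr (.inl (by rw [I.frame_path v hvZ]; exact hall v))
      refine ⟨v, hvZ, ?_⟩
      rw [activate_eq_choose hx]
      have hne : ∀ a ∈ Z, a ≠ v := by rintro a ha rfl; exact hvZ ha
      refine ⟨I.choose hvZ hvr hx.1, ⟨.inr hZ.1, .inr hZ.2.1, .inr hZ.2.2⟩, ?_⟩
      rw [t.choose_next_of_ne _ (hne _ hZ.1), t.choose_next_of_ne _ (hne _ hZ.2.1),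
        t.choose_next_of_ne _ (hne _ hZ.2.2)]
      exact hn)
    (by
      refine ⟨I₃, by simp, ?_, ?_, by simp [hs₃]⟩
      · rw [hs₃, ControlState.choose_next_of_ne _ _ ho'o.symm, hs₂,
          ControlState.choose_next_of_ne _ _ hbo.symm, hs₁, ControlState.choose_next_self]
      · rw [hs₃, ControlState.choose_next_of_ne _ _ ho'b.symm, hs₂,
          ControlState.choose_next_self])
  obtain ⟨l, hl, hlm, hs₄⟩ := exists_order_of_run (run₃.trans run₄) I₄ hG₄
  set F : RoutingGraph V := fun v => if v = o then some b else if v = b then some w else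
    if v = o' then some (h o') else none with hF
  have hFo : F o = some b := by simp [hF]
  have hFb : F b = some w := by simp [hF, hbo]
  have hFo' : F o' = some (h o') := by simp [hF, ho'o, ho'b]
  have hFn : ∀ v, v ≠ o → v ≠ b → v ≠ o' → F v = none := fun v h₁ h₂ h₃ => by simp [hF, h₁, h₂, h₃]
  have hFs : ∀ v x, F v = some x → v = o ∧ x = b ∨ v = b ∧ x = w ∨ v = o' ∧ x = h o' := by
    intro v x hvx
    by_cases h₁ : v = o
    · subst h₁; rw [hFo] at hvx; left; simpa using hvx.symm
    by_cases h₂ : v = b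
    · subst h₂; rw [hFb] at hvx; right; left; simpa using hvx.symm
    by_cases h₃ : v = o'
    · subst h₃; rw [hFo'] at hvx; right; right; simpa using hvx.symm
    · simp [hFn v h₁ h₂ h₃] at hvx
  have hreach : ∀ n x, ((N.verified R).path x).length = n → x ≠ o → x ≠ b → x ≠ o' →
      Relation.ReflTransGen (fun v w => N.graph.Adj v w ∧ (F v = none ∨ F v = some w)) x
        N.sink := by
    intro n
    induction n with
    | zero => intro x hx; exact absurd (List.length_eq_zero_iff.1 hx) (hall x)
    | succ n ih =>
      intro x hx h₁ h₂ h₃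
      by_cases hxr : x = N.sink
      · rw [hxr]
      obtain ⟨y, hy, hyne, hxy⟩ := c.path_eq x hxr (hall x)
      have hym : y ∈ (N.verified R).path x := by
        rw [hxy]; exact List.mem_cons_of_mem _ (c.mem_self hyne)
      refine .head ⟨c.compat _ _ hy, .inl (hFn x h₁ h₂ h₃)⟩ (ih y ?_ ?_ ?_ ?_)
      · rw [hxy] at hx; simpa using hx
      · rintro rfl; exact h₁ (ho x hym)
      · rintro rfl; exact h₂ (hb x hym)
      · rintro rfl; exact h₃ (ho' x hym)
  have hreach' : Relation.ReflTransGen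
      (fun v w => N.graph.Adj v w ∧ (F v = none ∨ F v = some w)) o' N.sink :=
    .head ⟨hh.adj _ ho'r, .inr hFo'⟩ (hreach _ _ rfl hho'o hho'b hho')
  have hreachb : Relation.ReflTransGen
      (fun v w => N.graph.Adj v w ∧ (F v = none ∨ F v = some w)) b N.sink := by
    refine .head ⟨hbw, .inr hFb⟩ ?_
    by_cases hwo' : w = o'
    · rw [hwo']; exact hreach'
    · exact hreach _ _ rfl hwo hwb hwo'
  refine ⟨l, hl, hlm, F, hs₄ ▸ ⟨I₄.compat, ?_, ?_, ?_, ?_, ?_⟩, .inr ?_⟩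
  · intro v x hvx
    rcases hFs v x hvx with ⟨rfl, rfl⟩ | ⟨rfl, rfl⟩ | ⟨rfl, rfl⟩
    exacts [hn₄.1, hn₄.2.1, hn₄.2.2]
  -- The choice `w` of `b` may be `o'`, so `o'` needs a level between `b` and the rest.
  · refine ⟨fun v => if v = o then 3 else if v = b then 2 else if v = o' then 1 else 0, ?_⟩
    intro v x hvx
    rcases hFs v x hvx with ⟨rfl, rfl⟩ | ⟨rfl, rfl⟩ | ⟨rfl, rfl⟩
    · simp [hbo]
    · simp only [hwo, hwb, hbo, if_false, if_true]
      split_ifs <;> omega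
    · simp [hho'o, hho'b, hho', ho'o, ho'b]
  · intro v x hvx y hy hyv hyx
    rcases hFs v x hvx with ⟨rfl, rfl⟩ | ⟨rfl, rfl⟩ | ⟨rfl, rfl⟩
    · have hyv' : y ≠ v := by rintro rfl; exact hyv .refl
      have := hh.lt v hor y hy hyv' (by rwa [hob])
      rwa [hob] at this
    · refine hwbest y hy ⟨?_, ?_⟩ hyx
      · rintro rfl; exact hyv .refl
      · rintro rfl; exact hyv (.single hFo)
    · exact hh.lt v ho'r y hy (by rintro rfl; exact hyv .refl) hyx
  · intro v
    by_cases h₁ : v = o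
    · rw [h₁]
      have hadj := hh.adj o hor
      rw [hob] at hadj
      exact .head ⟨hadj, .inr hFo⟩ hreachb
    by_cases h₂ : v = b
    · rw [h₂]; exact hreachb
    by_cases h₃ : v = o'
    · rw [h₃]; exact hreach'
    · exact hreach _ _ rfl h₁ h₂ h₃
  · intro v hv
    exact (I₄.activated v (hG₄ hv)).2
  · have hset : {v | F v ≠ none} = {o, b, o'} := by
      ext v
      simp only [Set.mem_ofPred_eq, Set.mem_insert_iff, Set.mem_singleton_iff]
      refine ⟨fun hv => ?_, ?_⟩
      · by_contra! hcon
        exact hv (hFn v hcon.1 hcon.2.1 hcon.2.2)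
      · rintro (rfl | rfl | rfl) <;> simp [hFo, hFb, hFo']
    rw [hset, Set.ncard_eq_toFinset_card']
    simp [hbo.symm, ho'o.symm, ho'b.symm]

/-! ### Cycles of favourites and the case analysis. -/

/-- A cycle of the functional graph of `h`. -/
structure IsCycle (h : V → V) (C : Set V) : Prop where
  nonempty : C.Nonempty
  map_mem : ∀ x ∈ C, h x ∈ C
  exists_iterate : ∀ x ∈ C, ∀ y ∈ C, ∃ k, h^[k] x = y

theorem IsCycle.iterate_mem {h : V → V} {C : Set V} (hC : IsCycle h C) {x : V} (hx : x ∈ C)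
    (k : ℕ) : h^[k] x ∈ C := by
  induction k with
  | zero => exact hx
  | succ k ih => rw [Function.iterate_succ_apply']; exact hC.map_mem _ ih

theorem IsCycle.exists_pred {h : V → V} {C : Set V} (hC : IsCycle h C) {y : V} (hy : y ∈ C) :
    ∃ x ∈ C, h x = y := by
  obtain ⟨k, hk⟩ := hC.exists_iterate (h y) (hC.map_mem y hy) y hy
  refine ⟨h^[k] y, hC.iterate_mem hy k, ?_⟩
  rw [← Function.iterate_succ_apply' h, Function.iterate_succ_apply, hk]

/-- A node that reaches a node of a cycle reaches every node of the cycle. -/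
theorem IsCycle.exists_iterate_mem {h : V → V} {C A : Set V} (hC : IsCycle h C) {v x : V}
    (hv : ∃ k, h^[k] v ∈ C) (hx : x ∈ C) (hxA : x ∈ A) : ∃ k, h^[k] v ∈ A := by
  obtain ⟨k, hk⟩ := hv
  obtain ⟨j, hj⟩ := hC.exists_iterate _ hk x hx
  exact ⟨j + k, by rw [Function.iterate_add_apply, hj]; exact hxA⟩

theorem exists_isCycle [Finite V] (h : V → V) (v : V) :
    ∃ C, IsCycle h C ∧ ∀ x ∈ C, ∃ k, h^[k] v = x := by
  obtain ⟨i, j, hij, he⟩ := Finite.exists_ne_map_eq_of_infinite fun k : ℕ => h^[k] v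
  wlog hlt : i < j generalizing i j
  · exact this j i hij.symm he.symm (lt_of_le_of_ne (not_lt.1 hlt) hij.symm)
  obtain ⟨p, hp⟩ := Nat.exists_eq_add_of_lt hlt
  have hper : Function.IsPeriodicPt h (p + 1) (h^[i] v) := by
    show h^[p + 1] (h^[i] v) = h^[i] v
    rw [← Function.iterate_add_apply, show p + 1 + i = j by omega, he]
  refine ⟨{x | ∃ k, h^[k] (h^[i] v) = x}, ⟨⟨_, 0, rfl⟩, ?_, ?_⟩, ?_⟩
  · rintro x ⟨k, rfl⟩
    exact ⟨k + 1, Function.iterate_succ_apply' _ _ _⟩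
  · rintro x ⟨k, rfl⟩ y ⟨m, rfl⟩
    -- Together with the `k` steps already made, this completes `k` periods of length `p + 1` and
    -- `m` further steps.
    refine ⟨m + k * p, ?_⟩
    have hk : h^[(p + 1) * k] (h^[i] v) = h^[i] v := hper.mul_const k
    rw [← Function.iterate_add_apply, show m + k * p + k = m + (p + 1) * k by ring,
      Function.iterate_add_apply, hk]
  · rintro x ⟨k, rfl⟩
    exact ⟨k + i, Function.iterate_add_apply _ _ _ _⟩

theorem three_le_ncard [Finite V] {G : Set V} {a b c : V} (ha : a ∈ G) (hb : b ∈ G) (hc : c ∈ G)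
    (hab : a ≠ b) (hac : a ≠ c) (hbc : b ≠ c) : 3 ≤ G.ncard := by
  classical
  rw [← show ({a, b, c} : Set V).ncard = 3 by
    rw [Set.ncard_eq_toFinset_card']; simp [hab, hac, hbc]]
  refine Set.ncard_le_ncard ?_ (Set.toFinite _)
  rintro x (rfl | rfl | rfl)
  exacts [ha, hb, hc]

/-- A cycle `{b, o}` of favourites with an access path of `b` that avoids `C'`. -/
structure TwoCycle [Fintype V] [DecidableEq V] (N : Network V) (R : RoutingGraph V) (h : V → V)
    (C : Set V) (s : ControlState V) (W : Set V) (b o : V) (C' : Set V) : Prop where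
  cycle : IsCycle h C
  access : N.Access R C s W b
  notMem : ∀ x ∈ s.path b, x ∉ C'
  o_mem : o ∈ C
  h_o : h o = b
  h_b : h b = o
  o_notMem : o ∉ s.path b

section

variable [Fintype V] [DecidableEq V] {R : RoutingGraph V} {h : V → V} {C C' W W' : Set V}
  {s s' : ControlState V} {b o b' o' : V}

theorem TwoCycle.disjoint (H : N.TwoCycle R h C s W b o C') (hC' : IsCycle h C') {x : V}
    (hx : x ∈ C) : x ∉ C' := by
  intro hx'
  obtain ⟨k, hk⟩ := H.cycle.exists_iterate x hx b H.access.mem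
  have hb : b ∈ C' := hk ▸ hC'.iterate_mem hx' k
  exact H.notMem b (H.access.start.consistent.mem_self H.access.ne_nil) hb

theorem TwoCycle.b_ne_sink (H : N.TwoCycle R h C s W b o C') (hh : N.IsFavourite h) :
    b ≠ N.sink := by
  rintro rfl
  have := H.h_b
  rw [hh.sink] at this
  exact H.o_notMem (this ▸ H.access.start.consistent.mem_self H.access.ne_nil)

theorem TwoCycle.o_ne_sink (H : N.TwoCycle R h C s W b o C') : o ≠ N.sink := by
  rintro rfl
  exact H.o_notMem (H.access.start.consistent.sink_mem H.access.ne_nil)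

/-- If the old path of `o`, if any, goes through `b`, then some order of activations delivers all
packets. -/
theorem TwoCycle.hasGoodRound_of_mem (hR : N.Compatible R) (hh : N.IsFavourite h)
    (H : N.TwoCycle R h C s W b o C') (H' : N.TwoCycle R h C' s' W' b' o' C)
    (cover : ∀ v, v ∈ s.path b ∨ v ∈ s'.path b' ∨ v = o ∨ v = o')
    (hob : (N.verified R).path o ≠ [] → b ∈ (N.verified R).path o) : N.HasGoodRound R := by
  have c := consistent_verified hR
  obtain ⟨τ, hτ, hτb, hτu⟩ := H.access.trunk
  obtain ⟨τ', hτ', hτb', hτu'⟩ := H'.access.trunk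
  -- The round starts afresh: of the access paths only the old parts, the paths of `τ` and `τ'`, are
  -- used.
  refine hasGoodRound_of_two_paths hR hh hτ hτ' (o := o) (o' := o') ?_ ?_ ?_ ?_ ?_ ?_ ?_ ?_ ?_
  · intro x hx
    rcases cover x with hm | hm | hm
    · exact .inl ((hτu x hx).1 hm)
    · exact .inr (.inl ((hτu' x hx).1 hm))
    · exact .inr (.inr hm)
  · exact fun hm => H.o_notMem ((hτu o (c.ne_nil_of_mem hm)).2 hm)
  · exact fun hm => H'.notMem o ((hτu' o (c.ne_nil_of_mem hm)).2 hm) H.o_mem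
  · exact fun hm => H.notMem o' ((hτu o' (c.ne_nil_of_mem hm)).2 hm) H'.o_mem
  · exact fun hm => H'.o_notMem ((hτu' o' (c.ne_nil_of_mem hm)).2 hm)
  · rintro rfl
    exact H.disjoint H'.cycle H.o_mem H'.o_mem
  · intro ho u hu
    rw [hτb (H.access.direct o H.o_mem ho).1] at hu
    exact c.mem_trans (hob ho) hu
  · intro ho'
    have hb' := (H'.access.direct o' H'.o_mem ho').1
    rw [hτb' hb', H'.h_o]
    exact c.mem_self hb'
  · intro _
    rw [H'.h_o, H'.h_b]

/-- If `o` and `o'` have old paths that avoid `b` and `b'`, then some order of activations makes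
enough progress. -/
theorem TwoCycle.hasGoodRound_of_notMem (hR : N.Compatible R) (hh : N.IsFavourite h)
    (H : N.TwoCycle R h C s W b o C') (H' : N.TwoCycle R h C' s' W' b' o' C)
    (cover : ∀ v, v ∈ s.path b ∨ v ∈ s'.path b' ∨ v = o ∨ v = o')
    (hits : ∀ v, v = N.sink ∨ (∃ k, h^[k] v ∈ C) ∨ ∃ k, h^[k] v ∈ C')
    (ho : (N.verified R).path o ≠ []) (hob : b ∉ (N.verified R).path o)
    (ho' : (N.verified R).path o' ≠ []) (hob' : b' ∉ (N.verified R).path o') :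
    N.HasGoodRound R := by
  have c := consistent_verified hR
  obtain ⟨hb, -, rfl⟩ := H.access.direct o H.o_mem ho
  obtain ⟨hb', -, rfl⟩ := H'.access.direct o' H'.o_mem ho'
  -- The path of `o'` starts on `C'`. If it also meets `C`, it is hit by all walks along favourites.
  by_cases h₁ : ∃ x ∈ (N.verified R).path o', x ∈ C
  · obtain ⟨x, hx, hxC⟩ := h₁
    refine (start_verified hR).hasGoodRound_of_hits hh ho' (by simp) (fun v => ?_) ⟨b', hob'⟩
    rcases hits v with rfl | hv | hv
    · exact ⟨0, c.sink_mem ho'⟩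
    · exact H.cycle.exists_iterate_mem (A := {u | u ∈ (N.verified R).path o'}) hv hxC hx
    · exact H'.cycle.exists_iterate_mem (A := {u | u ∈ (N.verified R).path o'}) hv H'.o_mem
        (c.mem_self ho')
  by_cases h₂ : ∃ x ∈ (N.verified R).path o, x ∈ C'
  · obtain ⟨x, hx, hxC⟩ := h₂
    refine (start_verified hR).hasGoodRound_of_hits hh ho (by simp) (fun v => ?_) ⟨b, hob⟩
    rcases hits v with rfl | hv | hv
    · exact ⟨0, c.sink_mem ho⟩
    · exact H.cycle.exists_iterate_mem (A := {u | u ∈ (N.verified R).path o}) hv H.o_mem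
        (c.mem_self ho)
    · exact H'.cycle.exists_iterate_mem (A := {u | u ∈ (N.verified R).path o}) hv hxC hx
  push Not at h₁ h₂
  have hdis : ∀ {x}, x ∈ C → x ∉ C' := fun hx => H.disjoint H'.cycle hx
  have hne : ∀ {x y}, x ∈ C → y ∈ C' → y ≠ x := by
    rintro x y hx hy rfl
    exact hdis hx hy
  -- Now `o`, `b` and `o'` are leaves: the paths of `b` and `b'` avoid each other's cycles, and so
  -- do those of `o` and `o'`.
  refine hasGoodRound_of_three_leaves hR hh (o := o) (b := b) (o' := o') ?_ H.o_ne_sink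
    (H.b_ne_sink hh) H'.o_ne_sink H.h_o (hne H.o_mem H'.o_mem) (hne H.access.mem H'.o_mem)
    (H'.h_o ▸ hne H.o_mem H'.access.mem) (H'.h_o ▸ hne H.access.mem H'.access.mem) ?_ ?_ ?_
  · intro x
    rcases cover x with hx | hx | rfl | rfl
    exacts [c.ne_nil_of_mem hx, c.ne_nil_of_mem hx, ho, ho']
  · intro x hx
    rcases cover x with hm | hm | rfl | rfl
    · exact absurd (c.mem_trans hm hx) H.o_notMem
    · exact absurd H.o_mem (H'.notMem _ (c.mem_trans hm hx))
    · rfl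
    · exact absurd H.o_mem (h₁ _ hx)
  · intro x hx
    rcases cover x with hm | hm | rfl | rfl
    · exact c.eq_of_mem_of_mem hx hm
    · exact absurd H.access.mem (H'.notMem _ (c.mem_trans hm hx))
    · exact absurd hx hob
    · exact absurd H.access.mem (h₁ _ hx)
  · intro x hx
    rcases cover x with hm | hm | rfl | rfl
    · exact absurd H'.o_mem (H.notMem _ (c.mem_trans hm hx))
    · exact absurd (c.mem_trans hm hx) H'.o_notMem
    · exact absurd H'.o_mem (h₂ _ hx)
    · rfl

/-- Unless some order of activations makes enough progress, only the predecessor of the node `b` of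
the cycle `C` reaches its access path from outside along favourites. -/
theorem Access.hasGoodRound_or_twoCycle (hh : N.IsFavourite h) (hC : IsCycle h C)
    (A : N.Access R C s W b) (hbr : b ≠ N.sink) (hC' : IsCycle h C')
    (hdisj : ∀ x ∈ s.path b, x ∉ C') :
    N.HasGoodRound R ∨ ∃ o, N.TwoCycle R h C s W b o C' ∧
      ∀ v, (∃ k, h^[k] v ∈ C) → v ∈ s.path b ∨ v = o := by
  rw [or_iff_not_imp_left]
  intro hgood
  have c := A.start.consistent
  have hbb := c.mem_self A.ne_nil
  -- The takers are the predecessor `o` of `b`, a node of `C'`, and any further node off the path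
  -- that reaches `C` along favourites; the last kind would bring their number to three.
  obtain ⟨G, hG₁, hG₂, hG₃⟩ := A.start.exists_takers hh A.ne_nil A.subset
  obtain ⟨y, hyC', hyG⟩ := hG₂ C' hC'.nonempty hC'.map_mem fun v hv hm => hdisj v hm hv
  obtain ⟨o, hoC, hob⟩ := hC.exists_pred A.mem
  have hsink : ∀ x ∈ C', ∀ k, h^[k] x ∉ s.path b := fun x hx k hm =>
    hdisj _ hm (hC'.iterate_mem hx k)
  have hobne : o ≠ b := by
    rintro rfl
    exact hh.ne o hbr hob
  have hoQ : o ∉ s.path b := fun hm => hobne (A.eq_of_mem o hm hoC)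
  have hoG : o ∈ G := hG₁ o hoQ ⟨1, by simpa [hob] using hbb⟩
  have huniq : ∀ v, (∃ k, h^[k] v ∈ C) → v ∈ s.path b ∨ v = o := by
    intro v hv
    by_contra! hcon
    have hv' := hC.exists_iterate_mem (A := {u | u ∈ s.path b}) hv A.mem hbb
    refine hgood (hG₃ (three_le_ncard hoG (hG₁ v hcon.1 hv') hyG hcon.2.symm ?_ ?_))
    · rintro rfl
      exact hsink o hyC' 1 (by simpa [hob] using hbb)
    · rintro rfl
      obtain ⟨k, hk⟩ := hv'
      exact hsink v hyC' k hk
  refine ⟨o, ⟨hC, A, hdisj, hoC, hob, ?_, hoQ⟩, huniq⟩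
  -- The path meets `C` only in `b`, so `h b` is off the path and must be `o`: the cycle has length
  -- two.
  refine (huniq (h b) ⟨0, hC.map_mem b A.mem⟩).resolve_left fun hm => ?_
  exact hh.ne b hbr (A.eq_of_mem _ hm (hC.map_mem b A.mem))

/-- Some order of activations makes enough progress. -/
theorem hasGoodRound (hR : N.Compatible R) (hcard : 2 ≤ Fintype.card V) : N.HasGoodRound R := by
  by_contra hgood
  have c := consistent_verified hR
  obtain ⟨h, hh⟩ := N.exists_isFavourite
  have hr := N.verified_path_sink (R := R)
  have hrne : (N.verified R).path N.sink ≠ [] := by simp [hr]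
  have hsink : ∃ v, ∀ k, h^[k] v ≠ N.sink := by
    by_contra! hall
    have : Nontrivial V := Fintype.one_lt_card_iff_nontrivial.1 hcard
    obtain ⟨y, hy⟩ := exists_ne N.sink
    refine hgood ((start_verified hR).hasGoodRound_of_hits hh hrne (by simp) (fun v => ?_)
      ⟨y, by simpa [hr] using hy⟩)
    obtain ⟨k, hk⟩ := hall v
    exact ⟨k, by simp [hr, hk]⟩
  obtain ⟨v₁, hv₁⟩ := hsink
  obtain ⟨C, hC, hCv⟩ := exists_isCycle h v₁
  have hCr : ∀ x ∈ C, x ≠ N.sink := by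
    rintro x hx rfl
    obtain ⟨k, hk⟩ := hCv _ hx
    exact hv₁ k hk
  have pred : ∀ {C : Set V} {s W b}, IsCycle h C → (∀ x ∈ C, x ≠ N.sink) → N.Access R C s W b →
      ∃ y, y ∉ s.path b := by
    intro C s W b hC hCr A
    obtain ⟨y, hy, hyb⟩ := hC.exists_pred A.mem
    refine ⟨y, fun hm => ?_⟩
    obtain rfl := A.eq_of_mem y hm hy
    exact hh.ne y (hCr y hy) hyb
  obtain ⟨s, W, b, A⟩ := exists_access hR hC.nonempty
  obtain ⟨v₂, hv₂⟩ : ∃ v, ∀ k, h^[k] v ∉ s.path b := by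
    by_contra! hall
    exact hgood (A.start.hasGoodRound_of_hits hh A.ne_nil A.subset hall (pred hC hCr A))
  obtain ⟨C', hC', hCv'⟩ := exists_isCycle h v₂
  have hCQ' : ∀ x ∈ s.path b, x ∉ C' := by
    intro x hx hx'
    obtain ⟨k, rfl⟩ := hCv' x hx'
    exact hv₂ k hx
  have hCr' : ∀ x ∈ C', x ≠ N.sink := by
    rintro x hx rfl
    exact hCQ' _ (A.start.consistent.sink_mem A.ne_nil) hx
  have hdis : ∀ x ∈ C, x ∉ C' := by
    intro x hx hx'
    obtain ⟨k, hk⟩ := hC.exists_iterate x hx b A.mem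
    exact hCQ' b (A.start.consistent.mem_self A.ne_nil) (hk ▸ hC'.iterate_mem hx' k)
  have hits : ∀ v, v = N.sink ∨ (∃ k, h^[k] v ∈ C) ∨ ∃ k, h^[k] v ∈ C' := by
    intro v
    -- With the sink alone as the kept path, `C` and `C'` supply two takers. The node `v` gives a
    -- third: itself if its favourites lead to the sink, otherwise a node on a third cycle.
    by_contra! hcon
    obtain ⟨hvr, hvC, hvC'⟩ := hcon
    obtain ⟨G, hG₁, hG₂, hG₃⟩ := (start_verified hR).exists_takers hh hrne (by simp)
    obtain ⟨y, hy, hyG⟩ := hG₂ C hC.nonempty hC.map_mem (by simpa [hr] using hCr)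
    obtain ⟨y', hy', hyG'⟩ := hG₂ C' hC'.nonempty hC'.map_mem (by simpa [hr] using hCr')
    have hyy' : y ≠ y' := by rintro rfl; exact hdis y hy hy'
    by_cases hv : ∃ k, h^[k] v = N.sink
    · refine hgood (hG₃ (three_le_ncard (hG₁ v (by simpa [hr] using hvr) (by simpa [hr] using hv))
        hyG hyG' ?_ ?_ hyy'))
      · rintro rfl; exact hvC 0 hy
      · rintro rfl; exact hvC' 0 hy'
    · obtain ⟨C'', hC'', hCv''⟩ := exists_isCycle h v
      obtain ⟨y'', hy'', hyG''⟩ := hG₂ C'' hC''.nonempty hC''.map_mem (by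
        intro x hx
        obtain ⟨k, rfl⟩ := hCv'' x hx
        push Not at hv
        simpa [hr] using hv k)
      obtain ⟨k, rfl⟩ := hCv'' y'' hy''
      refine hgood (hG₃ (three_le_ncard hyG'' hyG hyG' ?_ ?_ hyy'))
      · rintro rfl; exact hvC k hy
      · rintro rfl; exact hvC' k hy'
  obtain ⟨s', W', b', A'⟩ := exists_access hR hC'.nonempty
  have hCQ : ∀ x ∈ s'.path b', x ∉ C := by
    intro x hx hxC
    have c' := A'.start.consistent
    refine hgood (A'.start.hasGoodRound_of_hits hh A'.ne_nil A'.subset (fun v => ?_)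
      (pred hC' hCr' A'))
    rcases hits v with rfl | hv | hv
    · exact ⟨0, c'.sink_mem A'.ne_nil⟩
    · exact hC.exists_iterate_mem (A := {u | u ∈ s'.path b'}) hv hxC hx
    · exact hC'.exists_iterate_mem (A := {u | u ∈ s'.path b'}) hv A'.mem (c'.mem_self A'.ne_nil)
  obtain ⟨o, H, ho⟩ := (A.hasGoodRound_or_twoCycle hh hC (hCr _ A.mem) hC' hCQ').resolve_left hgood
  obtain ⟨o', H', ho'⟩ :=
    (A'.hasGoodRound_or_twoCycle hh hC' (hCr' _ A'.mem) hC hCQ).resolve_left hgood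
  have cover : ∀ v, v ∈ s.path b ∨ v ∈ s'.path b' ∨ v = o ∨ v = o' := by
    intro v
    rcases hits v with rfl | hv | hv
    · exact .inl (A.start.consistent.sink_mem A.ne_nil)
    · have := ho v hv; tauto
    · have := ho' v hv; tauto
  -- What remains depends on how the old paths of `o` and `o'`, if any, meet `b` and `b'`.
  by_cases h₁ : (N.verified R).path o ≠ [] → b ∈ (N.verified R).path o
  · exact hgood (H.hasGoodRound_of_mem hR hh H' cover h₁)
  by_cases h₂ : (N.verified R).path o' ≠ [] → b' ∈ (N.verified R).path o'
  · refine hgood (H'.hasGoodRound_of_mem hR hh H (fun v => ?_) h₂)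
    have := cover v; tauto
  push Not at h₁ h₂
  exact hgood (H.hasGoodRound_of_notMem hR hh H' cover hits h₁.1 h₁.2 h₂.1 h₂.2)

end

/-! ### Contraction of a forest. -/

/-- A forest of arcs that remain the best choices of their tails as long as they are kept, with the
map to the roots. -/
structure Forest (N : Network V) where
  arc : RoutingGraph V
  root : V → {v // arc v = none}
  root_coe : ∀ c : {v // arc v = none}, root c = c
  root_eq : ∀ v w, arc v = some w → root v = root w
  leads_root : ∀ v, arc.Leads v (root v)
  height : V → ℕ
  height_lt : ∀ v w, arc v = some w → height w < height v
  sink_eq : arc N.sink = none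
  adj : ∀ v w, arc v = some w → N.graph.Adj v w
  best : ∀ v w, arc v = some w → ∀ x, N.graph.Adj v x → ¬ arc.Leads x v → x ≠ w →
    N.rank v w < N.rank v x
  reach : ∀ v, Relation.ReflTransGen
    (fun v w => N.graph.Adj v w ∧ (arc v = none ∨ arc v = some w)) v N.sink

/-- The height bounds all walks along `F`, so each node leads to one without an arc, which is unique
because there is at most one arc from each node. -/
theorem IsContraction.exists_forest {R F : RoutingGraph V} (h : N.IsContraction R F) :
    ∃ P : N.Forest, P.arc = F := by
  obtain ⟨μ, hμ⟩ := h.acyclic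
  have hroot : ∀ n v, μ v = n → ∃ c : {v // F v = none}, F.Leads v c := by
    intro n
    induction n using Nat.strong_induction_on with
    | _ n ih =>
      intro v hv
      cases hF : F v with
      | none => exact ⟨⟨v, hF⟩, .refl⟩
      | some w =>
        obtain ⟨c, hc⟩ := ih _ (hv ▸ hμ v w hF) w rfl
        exact ⟨c, .head hF hc⟩
  have huniq : ∀ v (c d : {v // F v = none}), F.Leads v c → F.Leads v d → c = d := by
    intro v c d hc hd
    rcases hc.total hd with h | h
    · exact Subtype.ext (h.eq_of_next_none c.2)
    · exact Subtype.ext (h.eq_of_next_none d.2).symm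
  choose ρ hρ using fun v => hroot _ v rfl
  refine ⟨⟨F, ρ, fun c => (huniq c _ _ .refl (hρ c)).symm, fun v w hvw => ?_, hρ, μ, hμ, ?_,
    fun v w hvw => h.compat _ _ (h.sub _ _ hvw), h.best, h.reach⟩, rfl⟩
  · exact huniq v _ _ (hρ v) (.head hvw (hρ w))
  · cases hs : F N.sink with
    | none => rfl
    | some w => exact absurd (h.sub _ _ hs) (by simp [h.compat.sink_eq_none])

namespace Forest

variable (P : N.Forest)

/-- The roots of the trees of the forest. -/
abbrev Root : Type _ := {v // P.arc v = none}

variable {P}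

theorem root_eq_of_leads {v w : V} (h : P.arc.Leads v w) : P.root v = P.root w := by
  induction h with
  | refl => rfl
  | tail _ h ih => exact ih.trans (P.root_eq _ _ h)

theorem root_eq_self {v : V} (h : P.arc v = none) : P.root v = ⟨v, h⟩ := P.root_coe ⟨v, h⟩

theorem leads_coe_of_root_eq {v : V} {c : P.Root} (h : P.root v = c) : P.arc.Leads v c :=
  h ▸ P.leads_root v

theorem not_leads_of_arc {v w : V} (h : P.arc v = some w) : ¬ P.arc.Leads w v := by
  have hle : ∀ {x y}, P.arc.Leads x y → P.height y ≤ P.height x := by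
    intro x y hxy
    induction hxy with
    | refl => exact le_rfl
    | tail _ h ih => exact (P.height_lt _ _ h).le.trans ih
  exact fun hwv => absurd (hle hwv) (not_le.2 (P.height_lt _ _ h))

variable (P)

theorem exists_rank_eq {c c' : P.Root} (h : ∃ w, N.graph.Adj c w ∧ P.root w = c') :
    ∃ w, N.graph.Adj c w ∧ P.root w = c' ∧
      N.rank c w = sInf {k | ∃ w, N.graph.Adj c w ∧ P.root w = c' ∧ N.rank c w = k} := by
  obtain ⟨w, hw, hwc⟩ := h
  exact Nat.sInf_mem (s := {k | ∃ w, N.graph.Adj c w ∧ P.root w = c' ∧ N.rank c w = k})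
    ⟨_, w, hw, hwc, rfl⟩

/-- The network of the trees: a tree has the out-neighbours of its root. -/
noncomputable def quotient : Network P.Root where
  -- An arc from a root into its own tree becomes a loop. Networks may have loops, and nonempty
  -- paths contain their own node, so the filter excludes them.
  graph := ⟨fun c c' => ∃ w, N.graph.Adj c w ∧ P.root w = c'⟩
  sink := ⟨N.sink, P.sink_eq⟩
  -- The minima for different out-neighbouring trees are attained at different nodes, so the ranking
  -- is strict. For other pairs the value is the default `0`, which plays no role.
  rank c c' := sInf {k | ∃ w, N.graph.Adj c w ∧ P.root w = c' ∧ N.rank c w = k}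
  rank_injOn := by
    intro c c₁ h₁ c₂ h₂ he
    obtain ⟨w₁, hw₁, rfl, hr₁⟩ := P.exists_rank_eq h₁
    obtain ⟨w₂, hw₂, rfl, hr₂⟩ := P.exists_rank_eq h₂
    rw [N.rank_injOn c hw₁ hw₂ (hr₁.trans (he.trans hr₂.symm))]
  sink_no_out := by
    rintro c ⟨w, hw, -⟩
    exact N.sink_no_out w hw
  reaches_sink := by
    have : ∀ v, Relation.ReflTransGen (fun c c' : P.Root => ∃ w, N.graph.Adj c w ∧ P.root w = c')
        (P.root v) ⟨N.sink, P.sink_eq⟩ := by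
      intro v
      induction P.reach v using Relation.ReflTransGen.head_induction_on with
      | refl => rw [root_eq_self P.sink_eq]
      | @head a b hab _ ih =>
        obtain ⟨hadj, h | h⟩ := hab
        · exact .head ⟨b, by rwa [root_eq_self h], rfl⟩ ih
        · rwa [P.root_eq _ _ h]
    intro c
    have := this c
    rwa [P.root_coe] at this

theorem quotient_adj {c c' : P.Root} :
    P.quotient.graph.Adj c c' ↔ ∃ w, N.graph.Adj c w ∧ P.root w = c' := Iff.rfl

theorem quotient_rank_le {c : P.Root} {w : V} (h : N.graph.Adj c w) :
    P.quotient.rank c (P.root w) ≤ N.rank c w := Nat.sInf_le ⟨w, h, rfl, rfl⟩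

theorem exists_quotient_rank_eq {c c' : P.Root} (h : P.quotient.graph.Adj c c') :
    ∃ w, N.graph.Adj c w ∧ P.root w = c' ∧ N.rank c w = P.quotient.rank c c' :=
  P.exists_rank_eq h

/-! ### Lifting rounds from the network of trees. -/

/-- The state `s` of the network agrees with the state `s'` of the network of trees. -/
structure Sim (s : ControlState V) (s' : ControlState P.Root) : Prop where
  -- Paths are compared as sets only, since validity asks for no more than nonemptiness and
  -- membership.
  map : ∀ x y, y ∈ s.path x → P.root y ∈ s'.path (P.root x)
  lift : ∀ x (c : P.Root), c ∈ s'.path (P.root x) → ↑c ∈ s.path x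
  arc_mem : ∀ x y, s.path x ≠ [] → P.arc.Leads x y → y ∈ s.path x
  next_arc : ∀ v w, P.arc v = some w → s.next v = some w
  next_root : ∀ c : P.Root, s'.next c = (s.next c).map P.root

/-- The root `c` points to the best of its out-neighbours in the same tree. -/
def TightAt (R : RoutingGraph V) (c : P.Root) : Prop :=
  ∀ w, R c = some w → ∀ x, N.graph.Adj c x → P.root x = P.root w → x ≠ w →
    N.rank c w < N.rank c x

variable {P}

namespace Sim

variable {s : ControlState V} {s' : ControlState P.Root} (h : P.Sim s s')
include h

theorem path_ne_nil_iff (x : V) : s.path x ≠ [] ↔ s'.path (P.root x) ≠ [] := by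
  constructor <;> intro hx
  · obtain ⟨y, hy⟩ := List.exists_mem_of_ne_nil _ hx
    exact List.ne_nil_of_mem (h.map x y hy)
  · obtain ⟨y, hy⟩ := List.exists_mem_of_ne_nil _ hx
    exact List.ne_nil_of_mem (h.lift x y hy)

theorem coe_mem_iff (x : V) (c : P.Root) : ↑c ∈ s.path x ↔ c ∈ s'.path (P.root x) :=
  ⟨fun hc => P.root_coe c ▸ h.map x c hc, h.lift x c⟩

theorem isValid_root {c : P.Root} {w : V} (hw : N.graph.Adj c w) :
    N.IsValid (selfFilter V) s c w ↔ P.quotient.IsValid (selfFilter P.Root) s' c (P.root w) := by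
  rw [isValid_iff, isValid_iff, h.path_ne_nil_iff, h.coe_mem_iff]
  simp only [hw, true_and, iff_and_self]
  exact fun _ => ⟨w, hw, rfl⟩

/-- For a root, the out-neighbours in one tree are all valid or all invalid, so its best valid
choice lies in the valid tree of smallest minimal rank. -/
theorem exists_isBestValid {c c' : P.Root}
    (hc : P.quotient.IsBestValid (selfFilter P.Root) s' c c') :
    ∃ w, N.IsBestValid (selfFilter V) s c w ∧ P.root w = c' := by
  obtain ⟨u, hu, rfl⟩ := hc.1.1
  obtain ⟨w, hw⟩ := N.exists_isBestValid ⟨u, (h.isValid_root hu).2 hc.1⟩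
  refine ⟨w, hw, ?_⟩
  have hadj := hw.1.1
  refine IsBestValid.unique hc ⟨(h.isValid_root hadj).1 hw.1, fun x hx hne => ?_⟩
  obtain ⟨y, hy, rfl, hyr⟩ := P.exists_quotient_rank_eq hx.1
  rw [← hyr]
  refine (P.quotient_rank_le hadj).trans_lt (hw.2 y ((h.isValid_root hy).2 hx) ?_)
  rintro rfl
  exact hne rfl

theorem rank_lt_of_isBestValid {c : P.Root} {w : V} (hw : N.IsBestValid (selfFilter V) s c w)
    {x : V} (hx : N.graph.Adj c x) (hxw : P.root x = P.root w) (hne : x ≠ w) :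
    N.rank c w < N.rank c x := by
  refine hw.2 x ((h.isValid_root hx).2 ?_) hne
  rw [hxw]
  exact (h.isValid_root hw.1.1).1 hw.1

end Sim

/-- Activating the nodes of a tree from the top down, after its root, each of them keeps its arc
of the forest. -/
theorem exists_run_tree [Finite V] {s : ControlState V} {Z : Set V} (c : P.Root) (B : Set V)
    (hB : ∀ v ∈ B, P.root v ≠ c) (hc : ∀ y, y ∈ s.path c ↔ y ∈ B ∨ y = c)
    (hnext : ∀ v w, P.arc v = some w → s.next v = some w)
    (harc : ∀ x ≠ (c : V), ∀ y, P.root x = c → s.path x ≠ [] → P.arc.Leads x y → y ∈ s.path x)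
    (hZ : ∀ x ≠ (c : V), P.root x = c → x ∉ Z) :
    ∃ s₁, N.Run s Z s₁ (Z ∪ {x | P.root x = c ∧ x ≠ c}) ∧ s₁.next = s.next ∧
      (∀ x, P.root x ≠ c → s₁.path x = s.path x) ∧
      ∀ x, P.root x = c → ∀ y, y ∈ s₁.path x ↔ y ∈ B ∨ P.arc.Leads x y := by
  let I : ControlState V → Set V → Prop := fun s₁ Z₁ =>
      Z₁ ⊆ Z ∪ {x | P.root x = c ∧ x ≠ c} ∧ s₁.next = s.next ∧
      (∀ x, P.root x ≠ c → s₁.path x = s.path x) ∧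
      (∀ x ≠ (c : V), P.root x = c → x ∉ Z₁ → s₁.path x = s.path x) ∧
      (∀ x, P.root x = c → x = c ∨ x ∈ Z₁ → (∀ y, y ∈ s₁.path x ↔ y ∈ B ∨ P.arc.Leads x y) ∧
        ∀ p, P.arc x = some p → p = c ∨ p ∈ Z₁)
  have hI : I s Z := by
    refine ⟨Set.subset_union_left, rfl, fun _ _ => rfl, fun _ _ _ _ => rfl, fun x hxc hx => ?_⟩
    have hxc' : x = c := hx.elim id fun h => by_contra fun hne => hZ x hne hxc h
    subst hxc'
    refine ⟨fun y => (hc y).trans (or_congr_right ⟨?_, fun h => (h.eq_of_next_none c.2).symm⟩),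
      fun p hp => ?_⟩
    · rintro rfl; exact .refl
    · rw [c.2] at hp; cases hp
  have hstep : ∀ s₁ Z₁, I s₁ Z₁ → (∃ g ∈ {x | P.root x = c ∧ x ≠ c}, g ∉ Z₁) →
      ∃ v, v ∉ Z₁ ∧ I (N.activate (selfFilter V) s₁ v) (insert v Z₁) := by
    rintro s₁ Z₁ ⟨hsub, hnx, hout, htodo, hdone⟩ hg
    obtain ⟨v, ⟨⟨hvc, hvne⟩, hvZ⟩, hmin⟩ := exists_minimalFor_of_wellFoundedLT
      (fun g => g ∈ {x | P.root x = c ∧ x ≠ c} ∧ g ∉ Z₁) P.height hg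
    cases hv : P.arc v with
    | none => exact absurd (congrArg Subtype.val ((root_eq_self hv).symm.trans hvc)) hvne
    | some p =>
      have hpc : P.root p = c := (P.root_eq _ _ hv).symm.trans hvc
      have hp : p = c ∨ p ∈ Z₁ := by
        by_contra! hp
        exact absurd (hmin ⟨⟨hpc, hp.1⟩, hp.2⟩ (P.height_lt _ _ hv).le)
          (not_le.2 (P.height_lt _ _ hv))
      have hpath := (hdone p hpc hp).1
      have hbest : N.IsBestValid (selfFilter V) s₁ v p := by
        refine ⟨N.isValid_iff.2 ⟨P.adj _ _ hv, List.ne_nil_of_mem ((hpath p).2 (.inr .refl)), ?_⟩,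
          fun x hx hxp => ?_⟩
        · rw [hpath]
          rintro (h | h)
          · exact hB v h hvc
          · exact not_leads_of_arc hv h
        · obtain ⟨hvx, hxne, hxv⟩ := N.isValid_iff.1 hx
          -- An out-neighbour below `v` in the forest is invalid: its stored path, renewed or not,
          -- contains `v`.
          refine P.best v p hv x hvx (fun hlead => hxv ?_) hxp
          have hxc : P.root x = c := (root_eq_of_leads hlead).trans hvc
          by_cases hxd : x = c ∨ x ∈ Z₁
          · exact ((hdone x hxc hxd).1 v).2 (.inr hlead)
          · push Not at hxd
            have he := htodo x hxd.1 hxc hxd.2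
            rw [he] at hxne ⊢
            exact harc x hxd.1 v hxc hxne hlead
      refine ⟨v, hvZ, ?_⟩
      rw [activate_eq_choose hbest]
      refine ⟨Set.insert_subset (.inr ⟨hvc, hvne⟩) hsub, ?_, ?_, ?_, ?_⟩
      · funext x
        by_cases hx : x = v
        · subst hx
          rw [s₁.choose_next_self, hnext _ _ hv]
        · rw [s₁.choose_next_of_ne _ hx, hnx]
      · intro x hx
        rw [s₁.choose_path_of_ne _ (by rintro rfl; exact hx hvc), hout x hx]
      · intro x hxc hx hxZ
        rw [Set.mem_insert_iff, not_or] at hxZ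
        rw [s₁.choose_path_of_ne _ hxZ.1, htodo x hxc hx hxZ.2]
      · intro x hxc hx
        by_cases hxv : x = v
        · subst hxv
          refine ⟨fun y => ?_, fun q hq => ?_⟩
          · rw [s₁.choose_path_self, List.mem_cons, hpath]
            constructor
            · rintro (rfl | h | h)
              · exact .inr .refl
              · exact .inl h
              · exact .inr (.head hv h)
            · rintro (h | h)
              · exact .inr (.inl h)
              · rcases h.eq_or_head with rfl | ⟨q, hq, h⟩
                · exact .inl rfl
                · rw [hv, Option.some.injEq] at hq
                  subst hq
                  exact .inr (.inr h)
          · rw [hv, Option.some.injEq] at hq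
            subst hq
            exact hp.imp_right (Set.mem_insert_of_mem _)
        · have hx' : x = c ∨ x ∈ Z₁ := hx.imp_right fun h => h.resolve_left hxv
          rw [s₁.choose_path_of_ne _ hxv]
          exact ⟨(hdone x hxc hx').1, fun q hq =>
            ((hdone x hxc hx').2 q hq).imp_right (Set.mem_insert_of_mem _)⟩
  obtain ⟨s₁, Z₁, hrun, ⟨hsub, hnx, hout, htodo, hdone⟩, hG⟩ := Run.exists_of_step _ I hstep hI
  have hZ₁ : Z₁ = Z ∪ {x | P.root x = c ∧ x ≠ c} :=
    hsub.antisymm (Set.union_subset hrun.subset hG)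
  subst hZ₁
  refine ⟨s₁, hrun, hnx, hout, fun x hx => (hdone x hx ?_).1⟩
  by_cases hxc : x = c
  · exact .inl hxc
  · exact .inr (.inr ⟨hx, hxc⟩)

end Forest

theorem activate_next_of_ne {D : V → Set V} {s : ControlState V} {v x : V} (h : x ≠ v) :
    (N.activate D s v).next x = s.next x := by
  classical
  unfold activate
  split_ifs <;> simp [h]

theorem activate_next_eq_none {D : V → Set V} {s : ControlState V} {v : V}
    (h : ¬ ∃ w, N.IsBestValid D s v w) : (N.activate D s v).next v = none := by
  unfold activate
  rw [dif_neg h]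
  simp

theorem foldl_activate_next_of_notMem {D : V → Set V} {l : List V} {s : ControlState V} {x : V}
    (h : x ∉ l) : (l.foldl (N.activate D) s).next x = s.next x := by
  induction l generalizing s with
  | nil => rfl
  | cons v l ih =>
    rw [List.mem_cons, not_or] at h
    rw [List.foldl_cons, ih h.2, activate_next_of_ne h.1]

theorem Compatible.activate {D : V → Set V} {s : ControlState V} (h : N.Compatible s.next) (v : V) :
    N.Compatible (N.activate D s v).next := by
  intro x w hx
  by_cases hxv : x = v
  · subst hxv
    by_cases hex : ∃ w, N.IsBestValid D s x w
    · obtain ⟨u, hu⟩ := hex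
      rw [activate_eq_choose hu, s.choose_next_self, Option.some.injEq] at hx
      exact hx ▸ hu.1.1
    · rw [activate_next_eq_none hex] at hx
      cases hx
  · rw [activate_next_of_ne hxv] at hx
    exact h _ _ hx

theorem Compatible.foldl_activate {D : V → Set V} {s : ControlState V} (h : N.Compatible s.next)
    (l : List V) : N.Compatible (l.foldl (N.activate D) s).next := by
  induction l generalizing s with
  | nil => exact h
  | cons v l ih => exact ih (h.activate v)

theorem Compatible.routing [Fintype V] [DecidableEq V] {D : V → Set V} {π : ℕ → List V}
    {R₀ : RoutingGraph V} (h : N.Compatible R₀) (t : ℕ) : N.Compatible (N.routing D π R₀ t) := by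
  induction t with
  | zero => exact h
  | succ t ih => exact Compatible.foldl_activate (s := N.verified _) ih _

namespace Forest

variable (P : N.Forest)

/-- The next hops of the trees. -/
def push (R : RoutingGraph V) : RoutingGraph P.Root := fun c => (R c).map P.root

variable {P} {R : RoutingGraph V}

theorem compatible_push (hR : N.Compatible R) : P.quotient.Compatible (P.push R) := by
  intro c c' h
  obtain ⟨w, hw, rfl⟩ := Option.map_eq_some_iff.1 h
  exact ⟨w, hR _ _ hw, rfl⟩

theorem leads_push (hF : ∀ v w, P.arc v = some w → R v = some w) {x y : V} (h : R.Leads x y) :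
    (P.push R).Leads (P.root x) (P.root y) := by
  induction h with
  | refl => exact .refl
  | @tail a b _ hab ih =>
    cases ha : P.arc a with
    | none =>
      refine ih.tail ?_
      rw [root_eq_self ha, push, hab, Option.map_some]
    | some w =>
      have : w = b := by simpa [hF a w ha] using hab
      subst this
      rwa [← P.root_eq _ _ ha]

theorem leads_of_leads_push (hF : ∀ v w, P.arc v = some w → R v = some w) {x : V} {c : P.Root}
    (h : (P.push R).Leads (P.root x) c) : R.Leads x c := by
  refine ((P.leads_root x).mono hF).trans ?_
  generalize P.root x = d at h
  induction h using Relation.ReflTransGen.head_induction_on with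
  | refl => exact .refl
  | @head a b hab _ ih =>
    obtain ⟨w, hw, rfl⟩ := Option.map_eq_some_iff.1 hab
    exact .head hw (((P.leads_root w).mono hF).trans ih)

theorem leads_push_iff (hF : ∀ v w, P.arc v = some w → R v = some w) {x : V} {c : P.Root} :
    (P.push R).Leads (P.root x) c ↔ R.Leads x c := by
  refine ⟨leads_of_leads_push hF, fun h => ?_⟩
  have := leads_push hF h
  rwa [P.root_coe] at this

variable [Fintype V] [DecidableEq V] [Fintype P.Root] [DecidableEq P.Root]

theorem sim_verified (hR : N.Compatible R) (hF : ∀ v w, P.arc v = some w → R v = some w) :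
    P.Sim (N.verified R) (P.quotient.verified (P.push R)) where
  map x y h := by
    have c := consistent_verified hR
    have c' := consistent_verified (compatible_push (P := P) hR)
    rw [c.mem_path_iff, verified_path_ne_nil_iff hR] at h
    rw [c'.mem_path_iff, verified_path_ne_nil_iff (compatible_push hR)]
    refine ⟨?_, leads_push hF h.2⟩
    have := leads_push hF h.1
    rwa [root_eq_self P.sink_eq] at this
  lift x d h := by
    have c := consistent_verified hR
    have c' := consistent_verified (compatible_push (P := P) hR)
    rw [c'.mem_path_iff, verified_path_ne_nil_iff (compatible_push hR)] at h
    rw [c.mem_path_iff, verified_path_ne_nil_iff hR]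
    exact ⟨leads_of_leads_push hF h.1, leads_of_leads_push hF h.2⟩
  arc_mem x y hx h := (consistent_verified hR).mem_of_leads hx (h.mono hF)
  next_arc := hF
  next_root _ := rfl

omit [DecidableEq V] [Fintype P.Root] [DecidableEq P.Root] in
/-- An activation in the network of trees is followed by the activation of a tree. -/
theorem Sim.exists_run {s : ControlState V} {s' : ControlState P.Root} (h : P.Sim s s')
    {c c' : P.Root} (hc : P.quotient.IsBestValid (selfFilter P.Root) s' c c') {Z : Set V}
    (hZ : ∀ x, P.root x = c → x ∉ Z) :
    ∃ s₁, N.Run s Z s₁ (Z ∪ {x | P.root x = c}) ∧ P.Sim s₁ (s'.choose c c') ∧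
      (∀ d ≠ c, s₁.next d = s.next d) ∧ P.TightAt s₁.next c := by
  obtain ⟨w, hw, rfl⟩ := h.exists_isBestValid hc
  obtain ⟨hadj, hne, hcw⟩ := N.isValid_iff.1 hw.1
  have hnext : ∀ v x, P.arc v = some x → (s.choose c w).next v = some x := by
    intro v x hv
    rw [s.choose_next_of_ne, h.next_arc _ _ hv]
    rintro rfl
    rw [c.2] at hv
    cases hv
  obtain ⟨s₁, hrun, hnx, hout, hin⟩ := exists_run_tree (N := N) (P := P) (s := s.choose c w)
    (Z := insert ↑c Z) c {y | y ∈ s.path w}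
    (by
      rintro v hv rfl
      exact hcw (h.lift w _ (h.map w v hv)))
    (by
      intro y
      rw [s.choose_path_self, List.mem_cons, or_comm]
      rfl) hnext
    (by
      intro x hx y hxc hxne hxy
      rw [s.choose_path_of_ne _ hx] at hxne ⊢
      exact h.arc_mem x y hxne hxy)
    (by
      rintro x hx hxc (h | h)
      · exact hx h
      · exact hZ x hxc h)
  have hout' : ∀ x, P.root x ≠ c → s₁.path x = s.path x := by
    intro x hx
    rw [hout x hx, s.choose_path_of_ne]
    rintro rfl
    exact hx (P.root_coe c)
  refine ⟨s₁, ?_, ⟨?_, ?_, ?_, ?_, ?_⟩, ?_, ?_⟩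
  · have hrun' := (Run.single (N := N) (s := s) (hZ c (P.root_coe c))).trans
      ((activate_eq_choose hw).symm ▸ hrun)
    convert hrun' using 1
    ext x
    simp only [Set.mem_union, Set.mem_insert_iff, Set.mem_ofPred_eq]
    by_cases hx : x = c
    · simp [hx, P.root_coe]
    · simp [hx]
  · intro x y hy
    by_cases hx : P.root x = c
    · rw [hx, s'.choose_path_self]
      rcases (hin x hx y).1 hy with hy | hy
      · exact List.mem_cons_of_mem _ (h.map w y hy)
      · rw [← root_eq_of_leads hy, hx]
        exact List.mem_cons_self
    · rw [s'.choose_path_of_ne _ hx]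
      rw [hout' x hx] at hy
      exact h.map x y hy
  · intro x d hd
    by_cases hx : P.root x = c
    · rw [hx, s'.choose_path_self] at hd
      rw [hin x hx]
      rcases List.mem_cons.1 hd with rfl | hd
      · exact .inr (leads_coe_of_root_eq hx)
      · exact .inl (h.lift w d hd)
    · rw [s'.choose_path_of_ne _ hx] at hd
      rw [hout' x hx]
      exact h.lift x d hd
  · intro x y hx hxy
    by_cases hxc : P.root x = c
    · exact (hin x hxc y).2 (.inr hxy)
    · rw [hout' x hxc] at hx ⊢
      exact h.arc_mem x y hx hxy
  · rw [hnx]; exact hnext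
  · intro d
    rw [hnx]
    by_cases hd : d = c
    · subst hd; simp
    · rw [s'.choose_next_of_ne _ hd, s.choose_next_of_ne _ (fun h => hd (Subtype.ext h)),
        h.next_root]
  · intro d hd
    rw [hnx, s.choose_next_of_ne _ (fun h => hd (Subtype.ext h))]
  · intro x hx y hy hyx hne
    rw [hnx, s.choose_next_self, Option.some.injEq] at hx
    subst hx
    exact h.rank_lt_of_isBestValid hw hy hyx hne

-- An activation without a valid choice cannot be imitated by `Sim.exists_run`. The hypothesis `hs`
-- rules it out, because a next hop set in the round is not changed again in that round.
omit [DecidableEq V] [Fintype P.Root] [DecidableEq P.Root] in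
theorem Sim.exists_run_foldl {l : List P.Root} {s : ControlState V} {s' : ControlState P.Root}
    (h : P.Sim s s') {Z : Set V} (hl : l.Nodup) (hZ : ∀ x, P.root x ∈ l → x ∉ Z)
    (hs : ∀ c ∈ l, (l.foldl (P.quotient.activate (selfFilter P.Root)) s').next c ≠ none) :
    ∃ s₁, N.Run s Z s₁ (Z ∪ {x | P.root x ∈ l}) ∧
      P.Sim s₁ (l.foldl (P.quotient.activate (selfFilter P.Root)) s') ∧
      (∀ d ∉ l, s₁.next d = s.next d) ∧ ∀ c ∈ l, P.TightAt s₁.next c := by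
  induction l generalizing s s' Z with
  | nil => exact ⟨s, by simpa using Run.refl s Z, h, by simp, by simp⟩
  | cons c l ih =>
    rw [List.nodup_cons] at hl
    have hex : ∃ c', P.quotient.IsBestValid (selfFilter P.Root) s' c c' := by
      by_contra hex
      refine hs c List.mem_cons_self ?_
      rw [List.foldl_cons, foldl_activate_next_of_notMem hl.1, activate_next_eq_none hex]
    obtain ⟨c', hc'⟩ := hex
    rw [List.foldl_cons, activate_eq_choose hc'] at hs ⊢
    obtain ⟨s₁, hrun, h₁, hnext₁, htight₁⟩ := h.exists_run hc' (Z := Z)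
      fun x hx => hZ x (hx ▸ List.mem_cons_self)
    obtain ⟨s₂, hrun₂, h₂, hnext₂, htight₂⟩ := ih h₁ (Z := Z ∪ {x | P.root x = c}) hl.2
      (by
        rintro x hx (hxZ | hxc)
        · exact hZ x (List.mem_cons_of_mem _ hx) hxZ
        · exact hl.1 ((show P.root x = c from hxc) ▸ hx))
      fun d hd => hs d (List.mem_cons_of_mem _ hd)
    refine ⟨s₂, ?_, h₂, ?_, ?_⟩
    · convert hrun.trans hrun₂ using 1
      ext x
      simp [or_assoc]
    · intro d hd
      rw [List.mem_cons, not_or] at hd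
      rw [hnext₂ d hd.2, hnext₁ d hd.1]
    · intro d hd
      rcases List.mem_cons.1 hd with rfl | hd
      · unfold TightAt
        rw [hnext₂ d hl.1]
        exact htight₁
      · exact htight₂ d hd

/-- A round in the network of trees is followed by a round in the network. -/
theorem exists_order (hR : N.Compatible R) (hF : ∀ v w, P.arc v = some w → R v = some w)
    {l : List P.Root} (hl : l.Nodup) (hlm : ∀ c, c ∈ l ↔ c ≠ P.quotient.sink)
    (hs : ∀ c ≠ P.quotient.sink, (l.foldl (P.quotient.activate (selfFilter P.Root))
      (P.quotient.verified (P.push R))).next c ≠ none) :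
    ∃ l' : List V, l'.Nodup ∧ (∀ v, v ∈ l' ↔ v ≠ N.sink) ∧ ∃ R',
      R' = (l'.foldl (N.activate (selfFilter V)) (N.verified R)).next ∧
      (∀ v w, P.arc v = some w → R' v = some w) ∧
      (l.foldl (P.quotient.activate (selfFilter P.Root))
        (P.quotient.verified (P.push R))).next = P.push R' ∧
      ∀ c ≠ P.quotient.sink, P.TightAt R' c := by
  have h₀ := sim_verified (P := P) hR hF
  have hsink : ∀ x, P.root x = P.quotient.sink → ∀ y, P.arc.Leads x y →
      P.root y = P.quotient.sink := fun x hx y hy => root_eq_of_leads hy ▸ hx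
  -- The sink is never activated in the network of trees, so the other nodes of its tree are
  -- activated separately, before all other trees.
  obtain ⟨s₁, hrun₁, hnx, hout, hin⟩ := exists_run_tree (N := N) (P := P) (s := N.verified R)
    (Z := ∅) P.quotient.sink ∅ (by simp)
    (fun y => by
      rw [show ((P.quotient.sink : P.Root) : V) = N.sink from rfl, verified_path_sink]
      simp) hF
    (fun x _ y _ hx hxy => h₀.arc_mem x y hx hxy) (by simp)
  have h₁ : P.Sim s₁ (P.quotient.verified (P.push R)) := by
    refine ⟨?_, ?_, ?_, ?_, ?_⟩
    · intro x y hy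
      by_cases hx : P.root x = P.quotient.sink
      · have := ((hin x hx y).1 hy).resolve_left (by simp)
        rw [hsink x hx y this, hx, verified_path_sink]
        simp
      · rw [hout x hx] at hy
        exact h₀.map x y hy
    · intro x c hc
      by_cases hx : P.root x = P.quotient.sink
      · rw [hx, verified_path_sink, List.mem_singleton] at hc
        subst hc
        exact (hin x hx _).2 (.inr (leads_coe_of_root_eq hx))
      · rw [hout x hx]
        exact h₀.lift x c hc
    · intro x y hx hxy
      by_cases hxc : P.root x = P.quotient.sink
      · exact (hin x hxc y).2 (.inr hxy)
      · rw [hout x hxc] at hx ⊢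
        exact h₀.arc_mem x y hx hxy
    · rw [hnx]; exact hF
    · rw [hnx]; exact h₀.next_root
  obtain ⟨s₂, hrun₂, h₂, -, htight⟩ := h₁.exists_run_foldl
    (Z := ∅ ∪ {x | P.root x = P.quotient.sink ∧ x ≠ (P.quotient.sink : P.Root)}) hl
    (by
      rintro x hx (h | h)
      · exact h
      · exact (hlm _).1 hx h.1)
    fun c hc => hs c ((hlm c).1 hc)
  obtain ⟨l', hl', -, hs₂, hZ⟩ := hrun₁.trans hrun₂
  refine ⟨l', hl', fun v => ?_, s₂.next, by rw [hs₂], h₂.next_arc, ?_,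
    fun c hc => htight c ((hlm c).2 hc)⟩
  · have := congrArg (v ∈ ·) hZ
    simp only [Set.mem_union, Set.mem_ofPred_eq, Set.mem_empty_iff_false, false_or, hlm,
      eq_iff_iff] at this
    rw [← this]
    by_cases hv : P.root v = P.quotient.sink
    · simp [hv]; rfl
    · simp only [hv, not_false_eq_true, ne_eq, or_true, true_iff, false_and]
      rintro rfl
      exact hv (root_eq_self P.sink_eq)
  · funext c
    exact h₂.next_root c

end Forest

end Network

/-! ### Stability, the induction, and the count of imperfect rounds. -/

namespace Network

variable {V : Type*} [Fintype V] [DecidableEq V] {N : Network V}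

omit [DecidableEq V] in
theorem IsStableSpanningTree.not_isImperfect {R : RoutingGraph V} (h : N.IsStableSpanningTree R) :
    ¬ N.IsImperfect R :=
  (not_isImperfect_iff h.1.1).2 fun v => RoutingGraph.isDescendant_iff_leads.1 (h.1.2 v)

/-- In a stable spanning tree every activation keeps the next hop. -/
theorem IsStableSpanningTree.foldl_activate {R : RoutingGraph V} (h : N.IsStableSpanningTree R)
    {l : List V} (hl : ∀ v ∈ l, v ≠ N.sink) :
    l.foldl (N.activate (selfFilter V)) (N.verified R) = N.verified R := by
  classical
  obtain ⟨⟨hR, htree⟩, hbest⟩ := h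
  have c := consistent_verified hR
  have hne : ∀ v, (N.verified R).path v ≠ [] := fun v =>
    (verified_path_ne_nil_iff hR v).2 (RoutingGraph.isDescendant_iff_leads.1 (htree v))
  induction l with
  | nil => rfl
  | cons v l ih =>
    obtain ⟨w, hw, hwne, he⟩ := c.path_eq v (hl v List.mem_cons_self) (hne v)
    have hb : N.IsBestValid (selfFilter V) (N.verified R) v w := by
      refine ⟨N.isValid_iff.2 ⟨hR _ _ hw, hwne, c.notMem_next he⟩, fun x hx hxw => ?_⟩
      obtain ⟨hvx, hxne, hxv⟩ := N.isValid_iff.1 hx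
      refine hbest v w hw x hvx (fun hd => hxv ?_) hxw
      exact c.mem_of_leads hxne (RoutingGraph.isDescendant_iff_leads.1 hd)
    have hs : (N.verified R).choose v w = N.verified R := by
      rw [ControlState.choose, ← he, ← hw]
      simp
    rw [List.foldl_cons, activate_eq_choose hb, hs]
    exact ih fun x hx => hl x (List.mem_cons_of_mem _ hx)

theorem routing_eq_of_stable {π : ℕ → List V} (hπ : N.IsFair π) {R₀ : RoutingGraph V} {t : ℕ}
    (h : N.IsStableSpanningTree (N.routing (selfFilter V) π R₀ t)) {t' : ℕ} (ht : t ≤ t') :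
    N.routing (selfFilter V) π R₀ t' = N.routing (selfFilter V) π R₀ t := by
  induction t', ht using Nat.le_induction with
  | base => rfl
  | succ t' _ ih =>
    rw [routing, ih, h.foldl_activate fun v hv => ((hπ t').2 v).1 hv]
    rfl

/-- Some fair activation sequence reaches a stable spanning tree in `card V - 1` rounds, with few
imperfect rounds. -/
def Settles (N : Network V) (R₀ : RoutingGraph V) : Prop :=
  ∃ π : ℕ → List V, N.IsFair π ∧
    -- This clause is what allows the sequence to be lifted from a network of trees.
    (∀ t, ∀ v ≠ N.sink, N.routing (selfFilter V) π R₀ (t + 1) v ≠ none) ∧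
    N.IsStableSpanningTree (N.routing (selfFilter V) π R₀ (Fintype.card V - 1)) ∧
    -- The bound is sharper than `card V / 3`: for at least two nodes it is one less than `(card V +
    -- 1) / 3`, which is what the deadline for the packets needs.
    {t : ℕ | 1 ≤ t ∧ N.IsImperfect (N.routing (selfFilter V) π R₀ t)}.encard ≤
      (((Fintype.card V - 2) / 3 : ℕ) : ℕ∞)

theorem settles_of_subsingleton [Subsingleton V] {R₀ : RoutingGraph V} (hR₀ : N.Compatible R₀) :
    N.Settles R₀ := by
  have hsub : ∀ v, v = N.sink := fun v => Subsingleton.elim _ _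
  have hcard : Fintype.card V - 1 = 0 := by
    have := Fintype.card_le_one_iff_subsingleton.2 ‹Subsingleton V›
    omega
  refine ⟨fun _ => [], fun t => ⟨List.nodup_nil, fun v => by simp [hsub v]⟩,
    fun t v hv => absurd (hsub v) hv, ?_, ?_⟩
  · rw [hcard]
    refine ⟨⟨hR₀, fun v => ⟨0, hsub _⟩⟩, fun v w hvw => ?_⟩
    exact absurd (hsub v ▸ hR₀ _ _ hvw) (N.sink_no_out w)
  · have : {t : ℕ | 1 ≤ t ∧ N.IsImperfect (N.routing (selfFilter V) (fun _ => []) R₀ t)} = ∅ := by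
      ext t
      simp only [Set.mem_ofPred_eq, Set.mem_empty_iff_false, iff_false, not_and]
      exact fun _ => (not_isImperfect_iff (hR₀.routing t)).2 fun v => by rw [hsub v]
    rw [this]
    simp

namespace Forest

variable {P : N.Forest} {R : RoutingGraph V} [Fintype P.Root] [DecidableEq P.Root]

omit [DecidableEq V] [DecidableEq P.Root] in
theorem card_root_add : Fintype.card P.Root + {v | P.arc v ≠ none}.ncard = Fintype.card V := by
  rw [← Nat.card_eq_fintype_card, ← Nat.card_eq_fintype_card]
  exact Set.ncard_add_ncard_compl {v | P.arc v = none}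

omit [DecidableEq V] [DecidableEq P.Root] in
theorem isImperfect_push_iff (hR : N.Compatible R)
    (hF : ∀ v w, P.arc v = some w → R v = some w) :
    P.quotient.IsImperfect (P.push R) ↔ N.IsImperfect R := by
  rw [← not_iff_not, not_isImperfect_iff hR, not_isImperfect_iff (compatible_push hR)]
  refine ⟨fun h v => (leads_push_iff hF).1 (h (P.root v)), fun h c => ?_⟩
  rw [← P.root_coe c]
  exact (leads_push_iff hF).2 (h c)

-- Arcs of the forest are best by `Forest.best`. At a root, stability of the tree network compares
-- nodes in different trees, and `TightAt` compares nodes in the same tree.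
omit [Fintype V] [DecidableEq V] [Fintype P.Root] [DecidableEq P.Root] in
theorem isStableSpanningTree_of_push (hR : N.Compatible R)
    (hF : ∀ v w, P.arc v = some w → R v = some w)
    (ht : ∀ c ≠ P.quotient.sink, P.TightAt R c)
    (h : P.quotient.IsStableSpanningTree (P.push R)) : N.IsStableSpanningTree R := by
  obtain ⟨⟨-, htree⟩, hbest⟩ := h
  refine ⟨⟨hR, fun v => ?_⟩, fun v w hvw x hx hxv hxw => ?_⟩
  · exact RoutingGraph.isDescendant_iff_leads.2 ((leads_push_iff hF).1
      (RoutingGraph.isDescendant_iff_leads.1 (htree (P.root v))))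
  · rw [RoutingGraph.isDescendant_iff_leads] at hxv
    cases hv : P.arc v with
    | some u =>
      have : u = w := by simpa [hF _ _ hv] using hvw
      subst this
      exact P.best v u hv x hx (fun h => hxv (h.mono hF)) hxw
    | none =>
      have hne : (⟨v, hv⟩ : P.Root) ≠ P.quotient.sink := by
        intro he
        have : v = N.sink := congrArg Subtype.val he
        subst this
        exact N.sink_no_out _ hx
      by_cases hroot : P.root x = P.root w
      · exact ht ⟨v, hv⟩ hne w hvw x hx hroot hxw
      · have hpush : P.push R ⟨v, hv⟩ = some (P.root w) := by simp [push, hvw]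
        have hvw' : N.graph.Adj (⟨v, hv⟩ : P.Root) w := hR _ _ hvw
        have hlt := hbest ⟨v, hv⟩ (P.root w) hpush (P.root x) ⟨x, hx, rfl⟩
          (fun hd => hxv ((leads_push_iff hF).1 (RoutingGraph.isDescendant_iff_leads.1 hd))) hroot
        obtain ⟨u, hu, huw, hur⟩ := P.exists_quotient_rank_eq (P.quotient_adj.2 ⟨w, hvw', rfl⟩)
        by_cases hue : u = w
        · subst hue
          rw [← hur] at hlt
          exact hlt.trans_le (P.quotient_rank_le (c := ⟨v, hv⟩) hx)
        · have h₁ := ht ⟨v, hv⟩ hne w hvw u hu huw hue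
          rw [hur] at h₁
          exact h₁.trans (hlt.trans_le (P.quotient_rank_le (c := ⟨v, hv⟩) hx))

/-- A sequence for the network of trees is followed by a sequence for the network. -/
theorem exists_sequence (hR : N.Compatible R) (hF : ∀ v w, P.arc v = some w → R v = some w)
    {σ : ℕ → List P.Root} (hσ : P.quotient.IsFair σ)
    (hs : ∀ t, ∀ c ≠ P.quotient.sink,
      P.quotient.routing (selfFilter P.Root) σ (P.push R) (t + 1) c ≠ none) :
    ∃ π, N.IsFair π ∧ ∀ t,
      (∀ v w, P.arc v = some w → N.routing (selfFilter V) π R t v = some w) ∧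
      P.quotient.routing (selfFilter P.Root) σ (P.push R) t =
        P.push (N.routing (selfFilter V) π R t) ∧
      (1 ≤ t → ∀ c ≠ P.quotient.sink, P.TightAt (N.routing (selfFilter V) π R t) c) := by
  -- The order for a round depends on the routing graph at its start. It is therefore chosen for all
  -- graphs `Q` at once, as the empty list where the premises fail, and the sequence is then defined
  -- by recursion.
  have hlift : ∀ (t : ℕ) (Q : RoutingGraph V), ∃ l : List V, N.Compatible Q →
      (∀ v w, P.arc v = some w → Q v = some w) →
      P.quotient.routing (selfFilter P.Root) σ (P.push R) t = P.push Q →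
      l.Nodup ∧ (∀ v, v ∈ l ↔ v ≠ N.sink) ∧ ∃ Q',
        Q' = (l.foldl (N.activate (selfFilter V)) (N.verified Q)).next ∧
        (∀ v w, P.arc v = some w → Q' v = some w) ∧
        P.quotient.routing (selfFilter P.Root) σ (P.push R) (t + 1) = P.push Q' ∧
        ∀ c ≠ P.quotient.sink, P.TightAt Q' c := by
    intro t Q
    by_cases h : N.Compatible Q ∧ (∀ v w, P.arc v = some w → Q v = some w) ∧
      P.quotient.routing (selfFilter P.Root) σ (P.push R) t = P.push Q
    · obtain ⟨hQ, hFQ, he⟩ := h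
      have hs' := hs t
      rw [routing, he] at hs' ⊢
      obtain ⟨l, hl⟩ := exists_order hQ hFQ (hσ t).1 (hσ t).2 hs'
      exact ⟨l, fun _ _ _ => hl⟩
    · exact ⟨[], fun h₁ h₂ h₃ => absurd ⟨h₁, h₂, h₃⟩ h⟩
  choose L hL using hlift
  let Q : ℕ → RoutingGraph V := fun t => Nat.rec R
    (fun t Q => ((L t Q).foldl (N.activate (selfFilter V)) (N.verified Q)).next) t
  have hQ : ∀ t, N.routing (selfFilter V) (fun t => L t (Q t)) R t = Q t := by
    intro t
    induction t with
    | zero => rfl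
    | succ t ih => rw [routing, ih]
  have hinv : ∀ t, N.Compatible (Q t) ∧ (∀ v w, P.arc v = some w → Q t v = some w) ∧
      P.quotient.routing (selfFilter P.Root) σ (P.push R) t = P.push (Q t) := by
    intro t
    induction t with
    | zero => exact ⟨hR, hF, rfl⟩
    | succ t ih =>
      obtain ⟨-, -, Q', rfl, h₁, h₂, -⟩ := hL t (Q t) ih.1 ih.2.1 ih.2.2
      exact ⟨Compatible.foldl_activate (s := N.verified (Q t)) ih.1 _, h₁, h₂⟩
  refine ⟨fun t => L t (Q t), fun t => ?_, fun t => ?_⟩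
  · obtain ⟨h₁, h₂, -⟩ := hL t (Q t) (hinv t).1 (hinv t).2.1 (hinv t).2.2
    exact ⟨h₁, h₂⟩
  · rw [hQ]
    refine ⟨(hinv t).2.1, (hinv t).2.2, fun ht => ?_⟩
    cases t with
    | zero => omega
    | succ t =>
      obtain ⟨-, -, Q', rfl, -, -, h⟩ := hL t (Q t) (hinv t).1 (hinv t).2.1 (hinv t).2.2
      exact h

end Forest

theorem routing_cons (D : V → Set V) (l : List V) (π : ℕ → List V) (R₀ : RoutingGraph V) (t : ℕ) :
    N.routing D (fun t => Nat.casesOn t l π) R₀ (t + 1) =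
      N.routing D π (l.foldl (N.activate D) (N.verified R₀)).next t := by
  induction t with
  | zero => rfl
  | succ t ih => rw [routing, ih]; rfl

/-- A good round is followed by the lifted sequence of the network of trees that it creates. -/
theorem settles {V : Type*} [Fintype V] [DecidableEq V] {N : Network V} {R₀ : RoutingGraph V}
    (hR₀ : N.Compatible R₀) : N.Settles R₀ := by
  classical
  induction hn : Fintype.card V using Nat.strong_induction_on generalizing V with
  | _ n ih =>
  subst hn
  by_cases hcard : Fintype.card V < 2
  · have : Subsingleton V := Fintype.card_le_one_iff_subsingleton.1 (by omega)
    exact settles_of_subsingleton hR₀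
  push Not at hcard
  obtain ⟨l, hl, hlm, F, hF, hgood⟩ := hasGoodRound hR₀ hcard
  obtain ⟨P, rfl⟩ := hF.exists_forest
  set R := (l.foldl (N.activate (selfFilter V)) (N.verified R₀)).next with hRdef
  have : Fintype P.Root := Fintype.ofFinite _
  have hsum := P.card_root_add
  have hpos : 0 < Fintype.card P.Root := Fintype.card_pos_iff.2 ⟨P.quotient.sink⟩
  obtain ⟨σ, hσ, hσne, hσst, hσcard⟩ := ih (Fintype.card P.Root)
    (by rcases hgood with h | h <;> omega)
    (Forest.compatible_push (P := P) hF.compat) rfl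
  obtain ⟨π, hπ, hsim⟩ := Forest.exists_sequence hF.compat hF.sub hσ hσne
  have hcompat := fun t => Compatible.routing (D := selfFilter V) (π := π) hF.compat t
  have hfair : N.IsFair (fun t => Nat.casesOn t l π) := by
    intro t
    cases t with
    | zero => exact ⟨hl, hlm⟩
    | succ t => exact hπ t
  have hperf : Fintype.card P.Root = 1 → ∀ v, R.Leads v N.sink := by
    intro h1 v
    have := Fintype.card_le_one_iff_subsingleton.1 h1.le
    have hv := (P.leads_root v).mono hF.sub
    rwa [Subsingleton.elim (P.root v) P.quotient.sink] at hv
  refine ⟨fun t => Nat.casesOn t l π, hfair, fun t v hv => ?_, ?_, ?_⟩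
  · rw [routing_cons, ← hRdef]
    cases hPv : P.arc v with
    | some w => rw [(hsim t).1 v w hPv]; simp
    | none =>
      cases t with
      | zero => exact hF.next_ne_none v hv
      | succ t =>
        have := hσne t ⟨v, hPv⟩ (fun h => hv (congrArg Subtype.val h))
        rw [(hsim (t + 1)).2.1] at this
        simpa [Forest.push] using this
  · have hst : N.IsStableSpanningTree
        (N.routing (selfFilter V) π R (Fintype.card P.Root - 1)) := by
      have h := hsim (Fintype.card P.Root - 1)
      refine Forest.isStableSpanningTree_of_push (hcompat _) h.1 (fun c hc => ?_) (h.2.1 ▸ hσst)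
      by_cases h1 : Fintype.card P.Root = 1
      · have := Fintype.card_le_one_iff_subsingleton.1 h1.le
        exact absurd (Subsingleton.elim _ _) hc
      · exact h.2.2 (by omega) c hc
    rw [← routing_cons (π := π)] at hst
    -- At least one arc is fixed, so the good round and the `card P.Root - 1` lifted rounds make at
    -- most `card V - 1`.
    rw [routing_eq_of_stable hfair hst (by rcases hgood with h | h <;> omega)]
    exact hst
  · set S : Set ℕ := {t : ℕ | 1 ≤ t ∧
      P.quotient.IsImperfect (P.quotient.routing (selfFilter P.Root) σ (P.push R) t)} with hS
    have himp : ∀ t,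
        N.IsImperfect (N.routing (selfFilter V) (fun t => Nat.casesOn t l π) R₀ (t + 1)) →
          t = 0 ∧ N.IsImperfect R ∨ t ∈ S := by
      intro t ht
      rw [routing_cons] at ht
      cases t with
      | zero => exact .inl ⟨rfl, ht⟩
      | succ t =>
        refine .inr ⟨by omega, ?_⟩
        rw [(hsim _).2.1]
        exact (Forest.isImperfect_push_iff (hcompat _) (hsim _).1).2 ht
    have himg : ((· + 1) '' S).encard ≤ (((Fintype.card P.Root - 2) / 3 : ℕ) : ℕ∞) :=
      (Set.encard_image_le _ _).trans hσcard
    by_cases hRi : N.IsImperfect R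
    · have h3 : 3 ≤ {v | P.arc v ≠ none}.ncard := by
        rcases hgood with h | h
        · exact absurd hRi ((not_isImperfect_iff hF.compat).2 h.1)
        · exact h
      -- A single tree would make the round perfect. So at least two trees remain, `card P.Root - 2`
      -- is not truncated, and the loss of three nodes pays for this imperfect round.
      have h1 : Fintype.card P.Root ≠ 1 := fun h1 =>
        (not_isImperfect_iff hF.compat).2 (hperf h1) hRi
      calc _ ≤ (insert 1 ((· + 1) '' S)).encard := by
            refine Set.encard_le_encard ?_
            rintro t ⟨ht, hti⟩
            obtain ⟨t, rfl⟩ := Nat.exists_eq_add_of_le' ht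
            rcases himp t hti with ⟨rfl, -⟩ | h
            · exact .inl rfl
            · exact .inr ⟨t, h, rfl⟩
        _ ≤ ((· + 1) '' S).encard + 1 := Set.encard_insert_le _ _
        _ ≤ (((Fintype.card P.Root - 2) / 3 : ℕ) : ℕ∞) + 1 := by gcongr
        _ ≤ _ := by
            norm_cast
            omega
    · calc _ ≤ ((· + 1) '' S).encard := by
            refine Set.encard_le_encard ?_
            rintro t ⟨ht, hti⟩
            obtain ⟨t, rfl⟩ := Nat.exists_eq_add_of_le' ht
            rcases himp t hti with ⟨-, h⟩ | h
            · exact absurd h hRi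
            · exact ⟨t, h, rfl⟩
        _ ≤ _ := himg
        _ ≤ _ := by
            norm_cast
            omega

omit [DecidableEq V] in
/-- A packet that has passed a perfect round is at the sink. -/
theorem allRoutedBy_of_not_isImperfect {R : ℕ → RoutingGraph V} (hR : ∀ t, N.Compatible (R t))
    {t m : ℕ} (ht : 1 ≤ t) (htm : t ≤ m) (h : ¬ N.IsImperfect (R t)) :
    N.AllRoutedBy R m := by
  intro p hp
  induction m, htm using Nat.le_induction with
  | base =>
    obtain ⟨t, rfl⟩ := Nat.exists_eq_add_of_le' ht
    obtain ⟨k, hk⟩ := hp t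
    rw [hk]
    exact RoutingGraph.iterate_hop_card_add (hR _).sink_eq_none
      ((not_isImperfect_iff (hR _)).1 h _) k
  | succ m _ ih =>
    obtain ⟨k, hk⟩ := hp m
    rw [hk, ih]
    exact RoutingGraph.iterate_hop_of_next_none (hR _).sink_eq_none _

end Network

theorem mainTheorem3 {V : Type*} [Fintype V] [DecidableEq V] (N : Network V)
    (D : V → Set V) (hD : ∀ v, D v = {v})
    (R₀ : RoutingGraph V) (hR₀ : N.Compatible R₀) :
    ∃ π : ℕ → List V, N.IsFair π ∧
      N.AllRoutedBy (N.routing D π R₀) ((Fintype.card V + 1) / 3) ∧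
      (N.IsStableSpanningTree (N.routing D π R₀ (Fintype.card V)) ∧
        ∀ t, Fintype.card V ≤ t →
          N.routing D π R₀ t = N.routing D π R₀ (Fintype.card V)) ∧
      {t : ℕ | 1 ≤ t ∧ N.IsImperfect (N.routing D π R₀ t)}.encard ≤
        ((Fintype.card V / 3 : ℕ) : ℕ∞) ∧
      (∀ t, 1 ≤ t → N.IsStableSpanningTree (N.routing D π R₀ t) →
        N.AllRoutedBy (N.routing D π R₀) t) := by
  obtain rfl : D = Network.selfFilter V := funext hD
  obtain ⟨π, hπ, -, hst, hcard⟩ := Network.settles hR₀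
  have hcompat : ∀ t, N.Compatible (N.routing (Network.selfFilter V) π R₀ t) := hR₀.routing
  have hn := Network.routing_eq_of_stable hπ hst (Nat.sub_le (Fintype.card V) 1)
  refine ⟨π, hπ, ?_, ⟨hn ▸ hst, fun t ht => ?_⟩, hcard.trans ?_, fun t ht h => ?_⟩
  · by_cases h1 : Fintype.card V ≤ 1
    · have := Fintype.card_le_one_iff_subsingleton.1 h1
      exact fun p _ => Subsingleton.elim _ _
    · obtain ⟨t, ht, htm, hp⟩ : ∃ t, 1 ≤ t ∧ t ≤ (Fintype.card V + 1) / 3 ∧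
          ¬ N.IsImperfect (N.routing (Network.selfFilter V) π R₀ t) := by
        -- For `n ≥ 2` there are `(n + 1) / 3 = (n - 2) / 3 + 1` rounds up to the deadline, too many
        -- to be all imperfect.
        by_contra! hall
        have hle : (Set.Icc 1 ((Fintype.card V + 1) / 3)).encard ≤
            (((Fintype.card V - 2) / 3 : ℕ) : ℕ∞) :=
          le_trans (Set.encard_le_encard fun t ht => And.intro ht.1 (hall t ht.1 ht.2)) hcard
        rw [← Finset.coe_Icc, Set.encard_coe_eq_coe_finsetCard, Nat.card_Icc, Nat.cast_le] at hle
        omega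
      exact Network.allRoutedBy_of_not_isImperfect hcompat ht htm hp
  · rw [hn, Network.routing_eq_of_stable hπ hst (by omega)]
  · norm_cast
    omega
  · exact Network.allRoutedBy_of_not_isImperfect hcompat ht le_rfl h.not_isImperfect
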